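/- Let $\mathbb T^2=(\mathbb R/2\pi\mathbb Z)^2$, and write $\|f\|_{H^s}^2=\sum_{n\in\mathbb Z^2}(1+|n|^2)^{s}|\hat f(n)|^2$. On a probability space $(\Omega,\mathcal F,\mathbb P)$ let $(g_n)_{n\in\mathbb Z^2\setminus\{0\}}$ be standard complex Gaussians ($\mathbb E|g_n|^2=1$), independent modulo the relation $\overline{g_n}=g_{-n}$. Let $\chi:\mathbb R^2\to\mathbb R$ be smooth, supported in $\{|x|<1/2\}$, with $\int\chi=1$, and let $\rho(\eta)=\int_{\mathbb R^2}\chi(x)e^{-ix\cdot\eta}\,dx$. For $\varepsilon\in(0,1)$ set $$Y=-\sum_{n\ne0}\frac{g_n}{|n|^2}e^{in\cdot x},\qquad Y_\varepsilon=-\sum_{n\neq 0}\rho(\varepsilon n)\frac{g_n}{|n|^2}e^{in\cdot x},\qquad C_\varepsilon=\sum_{n\ne0}\frac{\rho(\varepsilon n)^2}{|n|^2},\qquad {:}|\nabla Y_\varepsilon|^2{:}=|\nabla Y_\varepsilon|^2-C_\varepsilon .$$ Let $p\in[2,3]$, $\lambda\le0$, and let $u_0=u_0(x,\omega)$ be a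 (possibly random) function such that $e^{Y}u_0\in H^2(\mathbb T^2)$ almost surely. For $\varepsilon\in(0,1)$ let $v_\varepsilon(t,x,\omega)$ denote the global solution in $C(\mathbb R;H^2(\mathbb T^2))\cap C^1(\mathbb R;L^2(\mathbb T^2))$ of $$i\partial_t v_\varepsilon=\Delta v_\varepsilon-2\nabla v_\varepsilon\cdot\nabla Y_\varepsilon+v_\varepsilon\,{:}|\nabla Y_\varepsilon|^2{:}+\lambda e^{-pY_\varepsilon}v_\varepsilon|v_\varepsilon|^p,\qquad v_\varepsilon(0)=e^{Y}u_0 .$$ Then for every event $\Sigma_0$ with $\mathbb P(\Sigma_0)=1$ there is an event $\Sigma\subset\Sigma_0$ with $\mathbb P(\Sigma)=1$ such that for every $\omega\in\Sigma$ there is a finite constant $C(\omega)>0$ with $$\sup_{\varepsilon\in(0,1),\ t\in\mathbb R}\|v_\varepsilon(t,\cdot,\omega)\|_{H^1}<C(\omega)\qquad\text{and}\qquad \|e^{Y(\cdot,\omega)}u_0(\cdot,\omega)\|_{H^2}<C(\omega).$$ (The supremum is taken over all such solutions $v_\varepsilon$; their existence and uniqueness are not part of the claim.) -/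

import Mathlib

open MeasureTheory ProbabilityTheory UnitAddTorus Filter Topology
open scoped ENNReal NNReal ComplexConjugate

/- The torus carries the Haar probability measure, as in Mathlib's theory of multivariate Fourier
series. -/
attribute [local instance] instMeasureSpaceUnitAddCircle
  instIsAddHaarMeasureUnitAddCircleVolume instIsProbabilityMeasureUnitAddCircleVolume

namespace GaugedNLS

noncomputable section

/-- The flat torus `𝕋² = (ℝ / 2πℤ)²`. The point of `𝕋²` with angular coordinates `x ∈ (-π, π)²` is
represented by `x / 2π ∈ (ℝ / ℤ)²`, so that `mFourier n` is the character `x ↦ exp (i n · x)`;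
all derivatives below are taken with respect to the angular coordinates `x`. -/
abbrev T2 : Type := UnitAddTorus (Fin 2)

/-- Complex-valued `L²(𝕋²)`. -/
abbrev L2 : Type := Lp ℂ 2 (volume : Measure T2)

/-- The square `|n|²` of the Euclidean length of a frequency `n ∈ ℤ²`. -/
def normSq (n : Fin 2 → ℤ) : ℝ := ∑ j, (n j : ℝ) ^ 2

/-! ### Sobolev norms and differential operators -/

/-- The norm `‖f‖_{H^s} = ‖D^s f‖_{L²} = (∑ₙ ⟨n⟩^{2s} |f̂(n)|²)^{1/2}`, where
`⟨n⟩² = 1 + |n|²`, of a square-integrable function `f`; it is `∞` if `f ∉ H^s`. (The `L²`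
norm is that of the normalised Lebesgue measure.) -/
def sobolevNorm (s : ℝ) (f : T2 → ℂ) : ℝ≥0∞ :=
  (∑' n : Fin 2 → ℤ, ENNReal.ofReal ((1 + normSq n) ^ s * ‖mFourierCoeff f n‖ ^ 2)) ^ (1 / 2 : ℝ)

/-- `f ∈ H^s(𝕋²)`, for `s ≥ 0`. -/
def MemSobolev (s : ℝ) (f : T2 → ℂ) : Prop :=
  MemLp f 2 volume ∧ sobolevNorm s f < ∞

/-- The Fourier multiplier `∑ₙ f̂(n) exp (i n · x) ↦ ∑ₙ m(n) f̂(n) exp (i n · x)`, the series being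
summed in `L²(𝕋²)`. -/
def fourierMultiplier (m : (Fin 2 → ℤ) → ℂ) (f : L2) : L2 :=
  ∑' n : Fin 2 → ℤ, (m n * mFourierCoeff f n) • mFourierLp 2 n

/-- The partial derivative `∂ⱼ f`, for `f ∈ H¹(𝕋²)`. -/
def partialDeriv (j : Fin 2) (f : L2) : L2 :=
  fourierMultiplier (fun n => Complex.I * (n j : ℂ)) f

/-- The Laplacian `Δ f`, for `f ∈ H²(𝕋²)`. -/
def laplacian (f : L2) : L2 :=
  fourierMultiplier (fun n => -(normSq n : ℂ)) f

/-! ### The white noise and the potentials -/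

/-- The law of a standard complex Gaussian `g = a + i b`: `a` and `b` are independent centred real
Gaussians of variance `1 / 2`, so that `𝔼 |g|² = 1`. -/
def stdComplexGaussian : Measure ℂ :=
  ((gaussianReal 0 (1 / 2)).prod (gaussianReal 0 (1 / 2))).map
    (fun z : ℝ × ℝ => (z.1 : ℂ) + (z.2 : ℂ) * Complex.I)

/-- `(gₙ)`, `n ∈ ℤ² \ {0}`, are standard complex Gaussians which are independent modulo the
relation `conj gₙ = g₋ₙ`: the variables indexed by any set of frequencies that does not contain
two opposite ones are independent. They are the Fourier coefficients of a real spatial white noise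
`ξ = ∑_{n ≠ 0} gₙ exp (i n · x)` of mean zero. The value of `g` at `0` plays no role. -/
structure IsWhiteNoise {Ω : Type*} [MeasurableSpace Ω] (P : Measure Ω)
    (g : (Fin 2 → ℤ) → Ω → ℂ) : Prop where
  measurable : ∀ n, n ≠ 0 → Measurable (g n)
  law : ∀ n, n ≠ 0 → P.map (g n) = stdComplexGaussian
  conj_symm : ∀ n, n ≠ 0 → ∀ᵐ ω ∂P, conj (g n ω) = g (-n) ω
  indep : ∀ S : Set (Fin 2 → ℤ), (∀ n ∈ S, -n ∉ S) → iIndepFun (fun n : S => g n) P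

/-- `χ : ℝ² → ℝ` is smooth, supported in `{|x| < 1/2}` and has integral one. -/
structure IsMollifier (χ : EuclideanSpace ℝ (Fin 2) → ℝ) : Prop where
  smooth : ContDiff ℝ ((⊤ : ℕ∞) : WithTop ℕ∞) χ
  support_subset : Function.support χ ⊆ Metric.ball 0 (1 / 2)
  integral_eq_one : ∫ x, χ x = 1

/-- The Fourier transform `ρ(η) = ∫_{ℝ²} χ(x) exp (-i x · η) dx`. -/
def rho (χ : EuclideanSpace ℝ (Fin 2) → ℝ) (η : Fin 2 → ℝ) : ℂ :=
  ∫ x : EuclideanSpace ℝ (Fin 2), (χ x : ℂ) * Complex.exp (-(Complex.I * ∑ j, (x j * η j : ℂ)))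

/-- `ρ(ε n)`. -/
def rhoAt (χ : EuclideanSpace ℝ (Fin 2) → ℝ) (ε : ℝ) (n : Fin 2 → ℤ) : ℂ :=
  rho χ (fun j => ε * (n j : ℝ))

/-- The Fourier coefficients of `Y = Δ⁻¹ ξ`, namely `-gₙ / |n|²` for `n ≠ 0`, and `0` for
`n = 0`. Here `g` is one realisation of the Gaussians. -/
def YCoeff (g : (Fin 2 → ℤ) → ℂ) (n : Fin 2 → ℤ) : ℂ :=
  if n = 0 then 0 else -(g n / (normSq n : ℂ))

/-- `Y = -∑_{n ≠ 0} gₙ / |n|² exp (i n · x)`, the series being summed in `L²(𝕋²)`. -/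
def Y (g : (Fin 2 → ℤ) → ℂ) : L2 :=
  ∑' n : Fin 2 → ℤ, YCoeff g n • mFourierLp 2 n

/-- `Y_ε(x) = -∑_{n ≠ 0} ρ(ε n) gₙ / |n|² exp (i n · x)`. -/
def Yeps (χ : EuclideanSpace ℝ (Fin 2) → ℝ) (ε : ℝ) (g : (Fin 2 → ℤ) → ℂ) (x : T2) : ℂ :=
  ∑' n : Fin 2 → ℤ, rhoAt χ ε n * YCoeff g n * mFourier n x

/-- The partial derivative `∂ⱼ Y_ε` of the smooth function `Y_ε`, i.e. its (rapidly convergent)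
Fourier series differentiated term by term. -/
def partialYeps (χ : EuclideanSpace ℝ (Fin 2) → ℝ) (ε : ℝ) (g : (Fin 2 → ℤ) → ℂ) (j : Fin 2)
    (x : T2) : ℂ :=
  ∑' n : Fin 2 → ℤ, rhoAt χ ε n * YCoeff g n * (Complex.I * (n j : ℂ)) * mFourier n x

/-- The renormalisation constant `C_ε = ∑_{n ≠ 0} ρ(ε n)² / |n|²`. -/
def Ceps (χ : EuclideanSpace ℝ (Fin 2) → ℝ) (ε : ℝ) : ℂ :=
  ∑' n : Fin 2 → ℤ, if n = 0 then 0 else rhoAt χ ε n ^ 2 / (normSq n : ℂ)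

/-- The renormalised potential `:|∇Y_ε|²: = |∇Y_ε|² - C_ε`. -/
def wickSq (χ : EuclideanSpace ℝ (Fin 2) → ℝ) (ε : ℝ) (g : (Fin 2 → ℤ) → ℂ) (x : T2) : ℂ :=
  ((∑ j, ‖partialYeps χ ε g j x‖ ^ 2 : ℝ) : ℂ) - Ceps χ ε

/-! ### The gauged equation -/

/-- The datum `e^Y u₀`. -/
def gaugedDatum (g : (Fin 2 → ℤ) → ℂ) (u₀ : T2 → ℂ) (x : T2) : ℂ :=
  Complex.exp (Y g x) * u₀ x

/-- `v` is a global solution in `C(ℝ; H²) ∩ C¹(ℝ; L²)` of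
`i ∂ₜ v = Δ v - 2 ∇v · ∇Y_ε + v :|∇Y_ε|²: + λ e^{-p Y_ε} v |v|^p`, `v(0) = v₀`: the time derivative
exists in `L²(𝕋²)` at every time, and the equation holds in `L²(𝕋²)` at every time. (Continuity of
the time derivative follows from the equation.) -/
structure IsGaugedSolution (χ : EuclideanSpace ℝ (Fin 2) → ℝ) (ε : ℝ) (g : (Fin 2 → ℤ) → ℂ)
    (p lam : ℝ) (v₀ : T2 → ℂ) (v : ℝ → L2) : Prop where
  mem_H2 : ∀ t, MemSobolev 2 (v t)
  continuous_H2 : ∀ t₀, Tendsto (fun t => sobolevNorm 2 (v t - v t₀ : L2)) (𝓝 t₀) (𝓝 0)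
  initial : v 0 =ᵐ[volume] v₀
  differentiable : Differentiable ℝ v
  equation : ∀ t, ∀ᵐ x : T2, Complex.I * deriv v t x =
    laplacian (v t) x
      - 2 * ∑ j, partialDeriv j (v t) x * partialYeps χ ε g j x
      + v t x * wickSq χ ε g x
      + lam * Complex.exp (-(p * Yeps χ ε g x)) * v t x * ((‖v t x‖ ^ p : ℝ) : ℂ)

end

end GaugedNLS

open GaugedNLS

/-!
The estimate is deterministic once the noise is fixed. The weight `w = exp (-2 Y_ε)` puts the
equation in divergence form, `i w ∂ₜ v = ∑ⱼ ∂ⱼ (w ∂ⱼ v) + w W v + λ w exp (-p Y_ε) |v|^p v`, with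
a real potential `W = |∇Y_ε|² - C_ε`. Hence the mass `∫ w |v|²` and the energy
`∫ w |∇v|² - ∫ w W |v|² - (2 λ / (p + 2)) ∫ w exp (-p Y_ε) |v|^(p + 2)`
are conserved (`IsFlow.mass_eq`, `IsFlow.energy_eq`). The solution is only differentiable
in `L²`, so the energy is not differentiated under the integral sign: increments of the Dirichlet form are
`-Re ⟪v - v₀, L v + L v₀⟫` with `L = ∑ⱼ ∂ⱼ w ∂ⱼ`, and `L v` is continuous in `L²`
because `v` is continuous in `H²`; the nonlinear energy is compared with a quadratic form by a second-order Taylor estimate.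

Since `λ ≤ 0` the nonlinear energy is nonnegative, and a constant added to `W` changes the energy
by a multiple of the mass. Therefore neither `C_ε` nor the mean of `|∇Y_ε|²` matters, and it
suffices that the nonconstant part of `|∇Y_ε|²` is a form perturbation of the Dirichlet form with
relative bound zero, uniformly in `ε` (`exists_form_bound`). By duality this follows from a bound
for that part in `H^{-1/4}` and a bound for `w |v|²` in `H^{1/4}`. The latter is measured by
dyadic translations (`exists_sum_rpow_norm_mul_le`): translations of `v` are controlled in `L⁴` by
the embedding of `H^{5/8}` (`integral_norm_pow_four_le`), which gives `‖v‖_{H¹} ‖v‖_{H^{5/8}}`,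
and translations of the weight by the Hölder regularity of `Y_ε`.

The probabilistic input is collected in `GoodRealisation` and holds almost surely
(`IsWhiteNoise.ae_goodRealisation`). All of it comes from one second-moment bound for quadratic
expressions in the Gaussians (`IsWhiteNoise.lintegral_chaos_le`). Sup norms over dyadic frequency
blocks are dominated by the sum of the Fourier coefficients of the squared block, which are
quadratic; the mollification is convolution with an integrable kernel and preserves these bounds.
The Fourier coefficients of `|∇Y_ε|²` are quadratic too, and they are bounded uniformly in `ε` by
integrating their derivative in `ε`. So only uniform bounds are needed, and no convergence as
`ε → 0`.
-/

namespace GaugedNLS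

noncomputable section

/-! ### Moments of the Gaussian coefficients -/

lemma map_I_mul_stdComplexGaussian :
    stdComplexGaussian.map (fun z => Complex.I * z) = stdComplexGaussian := by
  unfold stdComplexGaussian
  set γ := gaussianReal 0 (1 / 2)
  have h1 : (γ.prod γ).map (fun z : ℝ × ℝ => (-z.2, z.1)) = γ.prod γ := by
    have : (fun z : ℝ × ℝ => (-z.2, z.1)) = Prod.map (fun x : ℝ => -x) id ∘ Prod.swap := by
      ext z <;> simp
    rw [this, ← Measure.map_map (by fun_prop) measurable_swap, Measure.prod_swap,
      ← Measure.map_prod_map _ _ (by fun_prop) (by fun_prop), gaussianReal_map_neg]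
    simp [γ]
  rw [Measure.map_map (by fun_prop) (by fun_prop)]
  conv_rhs => rw [← h1, Measure.map_map (by fun_prop) (by fun_prop)]
  congr 1
  ext z
  simp only [Function.comp]
  push_cast
  linear_combination (z.2 : ℂ) * Complex.I_mul_I

lemma memLp_id_stdComplexGaussian : MemLp (fun z : ℂ => z) 4 stdComplexGaussian := by
  unfold stdComplexGaussian
  rw [memLp_map_measure_iff (by fun_prop) (by fun_prop)]
  have h : MemLp (fun x : ℝ => x) 4 (gaussianReal 0 (1 / 2)) := by
    simpa using! memLp_id_gaussianReal (μ := 0) (v := 1 / 2) 4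
  have h1 : MemLp (fun z : ℝ × ℝ => z.1) 4
      ((gaussianReal 0 (1 / 2)).prod (gaussianReal 0 (1 / 2))) :=
    h.comp_measurePreserving measurePreserving_fst
  have h2 : MemLp (fun z : ℝ × ℝ => z.2) 4
      ((gaussianReal 0 (1 / 2)).prod (gaussianReal 0 (1 / 2))) :=
    h.comp_measurePreserving measurePreserving_snd
  have h3 := h1.ofReal (K := ℂ)
  have h4 := (h2.ofReal (K := ℂ)).mul_const Complex.I
  exact h3.add h4

/-- The fourth absolute moment of a standard complex Gaussian. -/
def fourthMoment : ℝ := ∫ z, ‖z‖ ^ 4 ∂stdComplexGaussian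

lemma fourthMoment_nonneg : 0 ≤ fourthMoment := integral_nonneg fun _ => by positivity

section WhiteNoise

variable {Ω : Type*} [MeasurableSpace Ω] {P : Measure Ω}
  {g : (Fin 2 → ℤ) → Ω → ℂ}

lemma IsWhiteNoise.memLp (hg : IsWhiteNoise P g) {n : Fin 2 → ℤ} (hn : n ≠ 0) :
    MemLp (g n) 4 P := by
  have h := memLp_id_stdComplexGaussian
  rw [← hg.law n hn, memLp_map_measure_iff (by fun_prop) (hg.measurable n hn).aemeasurable] at h
  exact h

lemma IsWhiteNoise.integrable_pow_four [IsProbabilityMeasure P] (hg : IsWhiteNoise P g)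
    {n : Fin 2 → ℤ} (hn : n ≠ 0) :
    Integrable (fun ω => ‖g n ω‖ ^ 4) P :=
  (hg.memLp hn).integrable_norm_pow (by norm_num)

lemma IsWhiteNoise.integral_pow_four (hg : IsWhiteNoise P g) {n : Fin 2 → ℤ} (hn : n ≠ 0) :
    ∫ ω, ‖g n ω‖ ^ 4 ∂P = fourthMoment := by
  rw [fourthMoment, ← hg.law n hn,
    integral_map (hg.measurable n hn).aemeasurable (by fun_prop)]

/-- A half of the lattice extends to all nonzero frequencies through the relation
`conj gₙ = g₋ₙ`. -/
def halfExtend (S : Set (Fin 2 → ℤ)) (z : S → ℂ) (n : Fin 2 → ℤ) : ℂ := by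
  classical exact if h : n ∈ S then z ⟨n, h⟩ else if h' : -n ∈ S then conj (z ⟨-n, h'⟩) else 0

lemma measurable_halfExtend (S : Set (Fin 2 → ℤ)) (n : Fin 2 → ℤ) :
    Measurable (fun z : S → ℂ => halfExtend S z n) := by
  unfold halfExtend
  split_ifs
  · fun_prop
  · exact Complex.continuous_conj.measurable.comp (measurable_pi_apply _)
  · fun_prop

/-- The factor by which `gₙ` changes when `gₘ` is multiplied by `i`, and hence `g₋ₘ` by `-i`. -/
def phase (m n : Fin 2 → ℤ) : ℂ := if n = m then Complex.I else if n = -m then -Complex.I else 1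

lemma halfExtend_rotate {S : Set (Fin 2 → ℤ)} (hS : ∀ n ∈ S, -n ∉ S) {m : Fin 2 → ℤ} (hm : m ∈ S)
    (z : S → ℂ) (n : Fin 2 → ℤ) :
    halfExtend S (fun k => if (k : Fin 2 → ℤ) = m then Complex.I * z k else z k) n
      = phase m n * halfExtend S z n := by
  unfold halfExtend phase
  by_cases h : n ∈ S
  · have h2 : n ≠ -m := fun h' => hS m hm (h' ▸ h)
    simp only [h, dif_pos]
    split_ifs <;> simp_all
  · by_cases h' : -n ∈ S
    · have h2 : n ≠ m := fun e => h (e ▸ hm)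
      simp only [h, h', dif_pos, dif_neg, not_false_eq_true, if_neg h2, neg_eq_iff_eq_neg]
      split_ifs <;> simp
    · simp [h, h']

/-- The joint law of the white noise is invariant under the rotation of one coordinate. -/
lemma IsWhiteNoise.map_rotate [IsProbabilityMeasure P] (hg : IsWhiteNoise P g) {S : Set (Fin 2 → ℤ)}
    (hS : ∀ n ∈ S, -n ∉ S) (hS0 : (0 : Fin 2 → ℤ) ∉ S) (m : Fin 2 → ℤ) :
    P.map (fun ω (k : S) => if (k : Fin 2 → ℤ) = m then Complex.I * g k ω else g k ω)
      = P.map (fun ω (k : S) => g k ω) := by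
  have hne : ∀ k : S, (k : Fin 2 → ℤ) ≠ 0 := fun k h => hS0 (h ▸ k.2)
  have hmeas : ∀ k : S, Measurable (g k) := fun k => hg.measurable k (hne k)
  have hind := hg.indep S hS
  let φ : S → ℂ → ℂ := fun k z => if (k : Fin 2 → ℤ) = m then Complex.I * z else z
  have hφ : ∀ k, Measurable (φ k) := by
    intro k; unfold φ; split_ifs <;> fun_prop
  have hind' : iIndepFun (fun k : S => φ k ∘ g k) P := hind.comp φ hφ
  rw [iIndepFun_iff_map_fun_eq_infinitePi_map hmeas] at hind
  rw [iIndepFun_iff_map_fun_eq_infinitePi_map (fun k => (hφ k).comp (hmeas k))] at hind'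
  have e : (fun ω (k : S) => if (k : Fin 2 → ℤ) = m then Complex.I * g k ω else g k ω)
      = fun ω (k : S) => (φ k ∘ g k) ω := by
    ext ω k; simp only [φ, Function.comp]
  rw [e, hind', hind]
  congr 1
  ext k : 1
  rw [← Measure.map_map (hφ k) (hmeas k), hg.law k (hne k)]
  by_cases h : (k : Fin 2 → ℤ) = m
  · simp only [φ, h, if_true]; exact map_I_mul_stdComplexGaussian
  · simp only [φ, h, if_false]; exact Measure.map_id

/-- A set containing exactly one of `n`, `-n` for each `n ≠ 0`. -/
def halfLattice : Set (Fin 2 → ℤ) := {n | 0 < n 0 ∨ (n 0 = 0 ∧ 0 < n 1)}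

/-- One of the half lattice and its negative contains `a`. -/
lemma exists_halfLattice {a : Fin 2 → ℤ} (ha : a ≠ 0) :
    ∃ S : Set (Fin 2 → ℤ), a ∈ S ∧ (∀ n ∈ S, -n ∉ S) ∧ (0 : Fin 2 → ℤ) ∉ S ∧
      ∀ n, n ≠ 0 → n ∈ S ∨ -n ∈ S := by
  have key : ∀ n : Fin 2 → ℤ, n ≠ 0 → n ∈ halfLattice ∨ -n ∈ halfLattice := by
    intro n hn
    have : n 0 ≠ 0 ∨ n 1 ≠ 0 := by
      by_contra! h
      apply hn; ext i; fin_cases i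
      · exact h.1
      · exact h.2
    simp only [halfLattice, Set.mem_ofPred_eq, Pi.neg_apply]
    omega
  have key2 : ∀ n ∈ halfLattice, -n ∉ halfLattice := by
    intro n hn
    simp only [halfLattice, Set.mem_ofPred_eq, Pi.neg_apply] at hn ⊢
    omega
  have key0 : (0 : Fin 2 → ℤ) ∉ halfLattice := by simp [halfLattice]
  rcases key a ha with h | h
  · exact ⟨halfLattice, h, key2, key0, key⟩
  · refine ⟨{n | -n ∈ halfLattice}, h, fun n hn hn' => ?_, by simpa using key0, fun n hn => ?_⟩
    · simp only [Set.mem_ofPred_eq, neg_neg] at hn hn'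
      exact key2 n hn' hn
    · simpa [or_comm] using key n hn

lemma IsWhiteNoise.ae_eq_halfExtend (hg : IsWhiteNoise P g) {S : Set (Fin 2 → ℤ)}
    (hS : ∀ n, n ≠ 0 → n ∈ S ∨ -n ∈ S) {n : Fin 2 → ℤ} (hn : n ≠ 0) :
    ∀ᵐ ω ∂P, g n ω = halfExtend S (fun k => g k ω) n := by
  have h := hg.conj_symm (-n) (by simpa using hn)
  filter_upwards [h] with ω hω
  unfold halfExtend
  by_cases h1 : n ∈ S
  · simp [h1]
  · have h2 := (hS n hn).resolve_left h1
    simp only [h1, h2, dif_pos, dif_neg, not_false_eq_true]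
    rw [hω, neg_neg]

/-- A monomial of degree four in the Gaussians has mean zero if its phase changes under the rotation
of some `gₘ`. -/
lemma IsWhiteNoise.integral_monomial_eq_zero [IsProbabilityMeasure P] (hg : IsWhiteNoise P g)
    {m a b c d : Fin 2 → ℤ}
    (hm : m ≠ 0) (ha : a ≠ 0) (hb : b ≠ 0) (hc : c ≠ 0) (hd : d ≠ 0)
    (h : phase m a * phase m b * phase m c * phase m d ≠ 1) :
    ∫ ω, g a ω * g b ω * g c ω * g d ω ∂P = 0 := by
  obtain ⟨S, hmS, hS, hS0, hS2⟩ := exists_halfLattice hm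
  let F : (S → ℂ) → ℂ := fun z =>
    halfExtend S z a * halfExtend S z b * halfExtend S z c * halfExtend S z d
  have hF : Measurable F :=
    (((measurable_halfExtend S a).mul (measurable_halfExtend S b)).mul
      (measurable_halfExtend S c)).mul (measurable_halfExtend S d)
  have hne : ∀ k : S, (k : Fin 2 → ℤ) ≠ 0 := fun k h => hS0 (h ▸ k.2)
  have hm1 : Measurable (fun ω (k : S) => g k ω) :=
    measurable_pi_lambda _ fun k => hg.measurable k (hne k)
  have hm2 : Measurable
      (fun ω (k : S) => if (k : Fin 2 → ℤ) = m then Complex.I * g k ω else g k ω) := by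
    refine measurable_pi_lambda _ fun k => ?_
    have := hg.measurable k (hne k)
    split_ifs <;> fun_prop
  have e1 : ∫ ω, g a ω * g b ω * g c ω * g d ω ∂P = ∫ ω, F (fun k => g k ω) ∂P := by
    apply integral_congr_ae
    filter_upwards [hg.ae_eq_halfExtend hS2 ha, hg.ae_eq_halfExtend hS2 hb,
      hg.ae_eq_halfExtend hS2 hc, hg.ae_eq_halfExtend hS2 hd] with ω h1 h2 h3 h4
    simp only [F]
    rw [← h1, ← h2, ← h3, ← h4]
  have e2 : ∫ ω, F (fun k => g k ω) ∂P = ∫ z, F z ∂(P.map (fun ω (k : S) => g k ω)) := by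
    rw [integral_map hm1.aemeasurable hF.aestronglyMeasurable]
  have e3 : ∫ z, F z ∂(P.map (fun ω (k : S) => g k ω))
      = (phase m a * phase m b * phase m c * phase m d) * ∫ ω, F (fun k => g k ω) ∂P := by
    rw [← hg.map_rotate hS hS0 m, integral_map hm2.aemeasurable hF.aestronglyMeasurable,
      ← integral_const_mul]
    congr 1
    ext ω
    have := halfExtend_rotate hS hmS (fun k => g k ω)
    simp only [F, this]
    ring
  rw [e1]
  rw [e3] at e2
  have : (phase m a * phase m b * phase m c * phase m d - 1) * ∫ ω, F (fun k => g k ω) ∂P = 0 := by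
    linear_combination -e2
  exact (mul_eq_zero.1 this).resolve_left (sub_ne_zero.2 h)

/-- Orthogonality in the second chaos: `g_a g_{n-a}` and `g_b g_{n-b}` are orthogonal unless
`b = a` or `b = n - a`, as the rotation of `g_a` shows. -/
lemma IsWhiteNoise.integral_chaos_eq_zero [IsProbabilityMeasure P] (hg : IsWhiteNoise P g)
    {n a b : Fin 2 → ℤ}
    (ha : a ≠ 0) (han : a ≠ n) (hb : b ≠ 0) (hbn : b ≠ n)
    (hab : b ≠ a) (hab' : b ≠ n - a) (hn : n ≠ 0) :
    ∫ ω, g a ω * g (n - a) ω * g (-b) ω * g (-(n - b)) ω ∂P = 0 := by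
  refine hg.integral_monomial_eq_zero ha ha (sub_ne_zero.2 han.symm) (neg_ne_zero.2 hb)
    (neg_ne_zero.2 (sub_ne_zero.2 hbn.symm)) ?_
  -- no two of the phases cancel, so their product is a power of `i` of exponent `1`, `2` or `3`
  have h1 : phase a a = Complex.I := by simp [phase]
  have haa : a ≠ -a := by
    intro h; apply ha; ext i; have := congrFun h i; simp at this ⊢; omega
  have h2 : phase a (n - a) = if n - a = a then Complex.I else 1 := by
    unfold phase
    have : n - a ≠ -a := fun h => hn (by simpa using h)
    simp [this]
  have h3 : phase a (-b) = if -b = a then Complex.I else 1 := by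
    unfold phase
    have : -b ≠ -a := fun h => hab (by simpa using h)
    rw [if_neg this]
  have h4 : phase a (-(n - b)) = if -(n - b) = a then Complex.I else 1 := by
    unfold phase
    have : -(n - b) ≠ -a := fun h => hab' (by have := neg_inj.1 h; rw [← this]; abel)
    rw [if_neg this]
  rw [h1, h2, h3, h4]
  have I2 : Complex.I * Complex.I = -1 := Complex.I_mul_I
  have hI : Complex.I ≠ 1 := fun h => by simpa using congrArg Complex.im h
  have hI' : -Complex.I ≠ 1 := fun h => by simpa using congrArg Complex.im h
  have h5 : (-1 : ℂ) ≠ 1 := by norm_num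
  by_cases c2 : n - a = a <;> by_cases c3 : -b = a <;> by_cases c4 : -(n - b) = a
  · exfalso; apply ha; ext i
    have := congrFun c2 i; have := congrFun c3 i; have := congrFun c4 i
    simp at *; omega
  all_goals simp only [c2, c3, c4, if_true, if_false, mul_one, I2, neg_mul, one_mul]
  all_goals assumption

lemma IsWhiteNoise.ae_conj (hg : IsWhiteNoise P g) :
    ∀ᵐ ω ∂P, ∀ n, n ≠ 0 → conj (g n ω) = g (-n) ω := by
  rw [ae_all_iff]; intro n
  by_cases hn : n = 0
  · simp [hn]
  · filter_upwards [hg.conj_symm n hn] with ω h _ using h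

lemma norm_mul_four_le (a b c d : ℂ) :
    ‖a * b * c * d‖ ≤ (‖a‖ ^ 4 + ‖b‖ ^ 4 + ‖c‖ ^ 4 + ‖d‖ ^ 4) / 4 := by
  rw [norm_mul, norm_mul, norm_mul]
  nlinarith [sq_nonneg (‖a‖ * ‖b‖ - ‖c‖ * ‖d‖), sq_nonneg (‖a‖ ^ 2 - ‖b‖ ^ 2),
    sq_nonneg (‖c‖ ^ 2 - ‖d‖ ^ 2)]

lemma IsWhiteNoise.integrable_monomial [IsProbabilityMeasure P] (hg : IsWhiteNoise P g)
    {a b c d : Fin 2 → ℤ}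
    (ha : a ≠ 0) (hb : b ≠ 0) (hc : c ≠ 0) (hd : d ≠ 0) :
    Integrable (fun ω => g a ω * g b ω * g c ω * g d ω) P := by
  have := hg.measurable a ha
  have := hg.measurable b hb
  have := hg.measurable c hc
  have := hg.measurable d hd
  refine Integrable.mono' (((((hg.integrable_pow_four ha).add (hg.integrable_pow_four hb)).add
    (hg.integrable_pow_four hc)).add (hg.integrable_pow_four hd)).div_const 4)
    (by fun_prop) (ae_of_all _ fun ω => ?_)
  exact norm_mul_four_le _ _ _ _

lemma IsWhiteNoise.norm_integral_monomial_le [IsProbabilityMeasure P] (hg : IsWhiteNoise P g)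
    {a b c d : Fin 2 → ℤ}
    (ha : a ≠ 0) (hb : b ≠ 0) (hc : c ≠ 0) (hd : d ≠ 0) :
    ‖∫ ω, g a ω * g b ω * g c ω * g d ω ∂P‖ ≤ fourthMoment := by
  refine (norm_integral_le_of_norm_le (((((hg.integrable_pow_four ha).add
    (hg.integrable_pow_four hb)).add (hg.integrable_pow_four hc)).add
    (hg.integrable_pow_four hd)).div_const 4)
    (ae_of_all _ fun ω => norm_mul_four_le _ _ _ _)).trans ?_
  have h1 := hg.integrable_pow_four ha
  have h2 := hg.integrable_pow_four hb
  have h3 := hg.integrable_pow_four hc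
  have h4 := hg.integrable_pow_four hd
  rw [integral_div, integral_add' ((h1.add h2).add h3) h4, integral_add' (h1.add h2) h3,
    integral_add' h1 h2, hg.integral_pow_four ha,
    hg.integral_pow_four hb, hg.integral_pow_four hc, hg.integral_pow_four hd]
  linarith

/-- The second moment of an element of the second chaos with frequency `n ≠ 0`: the products
`g_a g_{n-a}` are orthogonal, up to the exchange of `a` and `n - a`. -/
theorem IsWhiteNoise.lintegral_chaos_le [IsProbabilityMeasure P] (hg : IsWhiteNoise P g)
    {n : Fin 2 → ℤ} (hn : n ≠ 0)
    (S : Finset (Fin 2 → ℤ)) (hS : ∀ a ∈ S, a ≠ 0 ∧ a ≠ n) (k : (Fin 2 → ℤ) → ℂ) :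
    ∫⁻ ω, ‖∑ a ∈ S, k a * (g a ω * g (n - a) ω)‖ₑ ^ 2 ∂P
      ≤ ENNReal.ofReal (2 * fourthMoment * ∑ a ∈ S, ‖k a‖ ^ 2) := by
  classical
  set Z : Ω → ℂ := fun ω => ∑ a ∈ S, k a * (g a ω * g (n - a) ω) with hZ
  let X : (Fin 2 → ℤ) → (Fin 2 → ℤ) → Ω → ℂ := fun a b ω =>
    g a ω * g (n - a) ω * g (-b) ω * g (-(n - b)) ω
  have hXi : ∀ a ∈ S, ∀ b ∈ S, Integrable (X a b) P := fun a ha b hb =>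
    hg.integrable_monomial (hS a ha).1 (sub_ne_zero.2 (hS a ha).2.symm) (neg_ne_zero.2 (hS b hb).1)
      (neg_ne_zero.2 (sub_ne_zero.2 (hS b hb).2.symm))
  have hXb : ∀ a ∈ S, ∀ b ∈ S, ‖∫ ω, X a b ω ∂P‖ ≤ fourthMoment := fun a ha b hb =>
    hg.norm_integral_monomial_le (hS a ha).1 (sub_ne_zero.2 (hS a ha).2.symm)
      (neg_ne_zero.2 (hS b hb).1) (neg_ne_zero.2 (sub_ne_zero.2 (hS b hb).2.symm))
  have e1 : ∀ᵐ ω ∂P, ((‖Z ω‖ ^ 2 : ℝ) : ℂ) = ∑ a ∈ S, ∑ b ∈ S, k a * conj (k b) * X a b ω := by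
    filter_upwards [hg.ae_conj] with ω hω
    rw [Complex.ofReal_pow, ← Complex.mul_conj', hZ]
    simp only [map_sum, Finset.sum_mul_sum, map_mul]
    refine Finset.sum_congr rfl fun a ha => Finset.sum_congr rfl fun b hb => ?_
    rw [hω b (hS b hb).1, hω (n - b) (sub_ne_zero.2 (hS b hb).2.symm)]
    simp only [X]; ring
  have hint : Integrable (fun ω => ∑ a ∈ S, ∑ b ∈ S, k a * conj (k b) * X a b ω) P :=
    integrable_finsetSum _ fun a ha => integrable_finsetSum _ fun b hb =>
      (hXi a ha b hb).const_mul _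
  have hintZ : Integrable (fun ω => ‖Z ω‖ ^ 2) P := by
    have h2 := (hint.congr (e1.mono fun ω h => h.symm)).re
    refine h2.congr (ae_of_all _ fun ω => ?_)
    simp only [RCLike.re_to_complex, Complex.ofReal_re]
  have e2 : ∫⁻ ω, ‖Z ω‖ₑ ^ 2 ∂P = ENNReal.ofReal (∫ ω, ‖Z ω‖ ^ 2 ∂P) := by
    rw [ofReal_integral_eq_lintegral_ofReal hintZ (ae_of_all _ fun ω => by positivity)]
    refine lintegral_congr fun ω => ?_
    rw [ENNReal.ofReal_pow (norm_nonneg _), ofReal_norm]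
  rw [e2]
  apply ENNReal.ofReal_le_ofReal
  have e3 : ((∫ ω, ‖Z ω‖ ^ 2 ∂P : ℝ) : ℂ)
      = ∑ a ∈ S, ∑ b ∈ S, k a * conj (k b) * ∫ ω, X a b ω ∂P := by
    rw [← integral_complex_ofReal, integral_congr_ae e1, integral_finsetSum _ fun a ha =>
      integrable_finsetSum _ fun b hb => (hXi a ha b hb).const_mul _]
    refine Finset.sum_congr rfl fun a ha => ?_
    rw [integral_finsetSum _ fun b hb => (hXi a ha b hb).const_mul _]
    simp only [integral_const_mul]
  have e4 : ∫ ω, ‖Z ω‖ ^ 2 ∂P ≤ ∑ a ∈ S, ∑ b ∈ S, ‖k a * conj (k b) * ∫ ω, X a b ω ∂P‖ := by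
    have : ‖((∫ ω, ‖Z ω‖ ^ 2 ∂P : ℝ) : ℂ)‖ = ∫ ω, ‖Z ω‖ ^ 2 ∂P := by
      rw [Complex.norm_real, Real.norm_of_nonneg (integral_nonneg fun _ => by positivity)]
    rw [← this, e3]
    exact (norm_sum_le _ _).trans (Finset.sum_le_sum fun a _ => norm_sum_le _ _)
  have hF := fourthMoment_nonneg
  have e5 : ∀ a ∈ S, ∀ b ∈ S, ‖k a * conj (k b) * ∫ ω, X a b ω ∂P‖ ≤
      fourthMoment / 2 * ((if b = a then ‖k a‖ ^ 2 else 0) + (if b = n - a then ‖k a‖ ^ 2 else 0)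
        + (if a = b then ‖k b‖ ^ 2 else 0) + (if a = n - b then ‖k b‖ ^ 2 else 0)) := by
    intro a ha b hb
    by_cases h : b = a ∨ b = n - a
    · have h1 : ‖k a * conj (k b) * ∫ ω, X a b ω ∂P‖
          ≤ fourthMoment / 2 * (‖k a‖ ^ 2 + ‖k b‖ ^ 2) := by
        rw [norm_mul, norm_mul, RCLike.norm_conj]
        have := hXb a ha b hb
        have h0 : 0 ≤ ‖k a‖ * ‖k b‖ := by positivity
        nlinarith [sq_nonneg (‖k a‖ - ‖k b‖), mul_le_mul_of_nonneg_left this h0]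
      refine h1.trans (mul_le_mul_of_nonneg_left ?_ (by positivity))
      have n1 : 0 ≤ ‖k a‖ ^ 2 := by positivity
      have n2 : 0 ≤ ‖k b‖ ^ 2 := by positivity
      rcases h with h | h
      · subst h; simp only [if_true]; split_ifs <;> linarith
      · have h' : a = n - b := by rw [h]; abel
        rw [if_pos h, if_pos h']; split_ifs <;> linarith
    · push Not at h
      have h0 : ∫ ω, X a b ω ∂P = 0 :=
        hg.integral_chaos_eq_zero (hS a ha).1 (hS a ha).2 (hS b hb).1 (hS b hb).2 h.1 h.2 hn
      rw [h0, mul_zero, norm_zero]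
      positivity
  refine e4.trans
    ((Finset.sum_le_sum fun a ha => Finset.sum_le_sum fun b hb => e5 a ha b hb).trans ?_)
  simp only [← Finset.mul_sum, Finset.sum_add_distrib]
  have s1 : ∑ a ∈ S, ∑ b ∈ S, (if b = a then ‖k a‖ ^ 2 else 0) ≤ ∑ a ∈ S, ‖k a‖ ^ 2 :=
    Finset.sum_le_sum fun a ha => by simp [ha]
  have s2 : ∑ a ∈ S, ∑ b ∈ S, (if b = n - a then ‖k a‖ ^ 2 else 0) ≤ ∑ a ∈ S, ‖k a‖ ^ 2 :=
    Finset.sum_le_sum fun a ha => by rw [Finset.sum_ite_eq']; split_ifs <;> simp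
  have s3 : ∑ a ∈ S, ∑ b ∈ S, (if a = b then ‖k b‖ ^ 2 else 0) ≤ ∑ a ∈ S, ‖k a‖ ^ 2 :=
    Finset.sum_le_sum fun a ha => by simp [ha]
  have s4 : ∑ a ∈ S, ∑ b ∈ S, (if a = n - b then ‖k b‖ ^ 2 else 0) ≤ ∑ a ∈ S, ‖k a‖ ^ 2 := by
    rw [Finset.sum_comm]
    exact Finset.sum_le_sum fun a ha => by rw [Finset.sum_ite_eq']; split_ifs <;> simp
  nlinarith

end WhiteNoise

/-! ### The mollifier and its Fourier transform -/

section Mollifier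

open scoped FourierTransform SchwartzMap

variable {χ : EuclideanSpace ℝ (Fin 2) → ℝ}

/-- The frequency `n / 2π`, at which Mathlib's Fourier transform of `χ` takes the value `ρ(n)`. -/
def freqVec (n : Fin 2 → ℤ) : EuclideanSpace ℝ (Fin 2) :=
  WithLp.toLp 2 fun j => (n j : ℝ) / (2 * Real.pi)

lemma norm_le_freqVec (n : Fin 2 → ℤ) : ‖n‖ / (2 * Real.pi) ≤ ‖freqVec n‖ := by
  rw [div_le_iff₀ (by positivity), pi_norm_le_iff_of_nonneg (by positivity)]
  intro j
  have := PiLp.norm_apply_le (freqVec n) j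
  have e : ‖freqVec n j‖ = ‖n j‖ / (2 * Real.pi) := by
    simp only [freqVec]
    rw [norm_div, Real.norm_of_nonneg (by positivity : (0 : ℝ) ≤ 2 * Real.pi), Int.norm_eq_abs,
      Real.norm_eq_abs]
  rwa [e, div_le_iff₀ (by positivity)] at this

lemma freqVec_le_norm (n : Fin 2 → ℤ) : ‖freqVec n‖ ≤ ‖n‖ := by
  have h : ∀ j, |(n j : ℝ)| ≤ ‖n‖ := fun j => by
    rw [← Int.norm_eq_abs]; exact norm_le_pi_norm n j
  have h0 := sq_le_sq' (abs_le.1 (h 0)).1 (abs_le.1 (h 0)).2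
  have h1 := sq_le_sq' (abs_le.1 (h 1)).1 (abs_le.1 (h 1)).2
  rw [EuclideanSpace.norm_eq]
  apply Real.sqrt_le_iff.2 ⟨norm_nonneg _, ?_⟩
  simp only [Fin.sum_univ_two, freqVec, Real.norm_eq_abs, sq_abs, div_pow]
  rw [← add_div, div_le_iff₀ (by positivity)]
  have hpi : (2 : ℝ) ≤ (2 * Real.pi) ^ 2 := by nlinarith [Real.pi_gt_three]
  nlinarith [sq_nonneg ‖n‖]

lemma IsMollifier.hasCompactSupport (hχ : IsMollifier χ) : HasCompactSupport χ :=
  HasCompactSupport.intro (isCompact_closedBall 0 (1 / 2)) fun x hx => by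
    by_contra h
    exact hx (Metric.ball_subset_closedBall (hχ.support_subset h))

lemma IsMollifier.integrable (hχ : IsMollifier χ) : Integrable χ :=
  hχ.smooth.continuous.integrable_of_hasCompactSupport hχ.hasCompactSupport

/-- A mollifier as a complex-valued Schwartz function. -/
def IsMollifier.toSchwartz (hχ : IsMollifier χ) : 𝓢(EuclideanSpace ℝ (Fin 2), ℂ) :=
  HasCompactSupport.toSchwartzMap (f := fun x => (χ x : ℂ))
    (hχ.hasCompactSupport.comp_left Complex.ofReal_zero)
    (Complex.ofRealCLM.contDiff.comp hχ.smooth)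

/-- The Fourier transform of a mollifier, as a Schwartz function. -/
def IsMollifier.fourierSchwartz (hχ : IsMollifier χ) : 𝓢(EuclideanSpace ℝ (Fin 2), ℂ) :=
  𝓕 hχ.toSchwartz

lemma IsMollifier.rhoAt_eq (hχ : IsMollifier χ) (t : ℝ) (n : Fin 2 → ℤ) :
    rhoAt χ t n = hχ.fourierSchwartz (t • freqVec n) := by
  rw [IsMollifier.fourierSchwartz, SchwartzMap.fourier_coe, Real.fourier_eq', rhoAt, rho]
  congr 1
  ext x
  rw [smul_eq_mul, mul_comm]
  congr 2
  simp only [PiLp.inner_apply, freqVec, Fin.sum_univ_two, PiLp.smul_apply, smul_eq_mul,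
    RCLike.inner_apply, conj_trivial]
  push_cast
  field_simp

lemma conj_rho (η : Fin 2 → ℝ) : conj (rho χ η) = rho χ (-η) := by
  rw [rho, rho, ← integral_conj]
  congr 1
  ext x
  rw [map_mul, ← Complex.exp_conj]
  simp only [Complex.conj_ofReal, map_neg, map_mul, Complex.conj_I, Fin.sum_univ_two, map_add,
    Pi.neg_apply, Complex.ofReal_neg]
  congr 2
  ring

lemma conj_rhoAt (ε : ℝ) (n : Fin 2 → ℤ) : conj (rhoAt χ ε n) = rhoAt χ ε (-n) := by
  rw [rhoAt, conj_rho, rhoAt]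
  congr 1
  ext j
  simp

/-- The derivative of `t ↦ ρ(t n)`. -/
def IsMollifier.derivRho (hχ : IsMollifier χ) (t : ℝ) (n : Fin 2 → ℤ) : ℂ :=
  fderiv ℝ hχ.fourierSchwartz (t • freqVec n) (freqVec n)

lemma IsMollifier.hasDerivAt_rhoAt (hχ : IsMollifier χ) (t : ℝ) (n : Fin 2 → ℤ) :
    HasDerivAt (fun s => rhoAt χ s n) (hχ.derivRho t n) t := by
  have h1 : HasFDerivAt hχ.fourierSchwartz (fderiv ℝ hχ.fourierSchwartz (t • freqVec n))
      (t • freqVec n) := (hχ.fourierSchwartz.differentiableAt).hasFDerivAt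
  have h2 : HasDerivAt (fun s : ℝ => s • freqVec n) (freqVec n) t := by
    simpa using (hasDerivAt_id t).smul_const (freqVec n)
  have h3 := h1.comp_hasDerivAt t h2
  refine h3.congr_of_eventuallyEq (Eventually.of_forall fun s => ?_)
  exact hχ.rhoAt_eq s n

lemma IsMollifier.continuous_derivRho (hχ : IsMollifier χ) (n : Fin 2 → ℤ) :
    Continuous (fun t => hχ.derivRho t n) := by
  have h : Continuous (fderiv ℝ hχ.fourierSchwartz) :=
    (hχ.fourierSchwartz.smooth 1).continuous_fderiv (by simp)
  unfold IsMollifier.derivRho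
  fun_prop

/-- Decay of `ρ` and of its radial derivative. -/
lemma IsMollifier.exists_decay (hχ : IsMollifier χ) : ∃ C : ℝ, 0 < C ∧ ∀ t : ℝ, 0 ≤ t → ∀ n,
    (t * ‖n‖) ^ 4 * ‖rhoAt χ t n‖ ≤ C ∧ (1 + t * ‖n‖) * ‖rhoAt χ t n‖ ≤ C ∧
    (1 + t * ‖n‖) * ‖hχ.derivRho t n‖ ≤ C * ‖n‖ := by
  set F := hχ.fourierSchwartz with hF
  obtain ⟨C0, hC0, h0⟩ := F.decay 0 0
  obtain ⟨C1, hC1, h1⟩ := F.decay 1 0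
  obtain ⟨C4, hC4, h4⟩ := F.decay 4 0
  obtain ⟨D0, hD0, d0⟩ := F.decay 0 1
  obtain ⟨D1, hD1, d1⟩ := F.decay 1 1
  simp only [norm_iteratedFDeriv_zero, norm_iteratedFDeriv_one, pow_zero, one_mul, pow_one]
    at h0 h1 h4 d0 d1
  set p := 2 * Real.pi with hp
  have hp0 : 0 < p := by positivity
  refine ⟨C0 + p * C1 + p ^ 4 * C4 + D0 + p * D1, by positivity, fun t ht n => ?_⟩
  have hn : t * ‖n‖ ≤ p * ‖t • freqVec n‖ := by
    rw [norm_smul, Real.norm_of_nonneg ht]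
    have := norm_le_freqVec n
    rw [div_le_iff₀ (by positivity)] at this
    nlinarith
  have hn0 : 0 ≤ t * ‖n‖ := by positivity
  have e := hχ.rhoAt_eq t n
  rw [← hF] at e
  have k0 := h0 (t • freqVec n)
  have k1 := h1 (t • freqVec n)
  have k4 := h4 (t • freqVec n)
  rw [← e] at k0 k1 k4
  refine ⟨?_, ?_, ?_⟩
  · calc (t * ‖n‖) ^ 4 * ‖rhoAt χ t n‖ ≤ (p * ‖t • freqVec n‖) ^ 4 * ‖rhoAt χ t n‖ := by gcongr
      _ = p ^ 4 * (‖t • freqVec n‖ ^ 4 * ‖rhoAt χ t n‖) := by ring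
      _ ≤ p ^ 4 * C4 := by gcongr
      _ ≤ _ := by nlinarith [mul_pos hp0 hC1, mul_pos hp0 hD1]
  · calc (1 + t * ‖n‖) * ‖rhoAt χ t n‖ ≤ (1 + p * ‖t • freqVec n‖) * ‖rhoAt χ t n‖ := by gcongr
      _ = ‖rhoAt χ t n‖ + p * (‖t • freqVec n‖ * ‖rhoAt χ t n‖) := by ring
      _ ≤ C0 + p * C1 := by gcongr
      _ ≤ _ := by nlinarith [mul_pos hp0 hC1, mul_pos hp0 hD1, mul_pos (pow_pos hp0 4) hC4]
  · have k2 := d0 (t • freqVec n)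
    have k3 := d1 (t • freqVec n)
    have hb : ‖hχ.derivRho t n‖ ≤ ‖fderiv ℝ F (t • freqVec n)‖ * ‖n‖ :=
      ((fderiv ℝ F (t • freqVec n)).le_opNorm _).trans
        (mul_le_mul_of_nonneg_left (freqVec_le_norm n) (norm_nonneg _))
    set L := ‖fderiv ℝ F (t • freqVec n)‖
    have hL : 0 ≤ L := norm_nonneg _
    calc (1 + t * ‖n‖) * ‖hχ.derivRho t n‖ ≤ (1 + p * ‖t • freqVec n‖) * (L * ‖n‖) := by gcongr
      _ = (L + p * (‖t • freqVec n‖ * L)) * ‖n‖ := by ring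
      _ ≤ (D0 + p * D1) * ‖n‖ := by gcongr
      _ ≤ _ := by
        gcongr
        nlinarith [mul_pos hp0 hC1, mul_pos hp0 hD1, mul_pos (pow_pos hp0 4) hC4]

/-- The point of the torus with angular coordinates `ε y`. -/
def torusPoint (ε : ℝ) (y : EuclideanSpace ℝ (Fin 2)) : T2 :=
  fun j => ((ε * y j / (2 * Real.pi) : ℝ) : UnitAddCircle)

lemma mFourier_neg_torusPoint (ε : ℝ) (y : EuclideanSpace ℝ (Fin 2)) (n : Fin 2 → ℤ) :
    mFourier n (-torusPoint ε y) = Complex.exp (-(Complex.I * ∑ j, (y j * (ε * n j : ℝ) : ℂ))) := by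
  have h : -torusPoint ε y = fun j => ((-(ε * y j / (2 * Real.pi)) : ℝ) : UnitAddCircle) := by
    ext j; simp [torusPoint]
  rw [h]
  simp only [mFourier, ContinuousMap.coe_mk, Fin.prod_univ_two, fourier_coe_apply]
  rw [← Complex.exp_add]
  congr 1
  simp only [Fin.sum_univ_two]
  push_cast
  have : (Real.pi : ℂ) ≠ 0 := by exact_mod_cast Real.pi_ne_zero
  field_simp
  ring

lemma mFourier_apply_add (n : Fin 2 → ℤ) (x y : T2) :
    mFourier n (x + y) = mFourier n x * mFourier n y := by
  simp only [mFourier, ContinuousMap.coe_mk, Pi.add_apply, ← Finset.prod_mul_distrib]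
  refine Finset.prod_congr rfl fun i _ => ?_
  simp [fourier_apply, AddCircle.toCircle_add]

lemma norm_mFourier_apply (n : Fin 2 → ℤ) (x : T2) : ‖mFourier n x‖ = 1 := by
  simp only [mFourier, ContinuousMap.coe_mk, norm_prod, fourier_apply, Circle.norm_coe,
    Finset.prod_const_one]

/-- `ρ(ε ·)` is the multiplier of the convolution with the rescaled mollifier. -/
lemma rhoAt_mul_mFourier (ε : ℝ) (n : Fin 2 → ℤ) (x : T2) :
    rhoAt χ ε n * mFourier n x = ∫ y, (χ y : ℂ) * mFourier n (x - torusPoint ε y) := by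
  rw [rhoAt, rho, ← integral_mul_const]
  congr 1
  ext y
  rw [sub_eq_add_neg, mFourier_apply_add, mFourier_neg_torusPoint]
  push_cast
  ring

lemma continuous_torusPoint (ε : ℝ) : Continuous (torusPoint ε) := by
  refine continuous_pi fun j => ?_
  exact (AddCircle.continuous_mk' 1).comp (by fun_prop)

/-- Mollification does not increase the supremum of a trigonometric polynomial by more than the
factor `‖χ‖_{L¹}`. -/
lemma IsMollifier.norm_sum_rhoAt_le (hχ : IsMollifier χ) (ε : ℝ) (S : Finset (Fin 2 → ℤ))
    (c : (Fin 2 → ℤ) → ℂ) {B : ℝ} (hB : ∀ x, ‖∑ n ∈ S, c n * mFourier n x‖ ≤ B) (x : T2) :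
    ‖∑ n ∈ S, rhoAt χ ε n * c n * mFourier n x‖ ≤ (∫ y, ‖χ y‖) * B := by
  have hc : ∀ n, Continuous fun y => mFourier n (x - torusPoint ε y) := fun n =>
    (mFourier n).continuous.comp (continuous_const.sub (continuous_torusPoint ε))
  have hi : ∀ n, Integrable fun y => (χ y : ℂ) * mFourier n (x - torusPoint ε y) := fun n =>
    (hχ.integrable.ofReal (𝕜 := ℂ)).mul_bdd (c := 1) (hc n).aestronglyMeasurable
      (ae_of_all _ fun y => (norm_mFourier_apply _ _).le)
  have e : ∑ n ∈ S, rhoAt χ ε n * c n * mFourier n x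
      = ∫ y, (χ y : ℂ) * ∑ n ∈ S, c n * mFourier n (x - torusPoint ε y) := by
    simp only [Finset.mul_sum]
    rw [integral_finsetSum]
    · refine Finset.sum_congr rfl fun n _ => ?_
      rw [mul_right_comm, rhoAt_mul_mFourier, ← integral_mul_const]
      congr 1; ext y; ring
    · intro n _
      refine ((hi n).const_mul (c n)).congr (ae_of_all _ fun y => ?_)
      simp only; ring
  rw [e, ← integral_mul_const]
  refine norm_integral_le_of_norm_le (hχ.integrable.norm.mul_const B) (ae_of_all _ fun y => ?_)
  rw [norm_mul, Complex.norm_real]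
  exact mul_le_mul_of_nonneg_left (hB _) (norm_nonneg _)

end Mollifier

/-! ### Lattice sums -/

/-- The frequencies `n` with `‖n‖ < N`, where `‖·‖` is the supremum norm. -/
def box (N : ℕ) : Finset (Fin 2 → ℤ) := Fintype.piFinset fun _ => Finset.Ioo (-(N : ℤ)) N

/-- The dyadic block `2 ^ k ≤ ‖n‖ < 2 ^ (k + 1)`. -/
def block (k : ℕ) : Finset (Fin 2 → ℤ) := box (2 ^ (k + 1)) \ box (2 ^ k)

lemma mem_box {N : ℕ} {n : Fin 2 → ℤ} : n ∈ box N ↔ ∀ j, -(N : ℤ) < n j ∧ n j < N := by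
  simp [box, Fintype.mem_piFinset]

lemma mem_box_iff_norm {N : ℕ} (hN : 0 < N) {n : Fin 2 → ℤ} : n ∈ box N ↔ ‖n‖ < N := by
  rw [mem_box, pi_norm_lt_iff (by exact_mod_cast hN)]
  refine forall_congr' fun j => ?_
  rw [Int.norm_eq_abs, abs_lt]
  constructor
  · rintro ⟨h1, h2⟩; exact ⟨by exact_mod_cast h1, by exact_mod_cast h2⟩
  · rintro ⟨h1, h2⟩; exact ⟨by exact_mod_cast h1, by exact_mod_cast h2⟩

lemma box_mono {M N : ℕ} (h : M ≤ N) : box M ⊆ box N := by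
  intro n hn
  rw [mem_box] at hn ⊢
  intro j; have := hn j; omega

lemma tendsto_box : Tendsto box atTop atTop := by
  refine tendsto_atTop_finset_of_monotone (fun _ _ h => box_mono h) fun n => ?_
  refine ⟨(n 0).natAbs + (n 1).natAbs + 1, mem_box.2 fun j => ?_⟩
  have h0 := abs_le.1 (le_refl |n 0|)
  have h1 := abs_le.1 (le_refl |n 1|)
  fin_cases j <;> simp only [Fin.zero_eta, Fin.mk_one, Nat.cast_add, Int.natCast_natAbs,
    Nat.cast_one] <;> omega

lemma card_box_le (N : ℕ) : (box N).card ≤ (2 * N) ^ 2 := by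
  rw [box, Fintype.card_piFinset]
  simp only [Int.card_Ioo, Finset.prod_const, Finset.card_univ, Fintype.card_fin]
  gcongr
  omega

lemma block_norm {k : ℕ} {n : Fin 2 → ℤ} (h : n ∈ block k) :
    (2 : ℝ) ^ k ≤ ‖n‖ ∧ ‖n‖ < 2 ^ (k + 1) := by
  rw [block, Finset.mem_sdiff, mem_box_iff_norm (by positivity), mem_box_iff_norm (by positivity)]
    at h
  push_cast at h
  exact ⟨not_lt.1 h.2, h.1⟩

lemma ne_zero_of_mem_block {k : ℕ} {n : Fin 2 → ℤ} (h : n ∈ block k) : n ≠ 0 := by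
  rintro rfl
  have := (block_norm h).1
  rw [norm_zero] at this
  exact absurd this (not_le.2 (by positivity))

lemma card_block_le (k : ℕ) : ((block k).card : ℝ) ≤ 16 * 4 ^ k := by
  have h : (block k).card ≤ (2 * 2 ^ (k + 1)) ^ 2 :=
    (Finset.card_le_card Finset.sdiff_subset).trans (card_box_le _)
  have h' : ((block k).card : ℝ) ≤ (2 * 2 ^ (k + 1)) ^ 2 := by exact_mod_cast h
  refine h'.trans (le_of_eq ?_)
  rw [show (4 : ℝ) = 2 ^ 2 by norm_num, ← pow_mul]; ring

lemma sum_box_two_pow {E : Type*} [AddCommGroup E] (f : (Fin 2 → ℤ) → E) (K : ℕ) :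
    ∑ n ∈ box (2 ^ K), f n = f 0 + ∑ k ∈ Finset.range K, ∑ n ∈ block k, f n := by
  induction K with
  | zero =>
    have : box 1 = {0} := by
      ext n
      simp only [mem_box, Finset.mem_singleton]
      constructor
      · intro h; ext j; have := h j; simp at this ⊢; omega
      · rintro rfl; simp
    simp [this]
  | succ K ih =>
    rw [Finset.sum_range_succ, ← add_assoc, ← ih, block, add_comm (∑ n ∈ box (2 ^ K), f n),
      Finset.sum_sdiff (box_mono (Nat.pow_le_pow_right (by norm_num) (by omega)))]

lemma norm_sq_le_normSq (n : Fin 2 → ℤ) : ‖n‖ ^ 2 ≤ normSq n := by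
  have h : ‖n‖ ≤ Real.sqrt (normSq n) := by
    rw [pi_norm_le_iff_of_nonneg (Real.sqrt_nonneg _)]
    intro j
    rw [Int.norm_eq_abs]
    apply Real.abs_le_sqrt
    rw [normSq, Fin.sum_univ_two]
    fin_cases j
    · simp; positivity
    · simp; positivity
  have h0 : 0 ≤ normSq n := Finset.sum_nonneg fun _ _ => by positivity
  calc ‖n‖ ^ 2 ≤ Real.sqrt (normSq n) ^ 2 := by gcongr
    _ = normSq n := Real.sq_sqrt h0

lemma abs_coord_le_norm (n : Fin 2 → ℤ) (j : Fin 2) : |(n j : ℝ)| ≤ ‖n‖ := by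
  rw [← Int.norm_eq_abs]; exact norm_le_pi_norm n j

lemma normSq_nonneg (n : Fin 2 → ℤ) : 0 ≤ normSq n := Finset.sum_nonneg fun _ _ => by positivity

lemma one_le_norm {n : Fin 2 → ℤ} (hn : n ≠ 0) : 1 ≤ ‖n‖ := by
  obtain ⟨j, hj⟩ : ∃ j, n j ≠ 0 := by
    by_contra! h; exact hn (funext h)
  refine le_trans ?_ (norm_le_pi_norm n j)
  rw [Int.norm_eq_abs]
  exact_mod_cast Int.one_le_abs hj

lemma normSq_pos {n : Fin 2 → ℤ} (hn : n ≠ 0) : 0 < normSq n :=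
  lt_of_lt_of_le (by have := one_le_norm hn; positivity) (norm_sq_le_normSq n)

lemma normSq_neg (n : Fin 2 → ℤ) : normSq (-n) = normSq n := by simp [normSq]

lemma summable_norm_rpow {s : ℝ} (hs : 2 < s) : Summable fun n : Fin 2 → ℤ => ‖n‖ ^ (-s) :=
  EisensteinSeries.summable_one_div_norm_rpow hs

/-! ### Suprema of random trigonometric polynomials -/

/-- The coefficient of `mFourier m` in `|∑ₙ γₙ cₙ mFourier n|²`, where `n` ranges over a dyadic
block and `conj γₙ = γ₋ₙ`. -/
def squareCoeff (c : (Fin 2 → ℤ) → ℂ) (k : ℕ) (m : Fin 2 → ℤ) (γ : (Fin 2 → ℤ) → ℂ) : ℂ :=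
  ∑ a ∈ block k with a - m ∈ block k, (c a * conj (c (a - m))) * (γ a * γ (m - a))

/-- The sum of the absolute values of the Fourier coefficients of `|∑ₙ γₙ cₙ mFourier n|²`, which
bounds the supremum of this function. -/
def blockSq (c : (Fin 2 → ℤ) → ℂ) (k : ℕ) (γ : (Fin 2 → ℤ) → ℂ) : ℝ :=
  ∑ m ∈ box (2 ^ (k + 2)), ‖squareCoeff c k m γ‖

lemma blockSq_nonneg (c : (Fin 2 → ℤ) → ℂ) (k : ℕ) (γ : (Fin 2 → ℤ) → ℂ) : 0 ≤ blockSq c k γ :=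
  Finset.sum_nonneg fun _ _ => norm_nonneg _

/-- A function is bounded by the sum of its absolute Fourier coefficients; this is applied to the
square of a dyadic block. -/
lemma norm_sq_block_le {γ : (Fin 2 → ℤ) → ℂ} (hγ : ∀ n, n ≠ 0 → conj (γ n) = γ (-n))
    (c : (Fin 2 → ℤ) → ℂ) (k : ℕ) (x : T2) :
    ‖∑ n ∈ block k, γ n * c n * mFourier n x‖ ^ 2 ≤ blockSq c k γ := by
  have e : ((‖∑ n ∈ block k, γ n * c n * mFourier n x‖ ^ 2 : ℝ) : ℂ)
      = ∑ m ∈ box (2 ^ (k + 2)), squareCoeff c k m γ * mFourier m x := by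
    rw [Complex.ofReal_pow, ← Complex.mul_conj']
    simp only [map_sum, map_mul, squareCoeff, Finset.sum_mul, Finset.sum_filter]
    rw [Finset.sum_comm (s := box (2 ^ (k + 2)))]
    refine Finset.sum_congr rfl fun a ha => ?_
    simp only [ite_mul, zero_mul]
    rw [← Finset.sum_filter, Finset.mul_sum]
    refine Finset.sum_nbij' (fun b => a - b) (fun m => a - m) ?_ ?_ ?_ ?_ ?_
    · intro b hb
      rw [Finset.mem_filter]
      refine ⟨?_, by simpa using hb⟩
      have h1 := (Finset.mem_sdiff.1 ha).1
      have h2 := (Finset.mem_sdiff.1 hb).1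
      rw [mem_box] at h1 h2 ⊢
      intro j
      have h1 := h1 j
      have h2 := h2 j
      simp only [Pi.sub_apply]
      push_cast at h1 h2 ⊢
      have : (2 : ℤ) ^ (k + 2) = 2 * 2 ^ (k + 1) := by ring
      omega
    · intro m hm; exact (Finset.mem_filter.1 hm).2
    · intro b _; simp
    · intro m _; simp
    · intro b hb
      rw [hγ b (ne_zero_of_mem_block hb), ← mFourier_neg]
      have e1 : mFourier (a - b) x = mFourier a x * mFourier (-b) x := by
        rw [sub_eq_add_neg, mFourier_add]
      rw [e1]
      simp only [sub_sub_cancel, sub_sub_cancel_left]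
      ring
  have h : ‖((‖∑ n ∈ block k, γ n * c n * mFourier n x‖ ^ 2 : ℝ) : ℂ)‖
      = ‖∑ n ∈ block k, γ n * c n * mFourier n x‖ ^ 2 := by
    rw [Complex.norm_real, Real.norm_of_nonneg (by positivity)]
  rw [← h, e]
  refine (norm_sum_le _ _).trans (Finset.sum_le_sum fun m _ => ?_)
  rw [norm_mul, norm_mFourier_apply, mul_one]

section WhiteNoise

variable {Ω : Type*} [MeasurableSpace Ω] {P : Measure Ω} {g : (Fin 2 → ℤ) → Ω → ℂ}

lemma IsWhiteNoise.measurable_squareCoeff (hg : IsWhiteNoise P g) (c : (Fin 2 → ℤ) → ℂ) (k : ℕ)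
    (m : Fin 2 → ℤ) : Measurable fun ω => squareCoeff c k m fun n => g n ω := by
  unfold squareCoeff
  refine Finset.measurable_sum _ fun a ha => ?_
  rw [Finset.mem_filter] at ha
  have h1 := hg.measurable a (ne_zero_of_mem_block ha.1)
  have h2 := hg.measurable (m - a) (by
    rw [← neg_sub]; exact neg_ne_zero.2 (ne_zero_of_mem_block ha.2))
  fun_prop

lemma IsWhiteNoise.measurable_blockSq (hg : IsWhiteNoise P g) (c : (Fin 2 → ℤ) → ℂ) (k : ℕ) :
    Measurable fun ω => blockSq c k fun n => g n ω :=
  Finset.measurable_sum _ fun m _ => (hg.measurable_squareCoeff c k m).norm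

/-- For `m ≠ 0` the sum over about `4 ^ k` pairs has square root cancellation. -/
lemma IsWhiteNoise.lintegral_squareCoeff_le [IsProbabilityMeasure P] (hg : IsWhiteNoise P g)
    {c : (Fin 2 → ℤ) → ℂ} {k : ℕ} {A : ℝ} (hA : 0 < A) (hc : ∀ n ∈ block k, ‖c n‖ ≤ A)
    {m : Fin 2 → ℤ} (hm : m ≠ 0) :
    ∫⁻ ω, ENNReal.ofReal ‖squareCoeff c k m fun n => g n ω‖ ∂P
      ≤ ENNReal.ofReal ((32 * fourthMoment + 1) * A ^ 2 * 2 ^ k) := by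
  set l : ℝ := A ^ 2 * 2 ^ k with hl
  have hl0 : 0 < l := by positivity
  have hF := fourthMoment_nonneg
  have h1 := hg.lintegral_chaos_le hm ((block k).filter fun a => a - m ∈ block k)
    (fun a ha => ⟨ne_zero_of_mem_block (Finset.mem_filter.1 ha).1,
      sub_ne_zero.1 (ne_zero_of_mem_block (Finset.mem_filter.1 ha).2)⟩)
    (fun a => c a * conj (c (a - m)))
  have h2 : ∑ a ∈ (block k).filter (fun a => a - m ∈ block k), ‖c a * conj (c (a - m))‖ ^ 2
      ≤ 16 * 4 ^ k * (A ^ 2) ^ 2 := by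
    calc _ ≤ ∑ a ∈ (block k).filter (fun a => a - m ∈ block k), (A ^ 2) ^ 2 := by
          refine Finset.sum_le_sum fun a ha => ?_
          rw [Finset.mem_filter] at ha
          rw [norm_mul, RCLike.norm_conj, sq A]
          gcongr
          · exact hc _ ha.1
          · exact hc _ ha.2
      _ ≤ _ := by
          rw [Finset.sum_const, nsmul_eq_mul]
          gcongr
          refine le_trans ?_ (card_block_le k)
          exact_mod_cast Finset.card_filter_le _ _
  -- `x ≤ x ^ 2 / l + l` trades the first moment for the second
  have h3 : ∀ z : ℂ, ENNReal.ofReal ‖z‖ ≤ ENNReal.ofReal (1 / l) * ‖z‖ₑ ^ 2 + ENNReal.ofReal l := by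
    intro z
    rw [← ofReal_norm, ← ENNReal.ofReal_pow (norm_nonneg _), ← ENNReal.ofReal_mul (by positivity),
      ← ENNReal.ofReal_add (by positivity) hl0.le]
    apply ENNReal.ofReal_le_ofReal
    have : 1 / l * ‖z‖ ^ 2 + l - ‖z‖ = ((‖z‖ - l / 2) ^ 2 + 3 / 4 * l ^ 2) / l := by
      field_simp; ring
    have h' : 0 ≤ ((‖z‖ - l / 2) ^ 2 + 3 / 4 * l ^ 2) / l := by positivity
    linarith
  calc _ ≤ ∫⁻ ω, (ENNReal.ofReal (1 / l) * ‖squareCoeff c k m fun n => g n ω‖ₑ ^ 2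
          + ENNReal.ofReal l) ∂P := lintegral_mono fun ω => h3 _
    _ = ENNReal.ofReal (1 / l) * ∫⁻ ω, ‖squareCoeff c k m fun n => g n ω‖ₑ ^ 2 ∂P
          + ENNReal.ofReal l := by
        have := (hg.measurable_squareCoeff c k m).enorm
        rw [lintegral_add_right _ measurable_const, lintegral_const_mul _ (by fun_prop),
          lintegral_const, measure_univ, mul_one]
    _ ≤ ENNReal.ofReal (1 / l) * ENNReal.ofReal (2 * fourthMoment * (16 * 4 ^ k * (A ^ 2) ^ 2))
          + ENNReal.ofReal l := by
        gcongr
        refine h1.trans (ENNReal.ofReal_le_ofReal ?_)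
        gcongr
    _ = _ := by
        rw [← ENNReal.ofReal_mul (by positivity), ← ENNReal.ofReal_add (by positivity) hl0.le]
        congr 1
        rw [show (4 : ℝ) ^ k = 2 ^ k * 2 ^ k by rw [← mul_pow]; norm_num, hl]
        field_simp
        ring

/-- For `m = 0` there is no cancellation, but this is a single frequency. -/
lemma IsWhiteNoise.lintegral_squareCoeff_zero_le [IsProbabilityMeasure P] (hg : IsWhiteNoise P g)
    {c : (Fin 2 → ℤ) → ℂ} {k : ℕ} {A : ℝ} (hc : ∀ n ∈ block k, ‖c n‖ ≤ A) :
    ∫⁻ ω, ENNReal.ofReal ‖squareCoeff c k 0 fun n => g n ω‖ ∂P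
      ≤ ENNReal.ofReal ((1 + 2 * fourthMoment) * A ^ 2 * (16 * 4 ^ k)) := by
  have hF := fourthMoment_nonneg
  have hi : ∀ a ∈ block k, Integrable (fun ω => A ^ 2 * (1 + (‖g a ω‖ ^ 4 + ‖g (-a) ω‖ ^ 4))) P :=
    fun a ha => ((integrable_const 1).add
      ((hg.integrable_pow_four (ne_zero_of_mem_block ha)).add
        (hg.integrable_pow_four (neg_ne_zero.2 (ne_zero_of_mem_block ha))))).const_mul _
  have h1 : ∀ ω, ‖squareCoeff c k 0 fun n => g n ω‖
      ≤ ∑ a ∈ block k, A ^ 2 * (1 + (‖g a ω‖ ^ 4 + ‖g (-a) ω‖ ^ 4)) := by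
    intro ω
    rw [squareCoeff]
    simp only [sub_zero, zero_sub, Finset.filter_mem_eq_inter, Finset.inter_self]
    refine (norm_sum_le _ _).trans (Finset.sum_le_sum fun a ha => ?_)
    rw [norm_mul, norm_mul, norm_mul, RCLike.norm_conj]
    have hca := hc a ha
    have h2 : ‖c a‖ * ‖c a‖ ≤ A ^ 2 := by nlinarith [norm_nonneg (c a)]
    have h3 : ‖g a ω‖ * ‖g (-a) ω‖ ≤ 1 + (‖g a ω‖ ^ 4 + ‖g (-a) ω‖ ^ 4) := by
      nlinarith [sq_nonneg (‖g a ω‖ - ‖g (-a) ω‖), sq_nonneg (‖g a ω‖ ^ 2 - 1 / 2),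
        sq_nonneg (‖g (-a) ω‖ ^ 2 - 1 / 2)]
    gcongr
  calc _ ≤ ∫⁻ ω, ENNReal.ofReal
          (∑ a ∈ block k, A ^ 2 * (1 + (‖g a ω‖ ^ 4 + ‖g (-a) ω‖ ^ 4))) ∂P :=
        lintegral_mono fun ω => ENNReal.ofReal_le_ofReal (h1 ω)
    _ = ENNReal.ofReal
          (∫ ω, ∑ a ∈ block k, A ^ 2 * (1 + (‖g a ω‖ ^ 4 + ‖g (-a) ω‖ ^ 4)) ∂P) := by
        rw [ofReal_integral_eq_lintegral_ofReal (integrable_finsetSum _ hi)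
          (ae_of_all _ fun ω => Finset.sum_nonneg fun a _ => by positivity)]
    _ ≤ _ := by
        apply ENNReal.ofReal_le_ofReal
        rw [integral_finsetSum _ hi]
        have : ∀ a ∈ block k, ∫ ω, A ^ 2 * (1 + (‖g a ω‖ ^ 4 + ‖g (-a) ω‖ ^ 4)) ∂P
            = A ^ 2 * (1 + 2 * fourthMoment) := by
          intro a ha
          have i1 := hg.integrable_pow_four (ne_zero_of_mem_block ha)
          have i2 := hg.integrable_pow_four (neg_ne_zero.2 (ne_zero_of_mem_block ha))
          have i3 : Integrable (fun ω => ‖g a ω‖ ^ 4 + ‖g (-a) ω‖ ^ 4) P := i1.add i2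
          rw [integral_const_mul, integral_add (integrable_const 1) i3, integral_add i1 i2,
            hg.integral_pow_four (ne_zero_of_mem_block ha),
            hg.integral_pow_four (neg_ne_zero.2 (ne_zero_of_mem_block ha))]
          simp; left; ring
        rw [Finset.sum_congr rfl this, Finset.sum_const, nsmul_eq_mul]
        calc _ ≤ (16 * 4 ^ k) * (A ^ 2 * (1 + 2 * fourthMoment)) := by
              gcongr; exact card_block_le k
          _ = _ := by ring

/-- The constant in the estimate of `blockSq`. -/
def blockConst : ℝ := 64 * (32 * fourthMoment + 1) + 16 * (1 + 2 * fourthMoment)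

lemma blockConst_nonneg : 0 ≤ blockConst := by
  have := fourthMoment_nonneg
  unfold blockConst; positivity

lemma IsWhiteNoise.lintegral_blockSq_le [IsProbabilityMeasure P] (hg : IsWhiteNoise P g)
    {c : (Fin 2 → ℤ) → ℂ} {k : ℕ} {A : ℝ} (hA : 0 < A) (hc : ∀ n ∈ block k, ‖c n‖ ≤ A) :
    ∫⁻ ω, ENNReal.ofReal (blockSq c k fun n => g n ω) ∂P
      ≤ ENNReal.ofReal (blockConst * A ^ 2 * 8 ^ k) := by
  have hF := fourthMoment_nonneg
  have h0 : (0 : Fin 2 → ℤ) ∈ box (2 ^ (k + 2)) := mem_box.2 fun j => by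
    have : (0 : ℤ) < 2 ^ (k + 2) := by positivity
    simp
  have e : ∀ ω, ENNReal.ofReal (blockSq c k fun n => g n ω) =
      ∑ m ∈ box (2 ^ (k + 2)), ENNReal.ofReal ‖squareCoeff c k m fun n => g n ω‖ := fun ω =>
    ENNReal.ofReal_sum_of_nonneg fun _ _ => norm_nonneg _
  simp only [e]
  rw [lintegral_finsetSum _ fun m _ => (hg.measurable_squareCoeff c k m).norm.ennreal_ofReal,
    ← Finset.add_sum_erase _ _ h0]
  have hk : (4 : ℝ) ^ k ≤ 8 ^ k := by gcongr; norm_num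
  calc _ ≤ ENNReal.ofReal ((1 + 2 * fourthMoment) * A ^ 2 * (16 * 4 ^ k))
        + ∑ m ∈ (box (2 ^ (k + 2))).erase 0,
          ENNReal.ofReal ((32 * fourthMoment + 1) * A ^ 2 * 2 ^ k) := by
        gcongr with m hm
        · exact hg.lintegral_squareCoeff_zero_le hc
        · exact hg.lintegral_squareCoeff_le hA hc (Finset.ne_of_mem_erase hm)
    _ ≤ ENNReal.ofReal ((1 + 2 * fourthMoment) * A ^ 2 * (16 * 4 ^ k))
        + ENNReal.ofReal (64 * 4 ^ k * ((32 * fourthMoment + 1) * A ^ 2 * 2 ^ k)) := by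
        gcongr
        rw [Finset.sum_const, nsmul_eq_mul, ← ENNReal.ofReal_natCast,
          ← ENNReal.ofReal_mul (by positivity)]
        apply ENNReal.ofReal_le_ofReal
        gcongr
        have h1 : ((box (2 ^ (k + 2))).erase 0).card ≤ (2 * 2 ^ (k + 2)) ^ 2 :=
          (Finset.card_erase_le).trans (card_box_le _)
        have h2 : (((box (2 ^ (k + 2))).erase 0).card : ℝ) ≤ (2 * 2 ^ (k + 2)) ^ 2 := by
          exact_mod_cast h1
        refine h2.trans (le_of_eq ?_)
        rw [show (4 : ℝ) = 2 ^ 2 by norm_num, ← pow_mul]; ring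
    _ ≤ _ := by
        rw [← ENNReal.ofReal_add (by positivity) (by positivity)]
        apply ENNReal.ofReal_le_ofReal
        have e8 : (4 : ℝ) ^ k * 2 ^ k = 8 ^ k := by rw [← mul_pow]; norm_num
        have e9 : 64 * 4 ^ k * ((32 * fourthMoment + 1) * A ^ 2 * 2 ^ k)
            = 64 * ((32 * fourthMoment + 1) * A ^ 2) * 8 ^ k := by rw [← e8]; ring
        rw [blockConst, e9]
        have : (1 + 2 * fourthMoment) * A ^ 2 * (16 * 4 ^ k)
            ≤ (1 + 2 * fourthMoment) * A ^ 2 * (16 * 8 ^ k) := by gcongr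
        linarith

end WhiteNoise

/-! ### The renormalised square, uniformly in the mollification -/

section Wick

variable {χ : EuclideanSpace ℝ (Fin 2) → ℝ}

/-- The coefficient of `γ_a γ_b` in `∑ⱼ ∂ⱼY ∂ⱼY`, which is `-(a · b) / (|a|² |b|²)`. -/
def gradCoeff (a b : Fin 2 → ℤ) : ℂ :=
  -((∑ j, (a j : ℂ) * (b j : ℂ)) / ((normSq a : ℂ) * (normSq b : ℂ)))

lemma norm_gradCoeff_le {a b : Fin 2 → ℤ} (ha : a ≠ 0) (hb : b ≠ 0) :
    ‖gradCoeff a b‖ ≤ 2 / (‖a‖ * ‖b‖) := by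
  have ha1 := one_le_norm ha
  have hb1 := one_le_norm hb
  have h1 : ‖∑ j, (a j : ℂ) * (b j : ℂ)‖ ≤ 2 * (‖a‖ * ‖b‖) := by
    refine (norm_sum_le _ _).trans ?_
    have : ∀ j, ‖(a j : ℂ) * (b j : ℂ)‖ ≤ ‖a‖ * ‖b‖ := fun j => by
      rw [norm_mul, Complex.norm_intCast, Complex.norm_intCast]
      gcongr
      · exact abs_coord_le_norm a j
      · exact abs_coord_le_norm b j
    rw [Fin.sum_univ_two]
    linarith [this 0, this 1]
  rw [gradCoeff, norm_neg, norm_div, norm_mul, Complex.norm_real, Complex.norm_real,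
    Real.norm_of_nonneg (normSq_nonneg a), Real.norm_of_nonneg (normSq_nonneg b)]
  calc _ ≤ 2 * (‖a‖ * ‖b‖) / (‖a‖ ^ 2 * ‖b‖ ^ 2) := by
        have h2 := norm_sq_le_normSq a
        have h3 := norm_sq_le_normSq b
        have h4 := normSq_nonneg a
        gcongr
    _ = _ := by field_simp

/-- The pairs `(a, n - a)` of nonzero frequencies in a box. -/
def pairSet (N : ℕ) (n : Fin 2 → ℤ) : Finset (Fin 2 → ℤ) :=
  {a ∈ box N | a ≠ 0 ∧ a ≠ n ∧ n - a ∈ box N}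

lemma ne_of_mem_pairSet {N : ℕ} {n a : Fin 2 → ℤ} (h : a ∈ pairSet N n) : a ≠ 0 ∧ a ≠ n := by
  rw [pairSet, Finset.mem_filter] at h
  exact ⟨h.2.1, h.2.2.1⟩

/-- The `n`-th Fourier coefficient of `|∇Y_t|²`, with all frequencies of `Y_t` outside a box
removed. -/
def wickCoeff (χ : EuclideanSpace ℝ (Fin 2) → ℝ) (N : ℕ) (n : Fin 2 → ℤ) (t : ℝ)
    (γ : (Fin 2 → ℤ) → ℂ) : ℂ :=
  ∑ a ∈ pairSet N n,
    (rhoAt χ t a * rhoAt χ t (n - a) * gradCoeff a (n - a)) * (γ a * γ (n - a))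

/-- The derivative of `wickCoeff` with respect to the mollification parameter. -/
def IsMollifier.derivWickCoeff (hχ : IsMollifier χ) (N : ℕ) (n : Fin 2 → ℤ) (t : ℝ)
    (γ : (Fin 2 → ℤ) → ℂ) : ℂ :=
  ∑ a ∈ pairSet N n,
    ((hχ.derivRho t a * rhoAt χ t (n - a) + rhoAt χ t a * hχ.derivRho t (n - a))
      * gradCoeff a (n - a)) * (γ a * γ (n - a))

lemma IsMollifier.hasDerivAt_wickCoeff (hχ : IsMollifier χ) (N : ℕ) (n : Fin 2 → ℤ) (t : ℝ)
    (γ : (Fin 2 → ℤ) → ℂ) :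
    HasDerivAt (fun s => wickCoeff χ N n s γ) (hχ.derivWickCoeff N n t γ) t := by
  unfold wickCoeff IsMollifier.derivWickCoeff
  refine HasDerivAt.fun_sum fun a _ => ?_
  exact (((hχ.hasDerivAt_rhoAt t a).mul (hχ.hasDerivAt_rhoAt t (n - a))).mul_const _).mul_const _

lemma IsMollifier.continuous_rhoAt (hχ : IsMollifier χ) (n : Fin 2 → ℤ) :
    Continuous fun t => rhoAt χ t n :=
  continuous_iff_continuousAt.2 fun t => (hχ.hasDerivAt_rhoAt t n).continuousAt

lemma IsMollifier.continuous_derivWickCoeff (hχ : IsMollifier χ) (N : ℕ) (n : Fin 2 → ℤ)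
    (γ : (Fin 2 → ℤ) → ℂ) : Continuous fun t => hχ.derivWickCoeff N n t γ := by
  unfold IsMollifier.derivWickCoeff
  have h1 := hχ.continuous_rhoAt
  have h2 := hχ.continuous_derivRho
  fun_prop

/-- A bound for `wickCoeff`, uniform in the mollification parameter `t ∈ (0, 1]`. -/
def IsMollifier.wickBound (hχ : IsMollifier χ) (N : ℕ) (n : Fin 2 → ℤ)
    (γ : (Fin 2 → ℤ) → ℂ) : ℝ≥0∞ :=
  ‖wickCoeff χ N n 1 γ‖ₑ + ∫⁻ t in Set.Ioc (0 : ℝ) 1, ‖hχ.derivWickCoeff N n t γ‖ₑ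

/-- The value at `ε` is the value at `1` minus the integral of the derivative over `[ε, 1]`. -/
lemma IsMollifier.enorm_wickCoeff_le (hχ : IsMollifier χ) (N : ℕ) (n : Fin 2 → ℤ)
    (γ : (Fin 2 → ℤ) → ℂ) {ε : ℝ} (hε : ε ∈ Set.Ioo (0 : ℝ) 1) :
    ‖wickCoeff χ N n ε γ‖ₑ ≤ hχ.wickBound N n γ := by
  have h := intervalIntegral.integral_eq_sub_of_hasDerivAt (a := ε) (b := 1)
    (fun t _ => hχ.hasDerivAt_wickCoeff N n t γ)
    ((hχ.continuous_derivWickCoeff N n γ).intervalIntegrable _ _)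
  have e : wickCoeff χ N n ε γ
      = wickCoeff χ N n 1 γ - ∫ t in ε..1, hχ.derivWickCoeff N n t γ := by rw [h]; ring
  rw [e, IsMollifier.wickBound, sub_eq_add_neg]
  refine (enorm_add_le _ _).trans ?_
  rw [enorm_neg, intervalIntegral.integral_of_le hε.2.le]
  gcongr
  exact (enorm_integral_le_lintegral_enorm _).trans
    (lintegral_mono_set (Set.Ioc_subset_Ioc_left hε.1.le))

/-- The lattice sum `∑_{a ≠ 0} ‖a‖ ^ (-17/8)`. -/
def latticeSum : ℝ := ∑' a : Fin 2 → ℤ, ‖a‖ ^ (-(17 / 8) : ℝ)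

lemma sum_norm_rpow_le (S : Finset (Fin 2 → ℤ)) :
    ∑ a ∈ S, ‖a‖ ^ (-(17 / 8) : ℝ) ≤ latticeSum :=
  (summable_norm_rpow (by norm_num)).sum_le_tsum S fun _ _ => by positivity

lemma sum_norm_sub_rpow_le (S : Finset (Fin 2 → ℤ)) (n : Fin 2 → ℤ) :
    ∑ a ∈ S, ‖n - a‖ ^ (-(17 / 8) : ℝ) ≤ latticeSum := by
  classical
  rw [← Finset.sum_image (s := S) (g := fun a => n - a) (f := fun a => ‖a‖ ^ (-(17 / 8) : ℝ))]
  · exact sum_norm_rpow_le _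
  · intro a _ b _ h; simpa using h

lemma latticeSum_nonneg : 0 ≤ latticeSum := tsum_nonneg fun _ => by positivity

/-- The trade-off between the decay in the output frequency `n` and the singularity at `t = 0`. -/
lemma weight_le {t x y z : ℝ} (ht : 0 < t) (hx : 1 ≤ x) (hy : 1 ≤ y) (hz : 1 ≤ z)
    (hxyz : z ≤ x + y) :
    (((1 + t * x) * (1 + t * y)) ^ 2)⁻¹ * (x ^ 2)⁻¹
      ≤ t ^ (-(15 / 8) : ℝ) * z ^ (-(7 / 4) : ℝ) * x ^ (-(17 / 8) : ℝ) := by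
  set X := (1 + t * x) * (1 + t * y) with hX
  have hxt : 0 < t * x := by positivity
  have hyt : 0 < t * y := by positivity
  have hX1 : 1 ≤ X := by nlinarith [mul_pos hxt hyt]
  have hXz : t * z ≤ X := by nlinarith [mul_pos hxt hyt, mul_le_mul_of_nonneg_left hxyz ht.le]
  have hXx : t * x ≤ X := by nlinarith [mul_pos hxt hyt]
  have h1 : (t * z) ^ (7 / 4 : ℝ) * (t * x) ^ (1 / 8 : ℝ) ≤ X ^ 2 := by
    calc _ ≤ X ^ (7 / 4 : ℝ) * X ^ (1 / 8 : ℝ) := by gcongr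
      _ = X ^ (15 / 8 : ℝ) := by rw [← Real.rpow_add (by positivity)]; norm_num
      _ ≤ X ^ (2 : ℝ) := Real.rpow_le_rpow_of_exponent_le hX1 (by norm_num)
      _ = X ^ 2 := by norm_cast
  have h2 : (X ^ 2)⁻¹ ≤ ((t * z) ^ (7 / 4 : ℝ) * (t * x) ^ (1 / 8 : ℝ))⁻¹ := by
    apply inv_anti₀ (by positivity) h1
  calc (X ^ 2)⁻¹ * (x ^ 2)⁻¹ ≤ ((t * z) ^ (7 / 4 : ℝ) * (t * x) ^ (1 / 8 : ℝ))⁻¹ * (x ^ 2)⁻¹ := by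
        gcongr
    _ = t ^ (-(15 / 8) : ℝ) * z ^ (-(7 / 4) : ℝ) * x ^ (-(17 / 8) : ℝ) := by
        have e1 : (15 / 8 : ℝ) = 7 / 4 + 1 / 8 := by norm_num
        have e2 : (17 / 8 : ℝ) = 1 / 8 + 2 := by norm_num
        rw [Real.mul_rpow ht.le (by positivity), Real.mul_rpow ht.le (by positivity),
          Real.rpow_neg ht.le, Real.rpow_neg (by positivity), Real.rpow_neg (by positivity),
          e1, e2, Real.rpow_add ht, Real.rpow_add (by positivity), Real.rpow_two, mul_inv, mul_inv,
          mul_inv, mul_inv, mul_inv]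
        ring

/-- The square sums of the coefficients of the second chaoses `derivWickCoeff` and `wickCoeff`.
The singularity `t ^ (-15/8)` is integrable after taking a square root. -/
lemma IsMollifier.exists_kernel_bound (hχ : IsMollifier χ) : ∃ C : ℝ, 0 < C ∧
    ∀ (n : Fin 2 → ℤ) (N : ℕ), n ≠ 0 →
      (∀ t ∈ Set.Ioc (0 : ℝ) 1, ∑ a ∈ pairSet N n,
        ‖(hχ.derivRho t a * rhoAt χ t (n - a) + rhoAt χ t a * hχ.derivRho t (n - a))
          * gradCoeff a (n - a)‖ ^ 2 ≤ C * t ^ (-(15 / 8) : ℝ) * ‖n‖ ^ (-(7 / 4) : ℝ)) ∧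
      ∑ a ∈ pairSet N n, ‖rhoAt χ 1 a * rhoAt χ 1 (n - a) * gradCoeff a (n - a)‖ ^ 2
        ≤ C * ‖n‖ ^ (-(7 / 4) : ℝ) := by
  obtain ⟨C, hC, hdec⟩ := hχ.exists_decay
  have hL := latticeSum_nonneg
  have key : ∀ (n : Fin 2 → ℤ) (N : ℕ) (t : ℝ), 0 < t → n ≠ 0 → ∑ a ∈ pairSet N n,
      (2 * C ^ 2 * (1 / ‖a‖ + 1 / ‖n - a‖) / ((1 + t * ‖a‖) * (1 + t * ‖n - a‖))) ^ 2
        ≤ (16 * C ^ 4 * latticeSum + 1) * t ^ (-(15 / 8) : ℝ) * ‖n‖ ^ (-(7 / 4) : ℝ) := by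
    intro n N t ht hn
    have hpt : ∀ a ∈ pairSet N n,
        (2 * C ^ 2 * (1 / ‖a‖ + 1 / ‖n - a‖) / ((1 + t * ‖a‖) * (1 + t * ‖n - a‖))) ^ 2
        ≤ 8 * C ^ 4 * (t ^ (-(15 / 8) : ℝ) * ‖n‖ ^ (-(7 / 4) : ℝ)) *
          (‖a‖ ^ (-(17 / 8) : ℝ) + ‖n - a‖ ^ (-(17 / 8) : ℝ)) := by
      intro a ha
      obtain ⟨ha0, han⟩ := ne_of_mem_pairSet ha
      have hx := one_le_norm ha0
      have hy := one_le_norm (sub_ne_zero.2 han.symm)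
      have hz := one_le_norm hn
      have hxyz : ‖n‖ ≤ ‖a‖ + ‖n - a‖ := by
        have := norm_add_le a (n - a); simpa using this
      have w1 := weight_le ht hx hy hz hxyz
      have w2 := weight_le ht hy hx hz (by rwa [add_comm])
      rw [mul_comm (1 + t * ‖n - a‖)] at w2
      set X := (1 + t * ‖a‖) * (1 + t * ‖n - a‖) with hX
      have hX0 : 0 < X := by positivity
      calc _ = 4 * C ^ 4 * ((X ^ 2)⁻¹ * (1 / ‖a‖ + 1 / ‖n - a‖) ^ 2) := by
            rw [div_pow]; ring
        _ ≤ 4 * C ^ 4 * ((X ^ 2)⁻¹ * (2 * ((‖a‖ ^ 2)⁻¹ + (‖n - a‖ ^ 2)⁻¹))) := by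
            gcongr
            rw [← inv_pow, ← inv_pow, one_div, one_div]
            nlinarith [sq_nonneg (‖a‖⁻¹ - ‖n - a‖⁻¹)]
        _ = 8 * C ^ 4 * ((X ^ 2)⁻¹ * (‖a‖ ^ 2)⁻¹ + (X ^ 2)⁻¹ * (‖n - a‖ ^ 2)⁻¹) := by ring
        _ ≤ 8 * C ^ 4 * (t ^ (-(15 / 8) : ℝ) * ‖n‖ ^ (-(7 / 4) : ℝ) * ‖a‖ ^ (-(17 / 8) : ℝ)
              + t ^ (-(15 / 8) : ℝ) * ‖n‖ ^ (-(7 / 4) : ℝ) * ‖n - a‖ ^ (-(17 / 8) : ℝ)) := by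
            gcongr
        _ = _ := by ring
    refine (Finset.sum_le_sum hpt).trans ?_
    rw [← Finset.mul_sum, Finset.sum_add_distrib]
    have s1 := sum_norm_rpow_le (pairSet N n)
    have s2 := sum_norm_sub_rpow_le (pairSet N n) n
    calc _ ≤ 8 * C ^ 4 * (t ^ (-(15 / 8) : ℝ) * ‖n‖ ^ (-(7 / 4) : ℝ)) *
          (latticeSum + latticeSum) := by gcongr
      _ = 16 * C ^ 4 * latticeSum * (t ^ (-(15 / 8) : ℝ) * ‖n‖ ^ (-(7 / 4) : ℝ)) := by ring
      _ ≤ (16 * C ^ 4 * latticeSum + 1) * (t ^ (-(15 / 8) : ℝ) * ‖n‖ ^ (-(7 / 4) : ℝ)) := by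
          gcongr; linarith
      _ = _ := by ring
  refine ⟨16 * C ^ 4 * latticeSum + 1, by positivity, fun n N hn => ⟨fun t ht => ?_, ?_⟩⟩
  · refine (Finset.sum_le_sum fun a ha => ?_).trans (key n N t ht.1 hn)
    obtain ⟨ha0, han⟩ := ne_of_mem_pairSet ha
    have hx := one_le_norm ha0
    have hb0 := sub_ne_zero.2 han.symm
    have hy := one_le_norm hb0
    have ht0 := ht.1
    obtain ⟨-, r1, d1⟩ := hdec t ht.1.le a
    obtain ⟨-, r2, d2⟩ := hdec t ht.1.le (n - a)
    have p1 : 0 < 1 + t * ‖a‖ := by positivity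
    have p2 : 0 < 1 + t * ‖n - a‖ := by positivity
    rw [mul_comm, ← le_div_iff₀ p1] at r1 d1
    rw [mul_comm, ← le_div_iff₀ p2] at r2 d2
    have hg := norm_gradCoeff_le ha0 hb0
    refine pow_le_pow_left₀ (norm_nonneg _) ?_ 2
    rw [norm_mul]
    calc _ ≤ (C * ‖a‖ / (1 + t * ‖a‖) * (C / (1 + t * ‖n - a‖))
          + C / (1 + t * ‖a‖) * (C * ‖n - a‖ / (1 + t * ‖n - a‖))) * (2 / (‖a‖ * ‖n - a‖)) := by
          gcongr
          refine (norm_add_le _ _).trans ?_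
          rw [norm_mul, norm_mul]
          gcongr
      _ = _ := by field_simp; ring
  · refine (Finset.sum_le_sum fun a ha => ?_).trans ((key n N 1 one_pos hn).trans (by simp))
    obtain ⟨ha0, han⟩ := ne_of_mem_pairSet ha
    have hx := one_le_norm ha0
    have hb0 := sub_ne_zero.2 han.symm
    have hy := one_le_norm hb0
    obtain ⟨-, r1, -⟩ := hdec 1 zero_le_one a
    obtain ⟨-, r2, -⟩ := hdec 1 zero_le_one (n - a)
    have p1 : 0 < 1 + 1 * ‖a‖ := by positivity
    have p2 : 0 < 1 + 1 * ‖n - a‖ := by positivity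
    rw [mul_comm, ← le_div_iff₀ p1] at r1
    rw [mul_comm, ← le_div_iff₀ p2] at r2
    have hg := norm_gradCoeff_le ha0 hb0
    refine pow_le_pow_left₀ (norm_nonneg _) ?_ 2
    rw [norm_mul, norm_mul]
    calc _ ≤ (C / (1 + 1 * ‖a‖) * (C / (1 + 1 * ‖n - a‖))) * (2 * (1 / ‖a‖ + 1 / ‖n - a‖)) := by
          gcongr
          refine hg.trans ?_
          rw [div_add_div _ _ (by positivity) (by positivity), ← mul_div_assoc]
          gcongr
          linarith
      _ = _ := by field_simp

variable {Ω : Type*} [MeasurableSpace Ω] {P : Measure Ω} {g : (Fin 2 → ℤ) → Ω → ℂ}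

lemma IsWhiteNoise.measurable_pair (hg : IsWhiteNoise P g) {N : ℕ} {n a : Fin 2 → ℤ}
    (ha : a ∈ pairSet N n) : Measurable fun ω => g a ω * g (n - a) ω :=
  (hg.measurable a (ne_of_mem_pairSet ha).1).mul
    (hg.measurable (n - a) (sub_ne_zero.2 (ne_of_mem_pairSet ha).2.symm))

lemma IsWhiteNoise.measurable_derivWickCoeff (hg : IsWhiteNoise P g) (hχ : IsMollifier χ) (N : ℕ)
    (n : Fin 2 → ℤ) :
    Measurable fun z : Ω × ℝ => hχ.derivWickCoeff N n z.2 fun m => g m z.1 := by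
  unfold IsMollifier.derivWickCoeff
  refine Finset.measurable_sum _ fun a ha => ?_
  have h1 := fun m => (hχ.continuous_rhoAt m).measurable
  have h2 := fun m => (hχ.continuous_derivRho m).measurable
  have h3 : Measurable fun z : Ω × ℝ => g a z.1 * g (n - a) z.1 :=
    (hg.measurable_pair ha).comp measurable_fst
  refine Measurable.mul ?_ h3
  fun_prop

lemma IsWhiteNoise.measurable_wickCoeff (hg : IsWhiteNoise P g) (N : ℕ) (n : Fin 2 → ℤ) (t : ℝ) :
    Measurable fun ω => wickCoeff χ N n t fun m => g m ω := by
  unfold wickCoeff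
  exact Finset.measurable_sum _ fun a ha => (hg.measurable_pair ha).const_mul _

lemma IsWhiteNoise.measurable_wickBound (hg : IsWhiteNoise P g) (hχ : IsMollifier χ) (N : ℕ)
    (n : Fin 2 → ℤ) : Measurable fun ω => hχ.wickBound N n fun m => g m ω := by
  unfold IsMollifier.wickBound
  refine (hg.measurable_wickCoeff N n 1).enorm.add ?_
  exact Measurable.lintegral_prod_right' (hg.measurable_derivWickCoeff hχ N n).enorm

lemma lintegral_rpow_Ioc :
    ∫⁻ t in Set.Ioc (0 : ℝ) 1, ENNReal.ofReal (t ^ (-(15 / 16) : ℝ)) = 16 := by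
  have hi : IntegrableOn (fun t : ℝ => t ^ (-(15 / 16) : ℝ)) (Set.Ioc 0 1) :=
    (intervalIntegrable_iff_integrableOn_Ioc_of_le zero_le_one).1
      (intervalIntegral.intervalIntegrable_rpow' (by norm_num))
  rw [← ofReal_integral_eq_lintegral_ofReal hi]
  · rw [← intervalIntegral.integral_of_le zero_le_one, integral_rpow (Or.inl (by norm_num))]
    norm_num
  · filter_upwards [ae_restrict_mem measurableSet_Ioc] with t ht
    have := ht.1
    positivity

/-- A weighted Cauchy–Schwarz inequality on `(0, 1]`. -/
lemma sq_lintegral_Ioc_le {f : ℝ → ℝ≥0∞} (hf : Measurable f) :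
    (∫⁻ t in Set.Ioc (0 : ℝ) 1, f t) ^ 2
      ≤ 16 * ∫⁻ t in Set.Ioc (0 : ℝ) 1, ENNReal.ofReal (t ^ (15 / 16 : ℝ)) * f t ^ 2 := by
  have h1 : ∫⁻ t in Set.Ioc (0 : ℝ) 1, f t = ∫⁻ t in Set.Ioc (0 : ℝ) 1,
      ((fun t => ENNReal.ofReal (t ^ (-(15 / 32) : ℝ))) *
        fun t => ENNReal.ofReal (t ^ (15 / 32 : ℝ)) * f t) t := by
    refine setLIntegral_congr_fun measurableSet_Ioc fun t ht => ?_
    have ht0 : 0 < t := ht.1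
    simp only [Pi.mul_apply]
    rw [← mul_assoc, ← ENNReal.ofReal_mul (by positivity), ← Real.rpow_add ht0]
    norm_num
  have h2 := ENNReal.lintegral_mul_le_Lp_mul_Lq (volume.restrict (Set.Ioc (0 : ℝ) 1))
    Real.HolderConjugate.two_two
    (f := fun t => ENNReal.ofReal (t ^ (-(15 / 32) : ℝ)))
    (g := fun t => ENNReal.ofReal (t ^ (15 / 32 : ℝ)) * f t) (by fun_prop) (by fun_prop)
  rw [h1]
  refine (pow_le_pow_left' h2 2).trans ?_
  rw [mul_pow, ← ENNReal.rpow_natCast, ← ENNReal.rpow_natCast, ← ENNReal.rpow_mul,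
    ← ENNReal.rpow_mul]
  norm_num
  have e1 : ∫⁻ t in Set.Ioc (0 : ℝ) 1, ENNReal.ofReal (t ^ (-(15 / 32) : ℝ)) ^ 2 = 16 := by
    rw [← lintegral_rpow_Ioc]
    refine setLIntegral_congr_fun measurableSet_Ioc fun t ht => ?_
    have ht0 : 0 < t := ht.1
    rw [← ENNReal.ofReal_pow (by positivity), ← Real.rpow_natCast, ← Real.rpow_mul ht0.le]
    norm_num
  have e2 : ∫⁻ t in Set.Ioc (0 : ℝ) 1, (ENNReal.ofReal (t ^ (15 / 32 : ℝ)) * f t) ^ 2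
      = ∫⁻ t in Set.Ioc (0 : ℝ) 1, ENNReal.ofReal (t ^ (15 / 16 : ℝ)) * f t ^ 2 := by
    refine setLIntegral_congr_fun measurableSet_Ioc fun t ht => ?_
    have ht0 : 0 < t := ht.1
    rw [mul_pow, ← ENNReal.ofReal_pow (by positivity), ← Real.rpow_natCast, ← Real.rpow_mul ht0.le]
    norm_num
  rw [e1, e2]

/-- The bound decays fast enough for the weight `‖n‖ ^ (-1/2)` of `H^{-1/4}`:
`1/2 + 7/4 = 9/4 > 2`. -/
lemma IsWhiteNoise.exists_lintegral_wickBound_le [IsProbabilityMeasure P] (hg : IsWhiteNoise P g)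
    (hχ : IsMollifier χ) : ∃ C : ℝ, 0 ≤ C ∧ ∀ (n : Fin 2 → ℤ) (N : ℕ), n ≠ 0 →
      ∫⁻ ω, (hχ.wickBound N n fun m => g m ω) ^ 2 ∂P
        ≤ ENNReal.ofReal (C * ‖n‖ ^ (-(7 / 4) : ℝ)) := by
  obtain ⟨C, hC, hker⟩ := hχ.exists_kernel_bound
  have hF := fourthMoment_nonneg
  refine ⟨2 * (2 * fourthMoment * C) + 512 * (2 * fourthMoment * C), by positivity,
    fun n N hn => ?_⟩
  obtain ⟨hk1, hk2⟩ := hker n N hn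
  have hne : ∀ a ∈ pairSet N n, a ≠ 0 ∧ a ≠ n := fun a ha => ne_of_mem_pairSet ha
  have hmD := hg.measurable_derivWickCoeff hχ N n
  have hb0 : ∫⁻ ω, ‖wickCoeff χ N n 1 fun m => g m ω‖ₑ ^ 2 ∂P
      ≤ ENNReal.ofReal (2 * fourthMoment * C * ‖n‖ ^ (-(7 / 4) : ℝ)) := by
    refine (hg.lintegral_chaos_le hn (pairSet N n) hne _).trans (ENNReal.ofReal_le_ofReal ?_)
    rw [mul_assoc (2 * fourthMoment)]
    gcongr
  have hb1 : ∀ t ∈ Set.Ioc (0 : ℝ) 1,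
      ∫⁻ ω, ‖hχ.derivWickCoeff N n t fun m => g m ω‖ₑ ^ 2 ∂P
      ≤ ENNReal.ofReal (2 * fourthMoment * (C * t ^ (-(15 / 8) : ℝ) * ‖n‖ ^ (-(7 / 4) : ℝ))) := by
    intro t ht
    refine (hg.lintegral_chaos_le hn (pairSet N n) hne _).trans (ENNReal.ofReal_le_ofReal ?_)
    gcongr
    exact hk1 t ht
  have hb2 : ∫⁻ ω, (∫⁻ t in Set.Ioc (0 : ℝ) 1, ‖hχ.derivWickCoeff N n t fun m => g m ω‖ₑ) ^ 2 ∂P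
      ≤ ENNReal.ofReal (256 * (2 * fourthMoment * C) * ‖n‖ ^ (-(7 / 4) : ℝ)) := by
    calc _ ≤ ∫⁻ ω, 16 * (∫⁻ t in Set.Ioc (0 : ℝ) 1, ENNReal.ofReal (t ^ (15 / 16 : ℝ)) *
            ‖hχ.derivWickCoeff N n t fun m => g m ω‖ₑ ^ 2) ∂P := by
          refine lintegral_mono fun ω => sq_lintegral_Ioc_le ?_
          exact (hχ.continuous_derivWickCoeff N n _).measurable.enorm
      _ = 16 * ∫⁻ t in Set.Ioc (0 : ℝ) 1, (∫⁻ ω, ENNReal.ofReal (t ^ (15 / 16 : ℝ)) *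
            ‖hχ.derivWickCoeff N n t fun m => g m ω‖ₑ ^ 2 ∂P) := by
          rw [lintegral_const_mul' _ _ (by norm_num), lintegral_lintegral_swap]
          have : Measurable fun z : Ω × ℝ => ENNReal.ofReal (z.2 ^ (15 / 16 : ℝ)) *
            ‖hχ.derivWickCoeff N n z.2 fun m => g m z.1‖ₑ ^ 2 := by fun_prop
          exact this.aemeasurable
      _ ≤ 16 * ∫⁻ t in Set.Ioc (0 : ℝ) 1, ENNReal.ofReal (t ^ (-(15 / 16) : ℝ)) *
            ENNReal.ofReal (2 * fourthMoment * C * ‖n‖ ^ (-(7 / 4) : ℝ)) := by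
          refine mul_le_mul_right (setLIntegral_mono' measurableSet_Ioc fun t ht => ?_) _
          have ht0 : 0 < t := ht.1
          rw [lintegral_const_mul' _ _ (by simp)]
          refine (mul_le_mul_right (hb1 t ht) _).trans (le_of_eq ?_)
          rw [← ENNReal.ofReal_mul (by positivity), ← ENNReal.ofReal_mul (by positivity)]
          congr 1
          have : t ^ (-(15 / 16) : ℝ) = t ^ (15 / 16 : ℝ) * t ^ (-(15 / 8) : ℝ) := by
            rw [← Real.rpow_add ht0]; norm_num
          rw [this]; ring
      _ = _ := by
          rw [lintegral_mul_const' _ _ (by simp), lintegral_rpow_Ioc, ← mul_assoc,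
            mul_assoc 256, ENNReal.ofReal_mul (by norm_num : (0 : ℝ) ≤ 256)]
          norm_num
  calc _ ≤ ∫⁻ ω, (2 * ‖wickCoeff χ N n 1 fun m => g m ω‖ₑ ^ 2 + 2 *
        (∫⁻ t in Set.Ioc (0 : ℝ) 1, ‖hχ.derivWickCoeff N n t fun m => g m ω‖ₑ) ^ 2) ∂P := by
        refine lintegral_mono fun ω => ?_
        rw [IsMollifier.wickBound, ← mul_add]
        have := ENNReal.rpow_add_le_mul_rpow_add_rpow (‖wickCoeff χ N n 1 fun m => g m ω‖ₑ)
          (∫⁻ t in Set.Ioc (0 : ℝ) 1, ‖hχ.derivWickCoeff N n t fun m => g m ω‖ₑ)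
          (p := 2) (by norm_num)
        norm_num at this
        exact this
    _ = 2 * ∫⁻ ω, ‖wickCoeff χ N n 1 fun m => g m ω‖ₑ ^ 2 ∂P + 2 * ∫⁻ ω,
        (∫⁻ t in Set.Ioc (0 : ℝ) 1, ‖hχ.derivWickCoeff N n t fun m => g m ω‖ₑ) ^ 2 ∂P := by
        have := (hg.measurable_wickCoeff (χ := χ) N n 1).enorm
        rw [lintegral_add_left (by fun_prop), lintegral_const_mul' _ _ (by norm_num),
          lintegral_const_mul' _ _ (by norm_num)]
    _ ≤ 2 * ENNReal.ofReal (2 * fourthMoment * C * ‖n‖ ^ (-(7 / 4) : ℝ))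
        + 2 * ENNReal.ofReal (256 * (2 * fourthMoment * C) * ‖n‖ ^ (-(7 / 4) : ℝ)) := by gcongr
    _ = _ := by
        rw [show (2 : ℝ≥0∞) = ENNReal.ofReal 2 by norm_num, ← ENNReal.ofReal_mul (by norm_num),
          ← ENNReal.ofReal_mul (by norm_num), ← ENNReal.ofReal_add (by positivity) (by positivity)]
        congr 1
        ring

end Wick

/-! ### The almost sure properties of the noise -/

/-- The number `2 ^ (1/16)`; all exponents of the dyadic estimates are multiples of `1/16`. -/
def dyadicBase : ℝ := (2 : ℝ) ^ (1 / 16 : ℝ)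

lemma dyadicBase_pow : dyadicBase ^ 16 = 2 := by
  rw [dyadicBase, ← Real.rpow_natCast, ← Real.rpow_mul (by norm_num)]; norm_num

lemma one_lt_dyadicBase : 1 < dyadicBase := Real.one_lt_rpow (by norm_num) (by norm_num)

lemma dyadicBase_pos : 0 < dyadicBase := one_pos.trans one_lt_dyadicBase

lemma dyadicBase_pow_mul (k : ℕ) : dyadicBase ^ (16 * k) = 2 ^ k := by
  rw [pow_mul, dyadicBase_pow]

/-- The multiplier of `Δ⁻¹`. -/
def invLaplace (n : Fin 2 → ℤ) : ℂ := if n = 0 then 0 else -((normSq n : ℂ)⁻¹)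

lemma YCoeff_eq (γ : (Fin 2 → ℤ) → ℂ) (n : Fin 2 → ℤ) : YCoeff γ n = γ n * invLaplace n := by
  unfold YCoeff invLaplace
  split_ifs
  · simp
  · rw [mul_neg, div_eq_mul_inv]

lemma norm_invLaplace_le {n : Fin 2 → ℤ} (hn : n ≠ 0) : ‖invLaplace n‖ ≤ (‖n‖ ^ 2)⁻¹ := by
  have h1 := one_le_norm hn
  have h2 := norm_sq_le_normSq n
  rw [invLaplace, if_neg hn, norm_neg, norm_inv, Complex.norm_real,
    Real.norm_of_nonneg (normSq_nonneg n)]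
  exact inv_anti₀ (by positivity) h2

lemma norm_invLaplace_block_le {k : ℕ} {n : Fin 2 → ℤ} (hn : n ∈ block k) :
    ‖invLaplace n‖ ≤ (4 ^ k)⁻¹ := by
  refine (norm_invLaplace_le (ne_zero_of_mem_block hn)).trans (inv_anti₀ (by positivity) ?_)
  have := (block_norm hn).1
  calc (4 : ℝ) ^ k = (2 ^ k) ^ 2 := by rw [← pow_mul, mul_comm, pow_mul]; norm_num
    _ ≤ _ := by gcongr

/-- The translation by the angle `(π / 2) 2 ^ (-l)` in the `j`-th coordinate. -/
def dyadicShift (l : ℕ) (j : Fin 2) : T2 :=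
  fun i => ((if i = j then 1 / (4 * 2 ^ l) else 0 : ℝ) : UnitAddCircle)

lemma mFourier_dyadicShift (n : Fin 2 → ℤ) (l : ℕ) (j : Fin 2) :
    mFourier n (dyadicShift l j)
      = Complex.exp (Complex.I * (Real.pi / 2 * n j / 2 ^ l : ℝ)) := by
  unfold dyadicShift
  simp only [mFourier, ContinuousMap.coe_mk, Fin.prod_univ_two, fourier_coe_apply]
  rw [← Complex.exp_add]
  congr 1
  fin_cases j <;>
  · simp
    field_simp
    ring

lemma norm_mFourier_dyadicShift_sub_one_le (n : Fin 2 → ℤ) (l : ℕ) (j : Fin 2) :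
    ‖mFourier n (dyadicShift l j) - 1‖ ≤ 2 * ‖n‖ / 2 ^ l := by
  rw [mFourier_dyadicShift]
  refine (Real.norm_exp_I_mul_ofReal_sub_one_le).trans ?_
  rw [norm_div, norm_mul, Real.norm_of_nonneg (by positivity : 0 ≤ Real.pi / 2),
    Real.norm_of_nonneg (by positivity : (0 : ℝ) ≤ 2 ^ l)]
  have h1 := abs_coord_le_norm n j
  rw [← Real.norm_eq_abs] at h1
  gcongr
  linarith [Real.pi_lt_four]

lemma norm_mFourier_sub_one_le_two (n : Fin 2 → ℤ) (x : T2) : ‖mFourier n x - 1‖ ≤ 2 := by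
  refine (norm_sub_le _ _).trans ?_
  rw [norm_mFourier_apply, norm_one]; norm_num

/-- The shift of scale `l` turns a frequency of size between `2 ^ l` and `2 ^ (l + 1)` by an angle
between `π / 2` and `π`. -/
lemma one_le_norm_mFourier_dyadicShift_sub_one {n : Fin 2 → ℤ} {l : ℕ} {j : Fin 2}
    (h1 : 2 ^ l ≤ |n j|) (h2 : |n j| < 2 ^ (l + 1)) :
    1 ≤ ‖mFourier n (dyadicShift l j) - 1‖ := by
  have h1' : (2 : ℝ) ^ l ≤ |(n j : ℝ)| := by exact_mod_cast h1
  have h2' : |(n j : ℝ)| ≤ 2 ^ (l + 1) := by exact_mod_cast h2.le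
  set θ : ℝ := Real.pi / 2 * n j / 2 ^ l with hθ
  have habs : |θ| = Real.pi / 2 * (|(n j : ℝ)| / 2 ^ l) := by
    rw [hθ, mul_div_assoc, abs_mul, abs_div (n j : ℝ),
      abs_of_nonneg (by positivity : 0 ≤ Real.pi / 2),
      abs_of_nonneg (by positivity : (0 : ℝ) ≤ 2 ^ l)]
  have hcos : Real.cos θ ≤ 0 := by
    rw [← Real.cos_abs]
    apply Real.cos_nonpos_of_pi_div_two_le_of_le
    · rw [habs]
      have : 1 ≤ |(n j : ℝ)| / 2 ^ l := by rw [le_div_iff₀ (by positivity)]; linarith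
      nlinarith [Real.pi_pos]
    · rw [habs]
      have : |(n j : ℝ)| / 2 ^ l ≤ 2 := by
        rw [div_le_iff₀ (by positivity)]; rw [pow_succ] at h2'; linarith
      nlinarith [Real.pi_pos]
  rw [mFourier_dyadicShift, ← hθ]
  have hre : (Complex.exp (Complex.I * (θ : ℝ)) - 1).re = Real.cos θ - 1 := by
    rw [mul_comm, Complex.sub_re, Complex.exp_ofReal_mul_I_re, Complex.one_re]
  calc (1 : ℝ) ≤ |Real.cos θ - 1| := by rw [abs_of_nonpos (by linarith)]; linarith
    _ = |(Complex.exp (Complex.I * (θ : ℝ)) - 1).re| := by rw [hre]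
    _ ≤ _ := Complex.abs_re_le_norm _

/-- The multiplier of the increment `Y(· + h) - Y` for a dyadic translation `h`. -/
def incCoeff (l : ℕ) (j : Fin 2) (n : Fin 2 → ℤ) : ℂ :=
  invLaplace n * (mFourier n (dyadicShift l j) - 1)

/-- The exponents `5 / 16` interpolate between the bounds `2` and `2 ‖n‖ / 2 ^ l` for
`‖mFourier n h - 1‖`. -/
lemma norm_incCoeff_block_le {k : ℕ} {n : Fin 2 → ℤ} (hn : n ∈ block k) (l : ℕ) (j : Fin 2) :
    ‖incCoeff l j n‖ ≤ 4 * (4 ^ k)⁻¹ * dyadicBase ^ (5 * k) / dyadicBase ^ (5 * l) := by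
  have hq := one_lt_dyadicBase
  have hq0 := dyadicBase_pos
  have h : ‖mFourier n (dyadicShift l j) - 1‖
      ≤ 4 * dyadicBase ^ (5 * k) / dyadicBase ^ (5 * l) := by
    rw [le_div_iff₀ (by positivity)]
    rcases le_total l k with hlk | hlk
    · calc _ ≤ 2 * dyadicBase ^ (5 * k) := by
            gcongr
            · exact norm_mFourier_sub_one_le_two _ _
            · exact hq.le
        _ ≤ _ := by gcongr; norm_num
    · have h1 := norm_mFourier_dyadicShift_sub_one_le n l j
      have h2 : 2 * ‖n‖ / 2 ^ l ≤ 4 * 2 ^ k / 2 ^ l := by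
        have := (block_norm hn).2
        rw [pow_succ] at this
        apply div_le_div_of_nonneg_right _ (by positivity)
        linarith
      calc _ ≤ 4 * 2 ^ k / 2 ^ l * dyadicBase ^ (5 * l) := by gcongr; exact h1.trans h2
        _ ≤ _ := by
          rw [div_mul_eq_mul_div, div_le_iff₀ (by positivity), ← dyadicBase_pow_mul,
            ← dyadicBase_pow_mul, mul_assoc, mul_assoc, ← pow_add, ← pow_add]
          exact mul_le_mul_of_nonneg_left (pow_le_pow_right₀ hq.le (by omega)) (by norm_num)
  rw [incCoeff, norm_mul]
  calc _ ≤ (4 ^ k)⁻¹ * (4 * dyadicBase ^ (5 * k) / dyadicBase ^ (5 * l)) := by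
        gcongr; exact norm_invLaplace_block_le hn
    _ = _ := by ring

/-- The properties of a realisation `γ` of the noise on which the deterministic part of the argument
rests: the growth of the noise, bounds for `Y`, for its dyadic increments, and for the `H^{-1/4}`
norm of the nonconstant part of `|∇Y_ε|²`, none of which depends on `ε`. -/
structure GoodRealisation {χ : EuclideanSpace ℝ (Fin 2) → ℝ} (hχ : IsMollifier χ)
    (γ : (Fin 2 → ℤ) → ℂ) : Prop where
  conj_symm : ∀ n, n ≠ 0 → conj (γ n) = γ (-n)
  growth : ∃ C : ℝ, 0 ≤ C ∧ ∀ n, n ≠ 0 → ‖γ n‖ ≤ C * ‖n‖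
  sup : ∑' k : ℕ, ENNReal.ofReal (dyadicBase ^ (4 * k) * blockSq invLaplace k γ) < ∞
  increment : ∀ j, ∑' l : ℕ, ∑' k : ℕ,
    ENNReal.ofReal (dyadicBase ^ (8 * l + 4 * k) * blockSq (incCoeff l j) k γ) < ∞
  wick : ∑' n : Fin 2 → ℤ, (if n = 0 then 0 else ENNReal.ofReal (‖n‖ ^ (-(1 / 2) : ℝ)) *
    liminf (fun N => hχ.wickBound N n γ ^ 2) atTop) < ∞

section WhiteNoise

variable {Ω : Type*} [MeasurableSpace Ω] {P : Measure Ω} [IsProbabilityMeasure P]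
  {g : (Fin 2 → ℤ) → Ω → ℂ}

/-- A crude polynomial bound; it makes the Fourier series of `Y_ε` absolutely convergent. -/
lemma IsWhiteNoise.ae_growth (hg : IsWhiteNoise P g) :
    ∀ᵐ ω ∂P, ∃ C : ℝ, 0 ≤ C ∧ ∀ n, n ≠ 0 → ‖g n ω‖ ≤ C * ‖n‖ := by
  let f : (Fin 2 → ℤ) → Ω → ℝ≥0∞ := fun n ω =>
    if n = 0 then 0 else ENNReal.ofReal (‖n‖ ^ (-3 : ℝ)) * ENNReal.ofReal (‖g n ω‖ ^ 4)
  have hf : ∀ n, Measurable (f n) := by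
    intro n
    by_cases hn : n = 0
    · simp only [f, hn, if_true]; exact measurable_const
    · have := hg.measurable n hn
      simp only [f, hn, if_false]; fun_prop
  have hF := fourthMoment_nonneg
  have h1 : ∀ n, ∫⁻ ω, f n ω ∂P ≤ ENNReal.ofReal (fourthMoment * ‖n‖ ^ (-3 : ℝ)) := by
    intro n
    by_cases hn : n = 0
    · simp [f, hn]
    · simp only [f, hn, if_false]
      rw [lintegral_const_mul' _ _ (by simp), ← ofReal_integral_eq_lintegral_ofReal
        (hg.integrable_pow_four hn) (ae_of_all _ fun ω => by positivity), hg.integral_pow_four hn,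
        ← ENNReal.ofReal_mul (by positivity), mul_comm]
  have h2 : ∫⁻ ω, ∑' n, f n ω ∂P ≠ ∞ := by
    rw [lintegral_tsum fun n => (hf n).aemeasurable]
    have hs : Summable fun n : Fin 2 → ℤ => fourthMoment * ‖n‖ ^ (-3 : ℝ) :=
      (summable_norm_rpow (by norm_num)).mul_left _
    exact ne_top_of_le_ne_top hs.tsum_ofReal_ne_top (ENNReal.tsum_le_tsum h1)
  filter_upwards [ae_lt_top (Measurable.tsum hf) h2] with ω hω
  set B := (∑' n, f n ω).toReal with hB
  have hB0 : 0 ≤ B := ENNReal.toReal_nonneg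
  refine ⟨1 + B, by positivity, fun n hn => ?_⟩
  have h3 : f n ω ≤ ENNReal.ofReal B := by
    rw [hB, ENNReal.ofReal_toReal hω.ne]; exact ENNReal.le_tsum n
  simp only [f, hn, if_false] at h3
  rw [← ENNReal.ofReal_mul (by positivity), ENNReal.ofReal_le_ofReal_iff hB0] at h3
  have hn1 := one_le_norm hn
  have h4 : ‖g n ω‖ ^ 4 ≤ B * ‖n‖ ^ 3 := by
    rw [Real.rpow_neg (by positivity), inv_mul_le_iff₀ (by positivity)] at h3
    calc _ ≤ ‖n‖ ^ (3 : ℝ) * B := h3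
      _ = B * ‖n‖ ^ 3 := by rw [mul_comm]; norm_cast
  have h5 : B ≤ (1 + B) ^ 4 := by nlinarith [pow_nonneg hB0 2, pow_nonneg hB0 3, pow_nonneg hB0 4]
  refine le_of_pow_le_pow_left₀ (n := 4) (by norm_num) (by positivity) ?_
  calc _ ≤ B * ‖n‖ ^ 3 := h4
    _ ≤ (1 + B) ^ 4 * ‖n‖ ^ 4 := by
        exact mul_le_mul h5 (pow_le_pow_right₀ hn1 (by norm_num)) (by positivity) (by positivity)
    _ = _ := by rw [mul_pow]

lemma summable_dyadicBase_inv : Summable fun k : ℕ => (dyadicBase⁻¹) ^ k :=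
  summable_geometric_of_lt_one (inv_nonneg.2 dyadicBase_pos.le)
    (inv_lt_one_of_one_lt₀ one_lt_dyadicBase)

lemma four_pow_eq (k : ℕ) : (4 : ℝ) ^ k = dyadicBase ^ (32 * k) := by
  rw [show 32 * k = 16 * (2 * k) by ring, dyadicBase_pow_mul, pow_mul]; norm_num

lemma eight_pow_eq (k : ℕ) : (8 : ℝ) ^ k = dyadicBase ^ (48 * k) := by
  rw [show 48 * k = 16 * (3 * k) by ring, dyadicBase_pow_mul, pow_mul]; norm_num

lemma IsWhiteNoise.ae_sup (hg : IsWhiteNoise P g) :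
    ∀ᵐ ω ∂P, ∑' k : ℕ, ENNReal.ofReal
      (dyadicBase ^ (4 * k) * blockSq invLaplace k fun n => g n ω) < ∞ := by
  have hq0 := dyadicBase_pos
  have hK := blockConst_nonneg
  have hm : ∀ k, Measurable fun ω => ENNReal.ofReal
      (dyadicBase ^ (4 * k) * blockSq invLaplace k fun n => g n ω) := fun k => by
    have := hg.measurable_blockSq invLaplace k
    fun_prop
  refine ae_lt_top (Measurable.tsum hm) ?_
  rw [lintegral_tsum fun k => (hm k).aemeasurable]
  have h1 : ∀ k, ∫⁻ ω, ENNReal.ofReal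
      (dyadicBase ^ (4 * k) * blockSq invLaplace k fun n => g n ω) ∂P
      ≤ ENNReal.ofReal (blockConst * (dyadicBase⁻¹) ^ k) := by
    intro k
    simp only [ENNReal.ofReal_mul (pow_nonneg hq0.le (4 * k))]
    rw [lintegral_const_mul' _ _ (by simp)]
    refine (mul_le_mul_right (hg.lintegral_blockSq_le (A := (4 ^ k)⁻¹) (by positivity)
      fun n hn => norm_invLaplace_block_le hn) _).trans ?_
    rw [← ENNReal.ofReal_mul (by positivity)]
    apply ENNReal.ofReal_le_ofReal
    rw [four_pow_eq, eight_pow_eq]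
    have : dyadicBase ^ (4 * k) * (blockConst * ((dyadicBase ^ (32 * k))⁻¹) ^ 2 *
        dyadicBase ^ (48 * k)) = blockConst * (dyadicBase ^ (12 * k))⁻¹ := by
      field_simp
      ring
    rw [this, inv_pow]
    gcongr
    · exact one_lt_dyadicBase.le
    · omega
  exact ne_top_of_le_ne_top (summable_dyadicBase_inv.mul_left _).tsum_ofReal_ne_top
    (ENNReal.tsum_le_tsum h1)

lemma IsWhiteNoise.ae_increment (hg : IsWhiteNoise P g) (j : Fin 2) :
    ∀ᵐ ω ∂P, ∑' l : ℕ, ∑' k : ℕ, ENNReal.ofReal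
      (dyadicBase ^ (8 * l + 4 * k) * blockSq (incCoeff l j) k fun n => g n ω) < ∞ := by
  have hq0 := dyadicBase_pos
  have hK := blockConst_nonneg
  have hm : ∀ l k, Measurable fun ω => ENNReal.ofReal
      (dyadicBase ^ (8 * l + 4 * k) * blockSq (incCoeff l j) k fun n => g n ω) := fun l k => by
    have := hg.measurable_blockSq (incCoeff l j) k
    fun_prop
  refine ae_lt_top (Measurable.tsum fun l => Measurable.tsum (hm l)) ?_
  rw [lintegral_tsum fun l => (Measurable.tsum (hm l)).aemeasurable]
  have h1 : ∀ l k, ∫⁻ ω, ENNReal.ofReal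
      (dyadicBase ^ (8 * l + 4 * k) * blockSq (incCoeff l j) k fun n => g n ω) ∂P
      ≤ ENNReal.ofReal ((16 * blockConst * (dyadicBase⁻¹) ^ l) * (dyadicBase⁻¹) ^ k) := by
    intro l k
    simp only [ENNReal.ofReal_mul (pow_nonneg hq0.le (8 * l + 4 * k))]
    rw [lintegral_const_mul' _ _ (by simp)]
    refine (mul_le_mul_right (hg.lintegral_blockSq_le
      (A := 4 * (4 ^ k)⁻¹ * dyadicBase ^ (5 * k) / dyadicBase ^ (5 * l)) (by positivity)
      fun n hn => norm_incCoeff_block_le hn l j) _).trans ?_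
    rw [← ENNReal.ofReal_mul (by positivity)]
    apply ENNReal.ofReal_le_ofReal
    rw [four_pow_eq, eight_pow_eq]
    have : dyadicBase ^ (8 * l + 4 * k) * (blockConst * (4 * (dyadicBase ^ (32 * k))⁻¹ *
        dyadicBase ^ (5 * k) / dyadicBase ^ (5 * l)) ^ 2 * dyadicBase ^ (48 * k))
        = 16 * blockConst * (dyadicBase ^ (2 * l))⁻¹ * (dyadicBase ^ (2 * k))⁻¹ := by
      field_simp
      ring
    rw [this, inv_pow, inv_pow]
    gcongr
    · exact one_lt_dyadicBase.le
    · omega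
    · exact one_lt_dyadicBase.le
    · omega
  have h2 : ∀ l, ∫⁻ ω, ∑' k : ℕ, ENNReal.ofReal
      (dyadicBase ^ (8 * l + 4 * k) * blockSq (incCoeff l j) k fun n => g n ω) ∂P
      ≤ ENNReal.ofReal
        ((∑' k : ℕ, (dyadicBase⁻¹) ^ k) * (16 * blockConst) * (dyadicBase⁻¹) ^ l) := by
    intro l
    rw [lintegral_tsum fun k => (hm l k).aemeasurable]
    refine (ENNReal.tsum_le_tsum (h1 l)).trans ?_
    rw [← ENNReal.ofReal_tsum_of_nonneg (fun k => by positivity)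
      (summable_dyadicBase_inv.mul_left _), tsum_mul_left]
    exact le_of_eq (by congr 1; ring)
  exact ne_top_of_le_ne_top (summable_dyadicBase_inv.mul_left _).tsum_ofReal_ne_top
    (ENNReal.tsum_le_tsum h2)

lemma IsWhiteNoise.ae_wick (hg : IsWhiteNoise P g) {χ : EuclideanSpace ℝ (Fin 2) → ℝ}
    (hχ : IsMollifier χ) :
    ∀ᵐ ω ∂P, ∑' n : Fin 2 → ℤ, (if n = 0 then 0 else ENNReal.ofReal (‖n‖ ^ (-(1 / 2) : ℝ)) *
      liminf (fun N => (hχ.wickBound N n fun m => g m ω) ^ 2) atTop) < ∞ := by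
  obtain ⟨C, hC, hb⟩ := hg.exists_lintegral_wickBound_le hχ
  have hm0 : ∀ n N, Measurable fun ω => (hχ.wickBound N n fun m => g m ω) ^ 2 :=
    fun n N => (hg.measurable_wickBound hχ N n).pow_const 2
  have hm : ∀ n : Fin 2 → ℤ, Measurable fun ω => if n = 0 then (0 : ℝ≥0∞) else
      ENNReal.ofReal (‖n‖ ^ (-(1 / 2) : ℝ)) *
        liminf (fun N => (hχ.wickBound N n fun m => g m ω) ^ 2) atTop := by
    intro n
    split_ifs
    · exact measurable_const
    · exact (Measurable.liminf (hm0 n)).const_mul _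
  refine ae_lt_top (Measurable.tsum hm) ?_
  rw [lintegral_tsum fun n => (hm n).aemeasurable]
  have h1 : ∀ n : Fin 2 → ℤ, ∫⁻ ω, (if n = 0 then (0 : ℝ≥0∞) else
      ENNReal.ofReal (‖n‖ ^ (-(1 / 2) : ℝ)) *
        liminf (fun N => (hχ.wickBound N n fun m => g m ω) ^ 2) atTop) ∂P
      ≤ ENNReal.ofReal (C * ‖n‖ ^ (-(9 / 4) : ℝ)) := by
    intro n
    by_cases hn : n = 0
    · simp [hn]
    simp only [hn, if_false]
    rw [lintegral_const_mul' _ _ (by simp)]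
    have h2 : ∫⁻ ω, liminf (fun N => (hχ.wickBound N n fun m => g m ω) ^ 2) atTop ∂P
        ≤ ENNReal.ofReal (C * ‖n‖ ^ (-(7 / 4) : ℝ)) := by
      refine (lintegral_liminf_le (hm0 n)).trans ?_
      refine (liminf_le_liminf (Eventually.of_forall fun N => hb n N hn)).trans ?_
      simp
    refine (mul_le_mul_right h2 _).trans (le_of_eq ?_)
    have hn1 := one_le_norm hn
    rw [← ENNReal.ofReal_mul (by positivity)]
    congr 1
    rw [show (-(9 / 4) : ℝ) = -(1 / 2) + -(7 / 4) by norm_num, Real.rpow_add (by positivity)]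
    ring
  have hs : Summable fun n : Fin 2 → ℤ => C * ‖n‖ ^ (-(9 / 4) : ℝ) :=
    (summable_norm_rpow (by norm_num)).mul_left _
  exact ne_top_of_le_ne_top hs.tsum_ofReal_ne_top (ENNReal.tsum_le_tsum h1)

theorem IsWhiteNoise.ae_goodRealisation (hg : IsWhiteNoise P g)
    {χ : EuclideanSpace ℝ (Fin 2) → ℝ} (hχ : IsMollifier χ) :
    ∀ᵐ ω ∂P, GoodRealisation hχ fun n => g n ω := by
  filter_upwards [hg.ae_conj, hg.ae_growth, hg.ae_sup, ae_all_iff.2 hg.ae_increment, hg.ae_wick hχ]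
    with ω h1 h2 h3 h4 h5
  exact ⟨h1, h2, h3, h4, h5⟩

end WhiteNoise

/-! ### The mollified fields of a good realisation -/

/-- The translation by the angle `s` in the `j`-th coordinate. -/
def line (j : Fin 2) (s : ℝ) : T2 :=
  fun i => ((if i = j then s / (2 * Real.pi) else 0 : ℝ) : UnitAddCircle)

lemma mFourier_line (n : Fin 2 → ℤ) (j : Fin 2) (s : ℝ) :
    mFourier n (line j s) = Complex.exp (Complex.I * n j * s) := by
  unfold line
  simp only [mFourier, ContinuousMap.coe_mk, Fin.prod_univ_two, fourier_coe_apply]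
  rw [← Complex.exp_add]
  congr 1
  have : (Real.pi : ℂ) ≠ 0 := by exact_mod_cast Real.pi_ne_zero
  fin_cases j <;>
  · simp
    field_simp

lemma hasDerivAt_mFourier_line (n : Fin 2 → ℤ) (j : Fin 2) (x : T2) (s : ℝ) :
    HasDerivAt (fun s => mFourier n (x + line j s))
      (Complex.I * n j * mFourier n (x + line j s)) s := by
  simp only [mFourier_apply_add, mFourier_line]
  have h1 : HasDerivAt (fun s : ℝ => Complex.I * n j * (s : ℂ)) (Complex.I * n j) s := by
    simpa using (Complex.ofRealCLM.hasDerivAt (x := s)).const_mul (Complex.I * (n j : ℂ))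
  exact ((h1.cexp).const_mul (mFourier n x)).congr_deriv (by ring)

lemma integral_mFourier (n : Fin 2 → ℤ) :
    ∫ x : T2, mFourier n x = if n = 0 then 1 else 0 := by
  have h := orthonormal_iff_ite.1 (orthonormal_mFourier (d := Fin 2)) 0 n
  rw [ContinuousMap.inner_toLp] at h
  simp only [mFourier_zero, ContinuousMap.one_apply, map_one, mul_one,
    eq_comm (a := (0 : Fin 2 → ℤ))] at h
  exact h

section Fields

variable {χ : EuclideanSpace ℝ (Fin 2) → ℝ} {hχ : IsMollifier χ} {γ : (Fin 2 → ℤ) → ℂ}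

lemma GoodRealisation.exists_coeff_bound (h : GoodRealisation hχ γ) {ε : ℝ} (hε : 0 < ε) :
    ∃ C : ℝ, 0 ≤ C ∧ ∀ n, ‖rhoAt χ ε n * YCoeff γ n‖ ≤ C * ‖n‖ ^ (-5 : ℝ) := by
  obtain ⟨C, hC, hdec⟩ := hχ.exists_decay
  obtain ⟨G, hG, hgr⟩ := h.growth
  refine ⟨C / ε ^ 4 * G, by positivity, fun n => ?_⟩
  by_cases hn : n = 0
  · simp only [YCoeff, hn, if_true, mul_zero, norm_zero]
    positivity
  have hn1 := one_le_norm hn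
  have h1 := (hdec ε hε.le n).1
  rw [mul_comm, ← le_div_iff₀ (by positivity)] at h1
  rw [norm_mul, YCoeff_eq, norm_mul]
  calc _ ≤ C / (ε * ‖n‖) ^ 4 * (G * ‖n‖ * (‖n‖ ^ 2)⁻¹) := by
        gcongr
        · exact hgr n hn
        · exact norm_invLaplace_le hn
    _ = _ := by
        rw [Real.rpow_neg (by positivity)]
        have : ‖n‖ ^ (5 : ℝ) = ‖n‖ ^ 5 := by norm_cast
        rw [this]
        field_simp

lemma GoodRealisation.exists_summable_bound (h : GoodRealisation hχ γ) {ε : ℝ} (hε : 0 < ε) :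
    ∃ u : (Fin 2 → ℤ) → ℝ, Summable u ∧ ∀ n, ‖rhoAt χ ε n * YCoeff γ n‖ ≤ u n ∧
      ∀ j, ‖rhoAt χ ε n * YCoeff γ n * (Complex.I * n j)‖ ≤ u n := by
  obtain ⟨C, hC, hb⟩ := h.exists_coeff_bound hε
  refine ⟨fun n => C * ‖n‖ ^ (-4 : ℝ), (summable_norm_rpow (by norm_num)).mul_left _, fun n => ?_⟩
  by_cases hn : n = 0
  · subst hn
    simp [YCoeff]
  have hn1 := one_le_norm hn
  refine ⟨(hb n).trans ?_, fun j => ?_⟩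
  · exact mul_le_mul_of_nonneg_left (Real.rpow_le_rpow_of_exponent_le hn1 (by norm_num)) hC
  · rw [norm_mul, norm_mul Complex.I, Complex.norm_I, one_mul, Complex.norm_intCast]
    simp only
    calc _ ≤ C * ‖n‖ ^ (-5 : ℝ) * ‖n‖ := by
          gcongr
          · exact hb n
          · exact abs_coord_le_norm n j
      _ = _ := by
          rw [mul_assoc, ← Real.rpow_add_one (by positivity)]; norm_num

lemma summable_mul_mFourier {u : (Fin 2 → ℤ) → ℝ} (hu : Summable u) {c : (Fin 2 → ℤ) → ℂ}
    (hc : ∀ n, ‖c n‖ ≤ u n) (x : T2) : Summable fun n => c n * mFourier n x :=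
  Summable.of_norm_bounded hu fun n => by rw [norm_mul, norm_mFourier_apply, mul_one]; exact hc n

lemma continuous_tsum_mFourier {u : (Fin 2 → ℤ) → ℝ} (hu : Summable u) {c : (Fin 2 → ℤ) → ℂ}
    (hc : ∀ n, ‖c n‖ ≤ u n) : Continuous fun x : T2 => ∑' n, c n * mFourier n x :=
  continuous_tsum (fun n => by fun_prop) hu fun n x => by
    rw [norm_mul, norm_mFourier_apply, mul_one]; exact hc n

/-- A Fourier series with conjugate-symmetric coefficients is real. -/
lemma conj_tsum_mFourier {c : (Fin 2 → ℤ) → ℂ} (hc : ∀ n, conj (c n) = c (-n)) (x : T2) :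
    conj (∑' n, c n * mFourier n x) = ∑' n, c n * mFourier n x := by
  have h1 : conj (∑' n, c n * mFourier n x) = ∑' n, conj (c n * mFourier n x) :=
    Complex.conjCLE.map_tsum
  rw [h1, ← (Equiv.neg (Fin 2 → ℤ)).tsum_eq]
  refine tsum_congr fun n => ?_
  simp [hc, mFourier_neg]

lemma GoodRealisation.conj_YCoeff (h : GoodRealisation hχ γ) (n : Fin 2 → ℤ) :
    conj (YCoeff γ n) = YCoeff γ (-n) := by
  unfold YCoeff
  by_cases hn : n = 0
  · simp [hn]
  · simp [hn, h.conj_symm n hn, normSq_neg]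

lemma GoodRealisation.conj_Yeps (h : GoodRealisation hχ γ) (ε : ℝ) (x : T2) :
    conj (Yeps χ ε γ x) = Yeps χ ε γ x :=
  conj_tsum_mFourier (fun n => by rw [map_mul, conj_rhoAt, h.conj_YCoeff]) x

lemma GoodRealisation.conj_partialYeps (h : GoodRealisation hχ γ) (ε : ℝ) (j : Fin 2) (x : T2) :
    conj (partialYeps χ ε γ j x) = partialYeps χ ε γ j x :=
  conj_tsum_mFourier (fun n => by
    rw [map_mul, map_mul, conj_rhoAt, h.conj_YCoeff]; simp) x

lemma conj_Ceps (ε : ℝ) : conj (Ceps χ ε) = Ceps χ ε := by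
  have h1 : conj (Ceps χ ε) = ∑' n : Fin 2 → ℤ, conj (if n = 0 then 0 else
      rhoAt χ ε n ^ 2 / (normSq n : ℂ)) := Complex.conjCLE.map_tsum
  rw [h1, Ceps, ← (Equiv.neg (Fin 2 → ℤ)).tsum_eq]
  refine tsum_congr fun n => ?_
  by_cases hn : n = 0
  · simp [hn]
  · simp [hn, normSq_neg, conj_rhoAt]

lemma GoodRealisation.hasDerivAt_Yeps (h : GoodRealisation hχ γ) {ε : ℝ} (hε : 0 < ε) (j : Fin 2)
    (x : T2) (s : ℝ) :
    HasDerivAt (fun s => Yeps χ ε γ (x + line j s)) (partialYeps χ ε γ j (x + line j s)) s := by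
  obtain ⟨u, hu, hb⟩ := h.exists_summable_bound hε
  have := hasDerivAt_tsum (g := fun n s => rhoAt χ ε n * YCoeff γ n * mFourier n (x + line j s))
    (g' := fun n s => rhoAt χ ε n * YCoeff γ n * (Complex.I * n j) * mFourier n (x + line j s))
    (y₀ := 0) hu (fun n s => ?_) (fun n s => ?_)
    (summable_mul_mFourier hu (fun n => (hb n).1) _) s
  · exact this
  · exact ((hasDerivAt_mFourier_line n j x s).const_mul (rhoAt χ ε n * YCoeff γ n)).congr_deriv
      (by ring)
  · rw [norm_mul, norm_mFourier_apply, mul_one]; exact (hb n).2 j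

/-- The supremum of a mollified random trigonometric series, in terms of its dyadic blocks. -/
lemma norm_sq_sum_box_le (hγ : ∀ n, n ≠ 0 → conj (γ n) = γ (-n)) (hχ : IsMollifier χ)
    {c : (Fin 2 → ℤ) → ℂ} (hc : c 0 = 0) {B : ℝ} (hB : 0 ≤ B)
    (hcB : ∑' k : ℕ, ENNReal.ofReal (dyadicBase ^ (4 * k) * blockSq c k γ) ≤ ENNReal.ofReal B)
    (ε : ℝ) (K : ℕ) (x : T2) :
    ‖∑ n ∈ box (2 ^ K), rhoAt χ ε n * (γ n * c n) * mFourier n x‖ ^ 2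
      ≤ (∫ y, ‖χ y‖) ^ 2 * (∑' k : ℕ, (dyadicBase⁻¹) ^ k) * B := by
  have hq0 := dyadicBase_pos
  have hI : 0 ≤ ∫ y, ‖χ y‖ := integral_nonneg fun _ => norm_nonneg _
  have h1 : ‖∑ n ∈ box (2 ^ K), rhoAt χ ε n * (γ n * c n) * mFourier n x‖
      ≤ (∫ y, ‖χ y‖) * ∑ k ∈ Finset.range K, Real.sqrt (blockSq c k γ) := by
    rw [sum_box_two_pow, hc, mul_zero, mul_zero, zero_mul, zero_add, Finset.mul_sum]
    refine (norm_sum_le _ _).trans (Finset.sum_le_sum fun k _ => ?_)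
    exact hχ.norm_sum_rhoAt_le ε (block k) (fun n => γ n * c n)
      (fun x => Real.le_sqrt_of_sq_le (norm_sq_block_le hγ c k x)) x
  have h2 : (∑ k ∈ Finset.range K, Real.sqrt (blockSq c k γ)) ^ 2
      ≤ (∑ k ∈ Finset.range K, (dyadicBase ^ (4 * k))⁻¹) *
        ∑ k ∈ Finset.range K, dyadicBase ^ (4 * k) * blockSq c k γ := by
    refine Finset.sum_sq_le_sum_mul_sum_of_sq_le_mul _ (fun k _ => by positivity)
      (fun k _ => mul_nonneg (by positivity) (blockSq_nonneg c k γ)) fun k _ => ?_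
    rw [Real.sq_sqrt (blockSq_nonneg c k γ)]
    refine le_of_eq ?_
    field_simp
  have h3 : ∑ k ∈ Finset.range K, (dyadicBase ^ (4 * k))⁻¹ ≤ ∑' k : ℕ, (dyadicBase⁻¹) ^ k := by
    refine (Finset.sum_le_sum fun k _ => ?_).trans
      (summable_dyadicBase_inv.sum_le_tsum (Finset.range K) fun _ _ => by positivity)
    rw [inv_pow]
    gcongr
    · exact one_lt_dyadicBase.le
    · omega
  have h4 : ∑ k ∈ Finset.range K, dyadicBase ^ (4 * k) * blockSq c k γ ≤ B := by
    rw [← ENNReal.ofReal_le_ofReal_iff hB, ENNReal.ofReal_sum_of_nonneg fun k _ =>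
      mul_nonneg (by positivity) (blockSq_nonneg c k γ)]
    exact (ENNReal.sum_le_tsum _).trans hcB
  calc _ ≤ ((∫ y, ‖χ y‖) * ∑ k ∈ Finset.range K, Real.sqrt (blockSq c k γ)) ^ 2 := by gcongr
    _ = (∫ y, ‖χ y‖) ^ 2 * (∑ k ∈ Finset.range K, Real.sqrt (blockSq c k γ)) ^ 2 := by ring
    _ ≤ (∫ y, ‖χ y‖) ^ 2 * ((∑' k : ℕ, (dyadicBase⁻¹) ^ k) * B) := by
        refine mul_le_mul_of_nonneg_left (h2.trans ?_) (by positivity)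
        refine mul_le_mul h3 h4 (Finset.sum_nonneg fun k _ =>
          mul_nonneg (by positivity) (blockSq_nonneg c k γ)) (tsum_nonneg fun k => by positivity)
    _ = _ := by ring

lemma tendsto_sum_box {c : (Fin 2 → ℤ) → ℂ} (hc : Summable c) :
    Tendsto (fun N => ∑ n ∈ box N, c n) atTop (𝓝 (∑' n, c n)) :=
  hc.hasSum.comp tendsto_box

lemma tendsto_two_pow : Tendsto (fun K : ℕ => 2 ^ K) atTop (atTop : Filter ℕ) :=
  tendsto_pow_atTop_atTop_of_one_lt (by norm_num)

lemma GoodRealisation.norm_sq_Yeps_le (h : GoodRealisation hχ γ) {B : ℝ} (hB : 0 ≤ B)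
    (hcB : ∑' k : ℕ, ENNReal.ofReal (dyadicBase ^ (4 * k) * blockSq invLaplace k γ)
      ≤ ENNReal.ofReal B) {ε : ℝ} (hε : 0 < ε) (x : T2) :
    ‖Yeps χ ε γ x‖ ^ 2 ≤ (∫ y, ‖χ y‖) ^ 2 * (∑' k : ℕ, (dyadicBase⁻¹) ^ k) * B := by
  obtain ⟨u, hu, hb⟩ := h.exists_summable_bound hε
  have h1 := (tendsto_sum_box (summable_mul_mFourier hu (fun n => (hb n).1) x)).comp tendsto_two_pow
  refine le_of_tendsto ((h1.norm).pow 2) (Eventually.of_forall fun K => ?_)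
  have h2 := norm_sq_sum_box_le h.conj_symm hχ (c := invLaplace) (by simp [invLaplace]) hB hcB ε K x
  simpa only [Function.comp, YCoeff_eq] using h2

lemma GoodRealisation.norm_sq_Yeps_sub_le (h : GoodRealisation hχ γ) {B : ℝ} (hB : 0 ≤ B) {l : ℕ}
    {j : Fin 2} (hcB : ∑' k : ℕ, ENNReal.ofReal (dyadicBase ^ (4 * k) * blockSq (incCoeff l j) k γ)
      ≤ ENNReal.ofReal B) {ε : ℝ} (hε : 0 < ε) (x : T2) :
    ‖Yeps χ ε γ (x + dyadicShift l j) - Yeps χ ε γ x‖ ^ 2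
      ≤ (∫ y, ‖χ y‖) ^ 2 * (∑' k : ℕ, (dyadicBase⁻¹) ^ k) * B := by
  obtain ⟨u, hu, hb⟩ := h.exists_summable_bound hε
  have h1 := (tendsto_sum_box (summable_mul_mFourier hu (fun n => (hb n).1) x)).comp tendsto_two_pow
  have h1' := (tendsto_sum_box (summable_mul_mFourier hu (fun n => (hb n).1)
    (x + dyadicShift l j))).comp tendsto_two_pow
  refine le_of_tendsto (((h1'.sub h1).norm).pow 2) (Eventually.of_forall fun K => ?_)
  have h2 := norm_sq_sum_box_le h.conj_symm hχ (c := incCoeff l j)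
    (by simp [incCoeff, invLaplace]) hB hcB ε K x
  refine le_trans (le_of_eq ?_) h2
  simp only [Function.comp]
  rw [← Finset.sum_sub_distrib]
  congr 2
  refine Finset.sum_congr rfl fun n _ => ?_
  rw [YCoeff_eq, incCoeff, mFourier_apply_add]
  ring

/-- Fourier coefficients of the square of a trigonometric polynomial. -/
lemma mFourierCoeff_sq_sum (S : Finset (Fin 2 → ℤ)) (c : (Fin 2 → ℤ) → ℂ) (n : Fin 2 → ℤ) :
    mFourierCoeff (fun x : T2 => (∑ a ∈ S, c a * mFourier a x) ^ 2) n
      = ∑ a ∈ S with n - a ∈ S, c a * c (n - a) := by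
  have e : ∀ x : T2, mFourier (-n) x • (∑ a ∈ S, c a * mFourier a x) ^ 2
      = ∑ a ∈ S, ∑ b ∈ S, c a * c b * mFourier (-n + (a + b)) x := by
    intro x
    rw [sq, Finset.sum_mul_sum, smul_eq_mul, Finset.mul_sum]
    refine Finset.sum_congr rfl fun a _ => ?_
    rw [Finset.mul_sum]
    refine Finset.sum_congr rfl fun b _ => ?_
    rw [mFourier_add, mFourier_add]
    ring
  have hi : ∀ m, Integrable fun x : T2 => mFourier m x := fun m =>
    (mFourier m).continuous.integrable_of_hasCompactSupport (HasCompactSupport.of_compactSpace _)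
  rw [mFourierCoeff]
  simp only [e]
  rw [integral_finsetSum _ fun a _ => integrable_finsetSum _ fun b _ => (hi _).const_mul _,
    Finset.sum_filter]
  refine Finset.sum_congr rfl fun a _ => ?_
  rw [integral_finsetSum _ fun b _ => (hi _).const_mul _]
  simp only [integral_const_mul, integral_mFourier]
  have : ∀ b, -n + (a + b) = 0 ↔ b = n - a := fun b => by
    constructor
    · intro h; rw [eq_sub_iff_add_eq, add_comm, ← sub_eq_zero, ← h]; abel
    · rintro rfl; abel
  simp only [this, mul_ite, mul_one, mul_zero, Finset.sum_ite_eq']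

/-- The frequencies `a = 0` and `a = n` do not contribute, since `Y` has mean zero. -/
lemma wickCoeff_eq (N : ℕ) (n : Fin 2 → ℤ) (ε : ℝ) :
    ∑ j, ∑ a ∈ box N with n - a ∈ box N, rhoAt χ ε a * YCoeff γ a * (Complex.I * a j) *
      (rhoAt χ ε (n - a) * YCoeff γ (n - a) * (Complex.I * (n - a) j)) = wickCoeff χ N n ε γ := by
  rw [Finset.sum_comm, wickCoeff]
  symm
  refine Finset.sum_subset_zero_on_sdiff (fun a ha => ?_) (fun a ha => ?_) (fun a ha => ?_)
  · rw [pairSet, Finset.mem_filter] at ha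
    exact Finset.mem_filter.2 ⟨ha.1, ha.2.2.2⟩
  · rw [Finset.mem_sdiff, Finset.mem_filter, pairSet, Finset.mem_filter] at ha
    have h : a = 0 ∨ a = n := by
      by_contra! h'
      exact ha.2 ⟨ha.1.1, h'.1, h'.2, ha.1.2⟩
    rcases h with rfl | rfl <;> simp [YCoeff]
  · obtain ⟨h0, h1⟩ := ne_of_mem_pairSet ha
    have h2 : n - a ≠ 0 := sub_ne_zero.2 h1.symm
    rw [YCoeff, YCoeff, if_neg h0, if_neg h2, gradCoeff, Fin.sum_univ_two, Fin.sum_univ_two]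
    have n1 : (normSq a : ℂ) ≠ 0 := by exact_mod_cast (normSq_pos h0).ne'
    have n2 : (normSq (n - a) : ℂ) ≠ 0 := by exact_mod_cast (normSq_pos h2).ne'
    field_simp
    linear_combination -(rhoAt χ ε a * γ a * rhoAt χ ε (n - a) * γ (n - a) *
      ((a 0 : ℂ) * ((n - a) 0 : ℤ) + a 1 * ((n - a) 1 : ℤ))) * Complex.I_sq

/-- The Fourier coefficients of `|∇Y_ε|²` are the limits of those of its truncations. -/
lemma GoodRealisation.tendsto_wickCoeff (h : GoodRealisation hχ γ) {ε : ℝ} (hε : 0 < ε)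
    (n : Fin 2 → ℤ) :
    Tendsto (fun N => wickCoeff χ N n ε γ) atTop
      (𝓝 (mFourierCoeff (fun x : T2 => ∑ j, partialYeps χ ε γ j x ^ 2) n)) := by
  obtain ⟨u, hu, hb⟩ := h.exists_summable_bound hε
  have hu0 : ∀ n, 0 ≤ u n := fun n => (norm_nonneg _).trans (hb n).1
  have hi : ∀ (j : Fin 2) (S : Finset (Fin 2 → ℤ)) (x : T2),
      ‖∑ a ∈ S, rhoAt χ ε a * YCoeff γ a * (Complex.I * a j) * mFourier a x‖ ≤ ∑' a, u a := by
    intro j S x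
    refine (norm_sum_le _ _).trans (le_trans ?_ (hu.sum_le_tsum S fun a _ => hu0 a))
    refine Finset.sum_le_sum fun a _ => ?_
    rw [norm_mul, norm_mFourier_apply, mul_one]
    exact (hb a).2 j
  have hcS : ∀ (j : Fin 2) (S : Finset (Fin 2 → ℤ)), Continuous fun x : T2 =>
      ∑ a ∈ S, rhoAt χ ε a * YCoeff γ a * (Complex.I * a j) * mFourier a x := fun j S =>
    continuous_finsetSum _ fun a _ => by fun_prop
  have e1 : ∀ N, wickCoeff χ N n ε γ = mFourierCoeff (fun x : T2 => ∑ j, (∑ a ∈ box N,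
      rhoAt χ ε a * YCoeff γ a * (Complex.I * a j) * mFourier a x) ^ 2) n := by
    intro N
    rw [← wickCoeff_eq]
    have : ∀ j : Fin 2, Integrable fun x : T2 => mFourier (-n) x • (∑ a ∈ box N,
        rhoAt χ ε a * YCoeff γ a * (Complex.I * a j) * mFourier a x) ^ 2 := fun j => by
      have := hcS j (box N)
      exact Continuous.integrable_of_hasCompactSupport (by fun_prop)
        (HasCompactSupport.of_compactSpace _)
    simp only [mFourierCoeff, Finset.smul_sum]
    rw [integral_finsetSum _ fun j _ => this j]
    refine Finset.sum_congr rfl fun j _ => ?_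
    exact (mFourierCoeff_sq_sum (box N)
      (fun a => rhoAt χ ε a * YCoeff γ a * (Complex.I * a j)) n).symm
  simp only [e1, mFourierCoeff]
  refine tendsto_integral_of_dominated_convergence (fun _ => ∑ _j : Fin 2, (∑' a, u a) ^ 2)
    (fun N => ?_) (integrable_const _) (fun N => ae_of_all _ fun x => ?_) (ae_of_all _ fun x => ?_)
  · have := fun j => hcS j (box N)
    exact Continuous.aestronglyMeasurable (by fun_prop)
  · rw [norm_smul, norm_mFourier_apply, one_mul]
    refine (norm_sum_le _ _).trans (Finset.sum_le_sum fun j _ => ?_)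
    rw [norm_pow]
    exact pow_le_pow_left₀ (norm_nonneg _) (hi j _ x) 2
  · refine Tendsto.const_smul (tendsto_finsetSum _ fun j _ => ?_) _
    exact (tendsto_sum_box (summable_mul_mFourier hu (fun a => (hb a).2 j) x)).pow 2

lemma GoodRealisation.enorm_sq_coeff_le (h : GoodRealisation hχ γ) {ε : ℝ}
    (hε : ε ∈ Set.Ioo (0 : ℝ) 1) (n : Fin 2 → ℤ) :
    ‖mFourierCoeff (fun x : T2 => ∑ j, partialYeps χ ε γ j x ^ 2) n‖ₑ ^ 2
      ≤ liminf (fun N => hχ.wickBound N n γ ^ 2) atTop := by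
  have h1 := (ENNReal.continuous_pow 2).continuousAt.tendsto.comp
    ((h.tendsto_wickCoeff hε.1 n).enorm)
  rw [← h1.liminf_eq]
  refine liminf_le_liminf (Eventually.of_forall fun N => ?_)
  exact pow_le_pow_left' (hχ.enorm_wickCoeff_le N n γ hε) 2

/-- The data of a real `C¹` field on the torus: a continuous function and its continuous partial
derivatives. -/
structure IsGradient (y : C(T2, ℝ)) (dy : Fin 2 → C(T2, ℝ)) : Prop where
  hasDerivAt : ∀ j x, HasDerivAt (fun s => y (x + line j s)) (dy j x) 0

/-- Bounds for a field `y` and for its gradient: `K` bounds `|y|`, `D l j` bounds the increment of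
`y` under a dyadic translation, and `B` bounds the square of the `H^{-1/4}` norm of the nonconstant
part of `|∇y|²`. -/
structure FieldBounds (K : ℝ) (D : ℕ → Fin 2 → ℝ) (B : ℝ) (y : C(T2, ℝ))
    (dy : Fin 2 → C(T2, ℝ)) : Prop where
  abs_le : ∀ x, |y x| ≤ K
  increment : ∀ l j x, |y (x + dyadicShift l j) - y x| ≤ D l j
  wick : ∀ S : Finset (Fin 2 → ℤ), 0 ∉ S → ∑ n ∈ S, ‖n‖ ^ (-(1 / 2) : ℝ) *
    ‖mFourierCoeff (fun x : T2 => ((∑ j, dy j x ^ 2 : ℝ) : ℂ)) n‖ ^ 2 ≤ B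

/-- The fields `Y_ε` of a good realisation satisfy bounds that do not depend on `ε`. -/
theorem GoodRealisation.exists_fields (h : GoodRealisation hχ γ) :
    ∃ (K : ℝ) (D : ℕ → Fin 2 → ℝ) (B : ℝ),
      (∀ j, Summable fun l => dyadicBase ^ (8 * l) * D l j ^ 2) ∧
      ∀ ε ∈ Set.Ioo (0 : ℝ) 1, ∃ (y : C(T2, ℝ)) (dy : Fin 2 → C(T2, ℝ)),
        (∀ x, Yeps χ ε γ x = y x) ∧ (∀ j x, partialYeps χ ε γ j x = dy j x) ∧
        IsGradient y dy ∧ FieldBounds K D B y dy := by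
  have hq0 := dyadicBase_pos
  set I := (∫ y, ‖χ y‖) ^ 2 * (∑' k : ℕ, (dyadicBase⁻¹) ^ k) with hI
  have hI0 : 0 ≤ I := mul_nonneg (by positivity) (tsum_nonneg fun k => by positivity)
  set B1 := (∑' k : ℕ, ENNReal.ofReal (dyadicBase ^ (4 * k) * blockSq invLaplace k γ)).toReal
  have hB1 : ∑' k : ℕ, ENNReal.ofReal (dyadicBase ^ (4 * k) * blockSq invLaplace k γ)
      ≤ ENNReal.ofReal B1 := (ENNReal.ofReal_toReal h.sup.ne).ge
  let T : ℕ → Fin 2 → ℝ≥0∞ := fun l j =>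
    ∑' k : ℕ, ENNReal.ofReal (dyadicBase ^ (4 * k) * blockSq (incCoeff l j) k γ)
  have hT : ∀ j, ∑' l, ENNReal.ofReal (dyadicBase ^ (8 * l)) * T l j < ∞ := by
    intro j
    refine lt_of_le_of_lt (le_of_eq ?_) (h.increment j)
    refine tsum_congr fun l => ?_
    rw [← ENNReal.tsum_mul_left]
    refine tsum_congr fun k => ?_
    rw [← ENNReal.ofReal_mul (by positivity), ← mul_assoc, ← pow_add]
  have hTl : ∀ l j, T l j ≠ ∞ := by
    intro l j hh
    have := ENNReal.ne_top_of_tsum_ne_top (hT j).ne l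
    rw [hh, ENNReal.mul_top (by simp; positivity)] at this
    exact this rfl
  let B3 : ℝ := (∑' n : Fin 2 → ℤ, (if n = 0 then 0 else ENNReal.ofReal (‖n‖ ^ (-(1 / 2) : ℝ)) *
    liminf (fun N => hχ.wickBound N n γ ^ 2) atTop)).toReal
  refine ⟨Real.sqrt (I * B1), fun l j => Real.sqrt (I * (T l j).toReal), B3,
    fun j => ?_, fun ε hε => ?_⟩
  · have hs := ENNReal.summable_toReal (hT j).ne
    refine (hs.mul_left I).congr fun l => ?_
    rw [Real.sq_sqrt (mul_nonneg hI0 ENNReal.toReal_nonneg), ENNReal.toReal_mul,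
      ENNReal.toReal_ofReal (by positivity)]
    ring
  · obtain ⟨u, hu, hb⟩ := h.exists_summable_bound hε.1
    have hc1 : Continuous (Yeps χ ε γ) := continuous_tsum_mFourier hu fun n => (hb n).1
    have hc2 : ∀ j, Continuous (partialYeps χ ε γ j) := fun j =>
      continuous_tsum_mFourier hu fun n => (hb n).2 j
    have hr1 : ∀ x, ((Yeps χ ε γ x).re : ℂ) = Yeps χ ε γ x := fun x =>
      Complex.conj_eq_iff_re.1 (h.conj_Yeps ε x)
    have hr2 : ∀ j x, ((partialYeps χ ε γ j x).re : ℂ) = partialYeps χ ε γ j x := fun j x =>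
      Complex.conj_eq_iff_re.1 (h.conj_partialYeps ε j x)
    refine ⟨⟨fun x => (Yeps χ ε γ x).re, by fun_prop⟩,
      fun j => ⟨fun x => (partialYeps χ ε γ j x).re, by have := hc2 j; fun_prop⟩,
      fun x => (hr1 x).symm, fun j x => (hr2 j x).symm, ⟨fun j x => ?_⟩,
      ⟨fun x => ?_, fun l j x => ?_, fun S hS => ?_⟩⟩
    · have h1 := h.hasDerivAt_Yeps hε.1 j x 0
      have h2 : line j 0 = 0 := by ext i; simp [line]
      rw [h2, add_zero] at h1
      exact Complex.reCLM.hasFDerivAt.comp_hasDerivAt (0 : ℝ) h1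
    · refine Real.le_sqrt_of_sq_le ?_
      have h1 := h.norm_sq_Yeps_le ENNReal.toReal_nonneg hB1 hε.1 x
      rw [← hr1, Complex.norm_real, Real.norm_eq_abs] at h1
      exact h1
    · refine Real.le_sqrt_of_sq_le ?_
      have h1 := h.norm_sq_Yeps_sub_le ENNReal.toReal_nonneg
        (ENNReal.ofReal_toReal (hTl l j)).ge hε.1 x
      rw [← hr1, ← hr1 x, ← Complex.ofReal_sub, Complex.norm_real, Real.norm_eq_abs] at h1
      exact h1
    · have e : (fun x : T2 => ((∑ j, ((partialYeps χ ε γ j x).re) ^ 2 : ℝ) : ℂ))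
          = fun x => ∑ j, partialYeps χ ε γ j x ^ 2 := by
        ext x; push_cast; simp only [hr2]
      simp only [ContinuousMap.coe_mk]
      rw [e, ← ENNReal.ofReal_le_ofReal_iff ENNReal.toReal_nonneg,
        ENNReal.ofReal_toReal h.wick.ne, ENNReal.ofReal_sum_of_nonneg fun n _ => by positivity]
      refine le_trans (Finset.sum_le_sum fun n hn => ?_) (ENNReal.sum_le_tsum S)
      have hn0 : n ≠ 0 := fun h0 => hS (h0 ▸ hn)
      rw [if_neg hn0, ENNReal.ofReal_mul (by positivity), ENNReal.ofReal_pow (norm_nonneg _),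
        ofReal_norm]
      exact mul_le_mul_right (h.enorm_sq_coeff_le hε n) _

end Fields

/-! ### Square-integrable functions through their Fourier coefficients -/

open scoped InnerProductSpace

lemma coeff_eq_repr (f : L2) (n : Fin 2 → ℤ) : mFourierCoeff f n = mFourierBasis.repr f n :=
  (mFourierBasis_repr f n).symm

lemma coeff_add (f g : L2) (n : Fin 2 → ℤ) :
    mFourierCoeff (f + g : L2) n = mFourierCoeff f n + mFourierCoeff g n := by
  simp only [coeff_eq_repr, map_add]; rfl

lemma coeff_sub (f g : L2) (n : Fin 2 → ℤ) :
    mFourierCoeff (f - g : L2) n = mFourierCoeff f n - mFourierCoeff g n := by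
  simp only [coeff_eq_repr, map_sub]; rfl

lemma L2_ext {f g : L2} (h : ∀ n, mFourierCoeff f n = mFourierCoeff g n) : f = g := by
  apply mFourierBasis.repr.injective
  ext n
  rw [← coeff_eq_repr, ← coeff_eq_repr, h]

lemma hasSum_norm_sq_coeff (f : L2) : HasSum (fun n => ‖mFourierCoeff f n‖ ^ 2) (‖f‖ ^ 2) := by
  have h := hasSum_sq_mFourierCoeff f
  have e : ‖f‖ ^ 2 = ∫ t, ‖f t‖ ^ 2 := by
    rw [← inner_self_eq_norm_sq (𝕜 := ℂ), L2.inner_def, ← integral_re (L2.integrable_inner f f)]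
    simp only [inner_self_eq_norm_sq]
  rwa [e]

/-- If the multiplied coefficients are square summable, the series that defines the multiplier
converges, so that it has the expected Fourier coefficients. -/
lemma hasSum_fourierMultiplier {m : (Fin 2 → ℤ) → ℂ} {f : L2}
    (h : Summable fun n => ‖m n * mFourierCoeff f n‖ ^ 2) :
    HasSum (fun n => (m n * mFourierCoeff f n) • mFourierLp 2 n) (fourierMultiplier m f) ∧
      ∀ n, mFourierCoeff (fourierMultiplier m f) n = m n * mFourierCoeff f n := by
  have hmem : Memℓp (fun n => m n * mFourierCoeff f n) 2 := by
    rw [memℓp_gen_iff (by norm_num)]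
    simpa using h
  let w : lp (fun _ : Fin 2 → ℤ => ℂ) 2 := ⟨_, hmem⟩
  have h1 := mFourierBasis.hasSum_repr_symm w
  rw [coe_mFourierBasis] at h1
  have h2 : fourierMultiplier m f = mFourierBasis.repr.symm w := h1.tsum_eq
  refine ⟨by rw [h2]; exact h1, fun n => ?_⟩
  rw [h2, coeff_eq_repr, LinearIsometryEquiv.apply_symm_apply]

/-- The square of the `H^s` norm, as a real number. -/
def sob (s : ℝ) (f : L2) : ℝ := ∑' n : Fin 2 → ℤ, (1 + normSq n) ^ s * ‖mFourierCoeff f n‖ ^ 2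

lemma one_add_normSq_pos (n : Fin 2 → ℤ) : 0 < 1 + normSq n := by linarith [normSq_nonneg n]

lemma one_le_one_add_normSq (n : Fin 2 → ℤ) : 1 ≤ 1 + normSq n := by linarith [normSq_nonneg n]

lemma sob_term_nonneg (s : ℝ) (f : L2) (n : Fin 2 → ℤ) :
    0 ≤ (1 + normSq n) ^ s * ‖mFourierCoeff f n‖ ^ 2 :=
  mul_nonneg (Real.rpow_nonneg (one_add_normSq_pos n).le _) (by positivity)

lemma sob_nonneg (s : ℝ) (f : L2) : 0 ≤ sob s f := tsum_nonneg fun n => sob_term_nonneg s f n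

lemma summable_sob {s : ℝ} {f : L2} (h : sobolevNorm s f < ∞) :
    Summable fun n : Fin 2 → ℤ => (1 + normSq n) ^ s * ‖mFourierCoeff f n‖ ^ 2 := by
  unfold sobolevNorm at h
  have h1 : ∑' n : Fin 2 → ℤ,
      ENNReal.ofReal ((1 + normSq n) ^ s * ‖mFourierCoeff f n‖ ^ 2) ≠ ∞ := by
    intro h2
    rw [h2, ENNReal.top_rpow_of_pos (by norm_num)] at h
    exact lt_irrefl _ h
  refine (ENNReal.summable_toReal h1).congr fun n => ?_
  rw [ENNReal.toReal_ofReal (sob_term_nonneg s f n)]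

lemma sobolevNorm_eq {s : ℝ} {f : L2}
    (h : Summable fun n : Fin 2 → ℤ => (1 + normSq n) ^ s * ‖mFourierCoeff f n‖ ^ 2) :
    sobolevNorm s f = ENNReal.ofReal (Real.sqrt (sob s f)) := by
  rw [sobolevNorm, ← ENNReal.ofReal_tsum_of_nonneg (sob_term_nonneg s f) h, ← sob,
    ENNReal.ofReal_rpow_of_nonneg (sob_nonneg s f) (by norm_num), ← Real.sqrt_eq_rpow]

lemma summable_sob_mono {s t : ℝ} (hst : s ≤ t) {f : L2}
    (h : Summable fun n : Fin 2 → ℤ => (1 + normSq n) ^ t * ‖mFourierCoeff f n‖ ^ 2) :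
    Summable fun n : Fin 2 → ℤ => (1 + normSq n) ^ s * ‖mFourierCoeff f n‖ ^ 2 :=
  Summable.of_nonneg_of_le (sob_term_nonneg s f) (fun n => mul_le_mul_of_nonneg_right
    (Real.rpow_le_rpow_of_exponent_le (one_le_one_add_normSq n) hst) (by positivity)) h

lemma sob_mono {s t : ℝ} (hst : s ≤ t) {f : L2}
    (h : Summable fun n : Fin 2 → ℤ => (1 + normSq n) ^ t * ‖mFourierCoeff f n‖ ^ 2) :
    sob s f ≤ sob t f :=
  (summable_sob_mono hst h).tsum_le_tsum (fun n => mul_le_mul_of_nonneg_right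
    (Real.rpow_le_rpow_of_exponent_le (one_le_one_add_normSq n) hst) (by positivity)) h

lemma sob_zero (f : L2) : sob 0 f = ‖f‖ ^ 2 := by
  rw [← (hasSum_norm_sq_coeff f).tsum_eq, sob]; simp

/-- `f` belongs to `H^s`, in terms of Fourier coefficients. -/
def InSob (s : ℝ) (f : L2) : Prop :=
  Summable fun n : Fin 2 → ℤ => (1 + normSq n) ^ s * ‖mFourierCoeff f n‖ ^ 2

lemma InSob.sub {s : ℝ} {f g : L2} (hf : InSob s f) (hg : InSob s g) : InSob s (f - g) := by
  refine Summable.of_nonneg_of_le (sob_term_nonneg s _) (fun n => ?_)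
    ((hf.mul_left 2).add (hg.mul_left 2))
  rw [coeff_sub]
  have h1 : ‖mFourierCoeff f n - mFourierCoeff g n‖ ^ 2
      ≤ 2 * ‖mFourierCoeff f n‖ ^ 2 + 2 * ‖mFourierCoeff g n‖ ^ 2 := by
    have := norm_sub_le (mFourierCoeff f n) (mFourierCoeff g n)
    nlinarith [norm_nonneg (mFourierCoeff f n - mFourierCoeff g n),
      sq_nonneg (‖mFourierCoeff f n‖ - ‖mFourierCoeff g n‖)]
  have h2 : (0 : ℝ) ≤ (1 + normSq n) ^ s := Real.rpow_nonneg (one_add_normSq_pos n).le _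
  nlinarith [mul_le_mul_of_nonneg_left h1 h2]

lemma InSob.mono {s t : ℝ} (hst : s ≤ t) {f : L2} (h : InSob t f) : InSob s f :=
  summable_sob_mono hst h

lemma sq_coord_le_normSq (n : Fin 2 → ℤ) (j : Fin 2) : (n j : ℝ) ^ 2 ≤ normSq n :=
  Finset.single_le_sum (f := fun j => (n j : ℝ) ^ 2) (fun _ _ => by positivity) (Finset.mem_univ j)

lemma norm_I_mul_coord_sq (n : Fin 2 → ℤ) (j : Fin 2) (z : ℂ) :
    ‖Complex.I * (n j : ℂ) * z‖ ^ 2 = (n j : ℝ) ^ 2 * ‖z‖ ^ 2 := by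
  rw [norm_mul, norm_mul, Complex.norm_I, one_mul, mul_pow, Complex.norm_intCast, sq_abs]

lemma coeff_partialDeriv {f : L2} (hf : InSob 1 f) (j : Fin 2) :
    HasSum (fun n => (Complex.I * (n j : ℂ) * mFourierCoeff f n) • mFourierLp 2 n)
      (partialDeriv j f) ∧
      ∀ n, mFourierCoeff (partialDeriv j f) n = Complex.I * (n j : ℂ) * mFourierCoeff f n := by
  refine hasSum_fourierMultiplier
    (Summable.of_nonneg_of_le (fun _ => by positivity) (fun n => ?_) hf)
  rw [norm_I_mul_coord_sq, Real.rpow_one]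
  have := sq_coord_le_normSq n j
  gcongr
  linarith

lemma coeff_laplacian {f : L2} (hf : InSob 2 f) (n : Fin 2 → ℤ) :
    mFourierCoeff (laplacian f) n = -(normSq n : ℂ) * mFourierCoeff f n := by
  refine (hasSum_fourierMultiplier (m := fun n => -(normSq n : ℂ))
    (Summable.of_nonneg_of_le (fun _ => by positivity) (fun n => ?_) hf)).2 n
  rw [norm_mul, norm_neg, Complex.norm_real, Real.norm_of_nonneg (normSq_nonneg n), mul_pow]
  have h0 := normSq_nonneg n
  gcongr
  rw [Real.rpow_two]
  gcongr
  linarith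

lemma InSob.partialDeriv {s : ℝ} {f : L2} (hs : 0 ≤ s) (hf : InSob (s + 1) f) (j : Fin 2) :
    InSob s (partialDeriv j f) := by
  refine Summable.of_nonneg_of_le (sob_term_nonneg s _) (fun n => ?_) hf
  rw [(coeff_partialDeriv (hf.mono (by linarith)) j).2, norm_I_mul_coord_sq,
    Real.rpow_add (one_add_normSq_pos n), Real.rpow_one, ← mul_assoc]
  have := sq_coord_le_normSq n j
  have := Real.rpow_nonneg (one_add_normSq_pos n).le s
  gcongr
  linarith

lemma laplacian_eq {f : L2} (hf : InSob 2 f) :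
    laplacian f = ∑ j, partialDeriv j (partialDeriv j f) := by
  have h1 : InSob 1 f := hf.mono (by norm_num)
  have h2 : ∀ j, InSob 1 (partialDeriv j f) := fun j =>
    InSob.partialDeriv (by norm_num) (by norm_num; exact hf) j
  apply L2_ext
  intro n
  rw [coeff_laplacian hf, Fin.sum_univ_two, coeff_add, (coeff_partialDeriv (h2 0) 0).2,
    (coeff_partialDeriv (h2 1) 1).2, (coeff_partialDeriv h1 0).2, (coeff_partialDeriv h1 1).2,
    normSq, Fin.sum_univ_two]
  push_cast
  linear_combination (-(n 0 : ℂ) ^ 2 - (n 1 : ℂ) ^ 2) * mFourierCoeff f n * Complex.I_sq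

lemma partialDeriv_sub {f g : L2} (hf : InSob 1 f) (hg : InSob 1 g) (j : Fin 2) :
    partialDeriv j (f - g) = partialDeriv j f - partialDeriv j g := by
  apply L2_ext
  intro n
  rw [coeff_sub, (coeff_partialDeriv (hf.sub hg) j).2, (coeff_partialDeriv hf j).2,
    (coeff_partialDeriv hg j).2, coeff_sub]
  ring

lemma laplacian_sub {f g : L2} (hf : InSob 2 f) (hg : InSob 2 g) :
    laplacian (f - g) = laplacian f - laplacian g := by
  apply L2_ext
  intro n
  rw [coeff_sub, coeff_laplacian (hf.sub hg), coeff_laplacian hf, coeff_laplacian hg, coeff_sub]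
  ring

lemma norm_sq_partialDeriv_le {f : L2} (hf : InSob 1 f) (j : Fin 2) :
    ‖partialDeriv j f‖ ^ 2 ≤ sob 1 f := by
  rw [← (hasSum_norm_sq_coeff _).tsum_eq]
  refine (hasSum_norm_sq_coeff _).summable.tsum_le_tsum (fun n => ?_) hf
  rw [(coeff_partialDeriv hf j).2, norm_I_mul_coord_sq, Real.rpow_one]
  have := sq_coord_le_normSq n j
  gcongr
  linarith

lemma sob_one_eq {f : L2} (hf : InSob 1 f) :
    sob 1 f = ‖f‖ ^ 2 + ∑ j, ‖partialDeriv j f‖ ^ 2 := by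
  have h := (hasSum_norm_sq_coeff f).add (hasSum_sum fun j (_ : j ∈ Finset.univ) =>
    hasSum_norm_sq_coeff (partialDeriv j f))
  rw [← h.tsum_eq, sob]
  refine tsum_congr fun n => ?_
  simp only [(coeff_partialDeriv hf _).2, norm_I_mul_coord_sq, Real.rpow_one, normSq,
    ← Finset.sum_mul]
  ring

lemma norm_sq_laplacian_le {f : L2} (hf : InSob 2 f) : ‖laplacian f‖ ^ 2 ≤ sob 2 f := by
  rw [← (hasSum_norm_sq_coeff _).tsum_eq]
  refine (hasSum_norm_sq_coeff _).summable.tsum_le_tsum (fun n => ?_) hf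
  rw [coeff_laplacian hf, norm_mul, norm_neg, Complex.norm_real,
    Real.norm_of_nonneg (normSq_nonneg n), mul_pow, Real.rpow_two]
  have h0 := normSq_nonneg n
  gcongr
  linarith

/-! ### The continuous representative of a function in `H²` -/

lemma summable_japanese {s : ℝ} (hs : 1 < s) :
    Summable fun n : Fin 2 → ℤ => (1 + normSq n) ^ (-s) := by
  have h1 := summable_norm_rpow (s := 2 * s) (by linarith)
  refine Summable.of_norm_bounded_eventually h1 ?_
  refine (Set.finite_singleton (0 : Fin 2 → ℤ)).subset fun n hn => ?_
  by_contra h0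
  apply hn
  have hn1 := one_le_norm h0
  change ‖(1 + normSq n) ^ (-s)‖ ≤ ‖n‖ ^ (-(2 * s))
  rw [Real.norm_of_nonneg (Real.rpow_nonneg (one_add_normSq_pos n).le _)]
  have e : ‖n‖ ^ (-(2 * s)) = (‖n‖ ^ 2) ^ (-s) := by
    rw [← Real.rpow_natCast, ← Real.rpow_mul (norm_nonneg _)]; congr 1; push_cast; ring
  rw [e]
  exact Real.rpow_le_rpow_of_nonpos (by positivity)
    (by linarith [norm_sq_le_normSq n]) (by linarith)

/-- The sum `∑ₙ (1 + |n|²)⁻²`. -/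
def japaneseSum : ℝ := ∑' n : Fin 2 → ℤ, (1 + normSq n) ^ (-2 : ℝ)

lemma japaneseSum_nonneg : 0 ≤ japaneseSum :=
  tsum_nonneg fun n => Real.rpow_nonneg (one_add_normSq_pos n).le _

lemma InSob.summable_coeff {f : L2} (hf : InSob 2 f) :
    Summable (fun n => ‖mFourierCoeff f n‖) ∧
      ∑' n, ‖mFourierCoeff f n‖ ≤ Real.sqrt (japaneseSum * sob 2 f) := by
  have hs := summable_japanese (s := 2) (by norm_num)
  have hfin : ∀ S : Finset (Fin 2 → ℤ), ∑ n ∈ S, ‖mFourierCoeff f n‖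
      ≤ Real.sqrt (japaneseSum * sob 2 f) := by
    intro S
    apply Real.le_sqrt_of_sq_le
    calc _ ≤ (∑ n ∈ S, (1 + normSq n) ^ (-2 : ℝ)) *
          ∑ n ∈ S, (1 + normSq n) ^ (2 : ℝ) * ‖mFourierCoeff f n‖ ^ 2 := by
          refine Finset.sum_sq_le_sum_mul_sum_of_sq_le_mul _
            (fun n _ => Real.rpow_nonneg (one_add_normSq_pos n).le _)
            (fun n _ => sob_term_nonneg 2 f n) fun n _ => ?_
          rw [← mul_assoc, ← Real.rpow_add (one_add_normSq_pos n)]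
          simp
      _ ≤ _ := by
          gcongr
          · exact Finset.sum_nonneg fun n _ => sob_term_nonneg 2 f n
          · exact japaneseSum_nonneg
          · exact hs.sum_le_tsum S fun n _ => Real.rpow_nonneg (one_add_normSq_pos n).le _
          · exact Summable.sum_le_tsum S (fun n _ => sob_term_nonneg 2 f n) hf
  exact ⟨summable_of_sum_le (fun _ => norm_nonneg _) hfin,
    Real.tsum_le_of_sum_le (fun _ => norm_nonneg _) hfin⟩

/-- The sum of the Fourier series of `f` in the space of continuous functions. -/
def contRep (f : L2) : C(T2, ℂ) := ∑' n, mFourierCoeff f n • mFourier n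

lemma hasSum_contRep {f : L2} (hf : InSob 2 f) :
    HasSum (fun n => mFourierCoeff f n • mFourier n) (contRep f) := by
  refine Summable.hasSum (Summable.of_norm ?_)
  simpa only [norm_smul, mFourier_norm, mul_one] using hf.summable_coeff.1

lemma toLp_contRep {f : L2} (hf : InSob 2 f) :
    ContinuousMap.toLp (E := ℂ) 2 volume ℂ (contRep f) = f := by
  have h := (ContinuousMap.toLp (E := ℂ) 2 (volume : Measure T2) ℂ).hasSum (hasSum_contRep hf)
  simp only [map_smul] at h
  exact h.unique (hasSum_mFourier_series_L2 f)

lemma coe_contRep {f : L2} (hf : InSob 2 f) : f =ᵐ[volume] contRep f := by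
  have h := ContinuousMap.coeFn_toLp (E := ℂ) (p := 2) (𝕜 := ℂ) (volume : Measure T2) (contRep f)
  rwa [toLp_contRep hf] at h

lemma norm_contRep_le {f : L2} (hf : InSob 2 f) :
    ‖contRep f‖ ≤ Real.sqrt (japaneseSum * sob 2 f) := by
  refine le_trans ?_ hf.summable_coeff.2
  refine tsum_of_norm_bounded (hf.summable_coeff.1.hasSum) fun n => ?_
  rw [norm_smul, mFourier_norm, mul_one]

lemma contRep_sub {f g : L2} (hf : InSob 2 f) (hg : InSob 2 g) :
    contRep (f - g) = contRep f - contRep g := by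
  refine (hasSum_contRep (hf.sub hg)).unique
    (((hasSum_contRep hf).sub (hasSum_contRep hg)).congr_fun fun n => ?_)
  ext x
  simp only [coeff_sub, ContinuousMap.sub_apply, ContinuousMap.smul_apply, smul_eq_mul]
  ring

/-! ### Multiplication operators and integration by parts -/

lemma memLp_mul (b : C(T2, ℂ)) (f : L2) : MemLp (fun x => b x * f x) 2 (volume : Measure T2) := by
  refine (Lp.memLp f).of_le_mul (c := ‖b‖)
    (b.continuous.aestronglyMeasurable.mul (Lp.aestronglyMeasurable f)) (ae_of_all _ fun x => ?_)
  rw [norm_mul]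
  gcongr
  exact b.norm_coe_le_norm x

/-- Multiplication by a continuous function, as a bounded operator of `L²`. -/
def mulL (b : C(T2, ℂ)) : L2 →L[ℂ] L2 :=
  LinearMap.mkContinuous
    { toFun := fun f => (memLp_mul b f).toLp
      map_add' := fun f g => by
        rw [← MemLp.toLp_add, MemLp.toLp_eq_toLp_iff]
        filter_upwards [Lp.coeFn_add f g] with x hx
        simp only [Pi.add_apply] at hx ⊢
        rw [hx, mul_add]
      map_smul' := fun c f => by
        rw [RingHom.id_apply, ← MemLp.toLp_const_smul, MemLp.toLp_eq_toLp_iff]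
        filter_upwards [Lp.coeFn_smul c f] with x hx
        simp only [Pi.smul_apply, smul_eq_mul] at hx ⊢
        rw [hx]; ring }
    ‖b‖ fun f => by
      refine Lp.norm_le_mul_norm_of_ae_le_mul ?_
      filter_upwards [(memLp_mul b f).coeFn_toLp] with x hx
      simp only [LinearMap.coe_mk, AddHom.coe_mk]
      rw [hx, norm_mul]
      gcongr
      exact b.norm_coe_le_norm x

lemma coe_mulL (b : C(T2, ℂ)) (f : L2) : mulL b f =ᵐ[volume] fun x => b x * f x :=
  (memLp_mul b f).coeFn_toLp

lemma norm_mulL_le (b : C(T2, ℂ)) (f : L2) : ‖mulL b f‖ ≤ ‖b‖ * ‖f‖ :=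
  (mulL b).le_of_opNorm_le (LinearMap.mkContinuous_norm_le _ (norm_nonneg _) _) f

lemma mulL_mul (a b : C(T2, ℂ)) (f : L2) : mulL a (mulL b f) = mulL (a * b) f := by
  apply Lp.ext
  filter_upwards [coe_mulL a (mulL b f), coe_mulL b f, coe_mulL (a * b) f] with x h1 h2 h3
  rw [h1, h2, h3, ContinuousMap.mul_apply, mul_assoc]

lemma mulL_add (a b : C(T2, ℂ)) (f : L2) : mulL (a + b) f = mulL a f + mulL b f := by
  apply Lp.ext
  filter_upwards [coe_mulL a f, coe_mulL b f, coe_mulL (a + b) f,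
    Lp.coeFn_add (mulL a f) (mulL b f)] with x h1 h2 h3 h4
  rw [h3, h4, Pi.add_apply, h1, h2, ContinuousMap.add_apply, add_mul]

lemma inner_eq_integral (f g : L2) : ⟪f, g⟫_ℂ = ∫ x, conj (f x) * g x := by
  rw [L2.inner_def]
  simp only [RCLike.inner_apply, mul_comm]

lemma inner_mulL (b : C(T2, ℂ)) (f g : L2) : ⟪f, mulL b g⟫_ℂ = ∫ x, b x * (conj (f x) * g x) := by
  rw [inner_eq_integral]
  apply integral_congr_ae
  filter_upwards [coe_mulL b g] with x h
  rw [h]; ring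

/-- A real-valued continuous function as a complex-valued one. -/
def toC (b : C(T2, ℝ)) : C(T2, ℂ) := ⟨fun x => (b x : ℂ), by fun_prop⟩

@[simp] lemma toC_apply (b : C(T2, ℝ)) (x : T2) : toC b x = (b x : ℂ) := rfl

lemma inner_mulL_symm (b : C(T2, ℝ)) (f g : L2) :
    ⟪mulL (toC b) f, g⟫_ℂ = ⟪f, mulL (toC b) g⟫_ℂ := by
  rw [inner_mulL, inner_eq_integral]
  apply integral_congr_ae
  filter_upwards [coe_mulL (toC b) f] with x h
  rw [h, map_mul, toC_apply, Complex.conj_ofReal]; ring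

lemma inner_mulL_self (b : C(T2, ℝ)) (f : L2) :
    ⟪f, mulL (toC b) f⟫_ℂ = ((∫ x, b x * ‖f x‖ ^ 2 : ℝ) : ℂ) := by
  rw [inner_mulL, ← integral_complex_ofReal]
  congr 1
  ext x
  rw [toC_apply, Complex.conj_mul']
  push_cast; rfl

lemma line_add (j : Fin 2) (s t : ℝ) : line j (s + t) = line j s + line j t := by
  ext i
  simp only [line, Pi.add_apply]
  split_ifs
  · rw [add_div, AddCircle.coe_add]
  · simp

lemma line_zero (j : Fin 2) : line j 0 = 0 := by ext i; simp [line]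

lemma hasDerivAt_line {F dF : T2 → ℂ} {j : Fin 2}
    (h : ∀ x, HasDerivAt (fun s => F (x + line j s)) (dF x) 0) (x : T2) (s : ℝ) :
    HasDerivAt (fun s => F (x + line j s)) (dF (x + line j s)) s := by
  have h1 := h (x + line j s)
  have h2 : HasDerivAt (fun u => F (x + line j s + line j (u - s))) (dF (x + line j s)) s := by
    have h3 : HasDerivAt (fun u : ℝ => u - s) 1 s := (hasDerivAt_id s).sub_const s
    have h4 : HasDerivAt (fun s_1 => F (x + line j s + line j s_1)) (dF (x + line j s))
        ((fun u : ℝ => u - s) s) := by simpa using h1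
    simpa [Function.comp_def] using HasDerivAt.scomp (h := fun u : ℝ => u - s) s h4 h3
  refine h2.congr_of_eventuallyEq (Eventually.of_forall fun u => ?_)
  simp only
  rw [add_assoc, ← line_add, add_sub_cancel]

/-- The integral of a derivative over the torus vanishes, because the integral is invariant under
translations. -/
lemma integral_deriv_eq_zero {F dF : T2 → ℂ} {j : Fin 2} (hF : Continuous F) (hdF : Continuous dF)
    (h : ∀ x, HasDerivAt (fun s => F (x + line j s)) (dF x) 0) : ∫ x, dF x = 0 := by
  obtain ⟨C, hC⟩ : ∃ C, ∀ x, ‖dF x‖ ≤ C := by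
    obtain ⟨C, hC⟩ := (isCompact_range hdF).isBounded.exists_norm_le
    exact ⟨C, fun x => hC _ ⟨x, rfl⟩⟩
  have hi : ∀ {G : T2 → ℂ}, Continuous G → Integrable G := fun hG =>
    hG.integrable_of_hasCompactSupport (HasCompactSupport.of_compactSpace _)
  have h1 := hasDerivAt_integral_of_dominated_loc_of_deriv_le (μ := (volume : Measure T2))
    (F := fun s x => F (x + line j s)) (F' := fun s x => dF (x + line j s)) (x₀ := (0 : ℝ))
    (s := Set.univ) (bound := fun _ => C) Filter.univ_mem
    (Eventually.of_forall fun s => (hF.comp (continuous_add_const _)).aestronglyMeasurable)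
    (hi (hF.comp (continuous_add_const _)))
    (hdF.comp (continuous_add_const _)).aestronglyMeasurable
    (ae_of_all _ fun x s _ => hC _) (integrable_const _)
    (ae_of_all _ fun x s _ => hasDerivAt_line h x s)
  have h2 : (fun s => ∫ x, F (x + line j s)) = fun _ => ∫ x, F x := by
    ext s; exact integral_add_right_eq_self F (line j s)
  have h3 := h1.2
  rw [h2] at h3
  have h4 := h3.unique (hasDerivAt_const _ _)
  simpa [line_zero] using h4

/-- Integration by parts for the weight `w`, tested against characters. -/
lemma integral_weight_deriv {w dw : C(T2, ℂ)} {j : Fin 2}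
    (h : ∀ x, HasDerivAt (fun s => w (x + line j s)) (dw x) 0) (m : Fin 2 → ℤ) :
    ∫ x, dw x * mFourier m x = -(Complex.I * m j * ∫ x, w x * mFourier m x) := by
  have hi : ∀ {G : T2 → ℂ}, Continuous G → Integrable G := fun hG =>
    hG.integrable_of_hasCompactSupport (HasCompactSupport.of_compactSpace _)
  have h1 := integral_deriv_eq_zero (j := j) (F := fun x => w x * mFourier m x)
    (dF := fun x => dw x * mFourier m x + w x * (Complex.I * m j * mFourier m x))
    (by fun_prop) (by fun_prop) fun x => by
      have := (h x).mul (hasDerivAt_mFourier_line m j x 0)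
      simpa [line_zero] using! this
  rw [integral_add (hi (by fun_prop)) (hi (by fun_prop))] at h1
  rw [← integral_const_mul, eq_neg_iff_add_eq_zero, ← h1]
  congr 2
  ext x
  ring

lemma inner_mFourierLp_mulL (b : C(T2, ℂ)) (m n : Fin 2 → ℤ) :
    ⟪mFourierLp 2 m, mulL b (mFourierLp 2 n)⟫_ℂ = ∫ x, b x * mFourier (n - m) x := by
  rw [inner_mulL]
  apply integral_congr_ae
  filter_upwards [coeFn_mFourierLp 2 m, coeFn_mFourierLp 2 n] with x h1 h2
  rw [h1, h2, ← mFourier_neg, ← mFourier_add, sub_eq_neg_add]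

/-- Integration by parts in `H¹` with a `C¹` weight. -/
lemma inner_partialDeriv_mulL {w dw : C(T2, ℂ)} {j : Fin 2}
    (h : ∀ x, HasDerivAt (fun s => w (x + line j s)) (dw x) 0) {f z : L2} (hf : InSob 1 f)
    (hz : InSob 1 z) :
    ⟪partialDeriv j z, mulL w f⟫_ℂ = -(⟪z, mulL w (partialDeriv j f)⟫_ℂ + ⟪z, mulL dw f⟫_ℂ) := by
  -- both sides are continuous in the Fourier series of `f` and `z`, so characters suffice
  have h1 : ∀ m n : Fin 2 → ℤ, (-(Complex.I * m j)) * ⟪mFourierLp 2 m, mulL w (mFourierLp 2 n)⟫_ℂ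
      = -((Complex.I * n j) * ⟪mFourierLp 2 m, mulL w (mFourierLp 2 n)⟫_ℂ
        + ⟪mFourierLp 2 m, mulL dw (mFourierLp 2 n)⟫_ℂ) := by
    intro m n
    rw [inner_mFourierLp_mulL, inner_mFourierLp_mulL, integral_weight_deriv h]
    simp only [Pi.sub_apply]
    push_cast
    ring
  have h2 : ∀ m : Fin 2 → ℤ, (-(Complex.I * m j)) * ⟪mFourierLp 2 m, mulL w f⟫_ℂ
      = -(⟪mFourierLp 2 m, mulL w (partialDeriv j f)⟫_ℂ + ⟪mFourierLp 2 m, mulL dw f⟫_ℂ) := by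
    intro m
    have a1 := ((hasSum_mFourier_series_L2 f).mapL (mulL w)).mapL
      (innerSL ℂ (mFourierLp (d := Fin 2) 2 m))
    have a2 := ((coeff_partialDeriv hf j).1.mapL (mulL w)).mapL
      (innerSL ℂ (mFourierLp (d := Fin 2) 2 m))
    have a3 := ((hasSum_mFourier_series_L2 f).mapL (mulL dw)).mapL
      (innerSL ℂ (mFourierLp (d := Fin 2) 2 m))
    simp only [map_smul, innerSL_apply_apply, smul_eq_mul] at a1 a2 a3
    refine (a1.mul_left (-(Complex.I * m j))).unique ?_
    have a4 := (a2.add a3).neg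
    refine a4.congr_fun fun n => ?_
    linear_combination mFourierCoeff f n * h1 m n
  have b1 := (coeff_partialDeriv hz j).1.mapL (innerSL ℂ (mulL w f))
  have b2 := (hasSum_mFourier_series_L2 z).mapL (innerSL ℂ (mulL w (partialDeriv j f)))
  have b3 := (hasSum_mFourier_series_L2 z).mapL (innerSL ℂ (mulL dw f))
  simp only [map_smul, innerSL_apply_apply, smul_eq_mul] at b1 b2 b3
  have b4 : ⟪mulL w f, partialDeriv j z⟫_ℂ
      = -(⟪mulL w (partialDeriv j f), z⟫_ℂ + ⟪mulL dw f, z⟫_ℂ) := by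
    refine b1.unique ((b2.add b3).neg.congr_fun fun m => ?_)
    have := congrArg conj (h2 m)
    simp only [map_mul, map_neg, map_add, Complex.conj_I, inner_conj_symm, map_intCast] at this
    linear_combination mFourierCoeff z m * this
  have := congrArg conj b4
  simpa only [map_neg, map_add, inner_conj_symm] using this

/-! ### Conservation of mass and energy -/

/-- The weight `exp (-c y)`. -/
def expWeight (c : ℝ) (y : C(T2, ℝ)) : C(T2, ℝ) := ⟨fun x => Real.exp (-(c * y x)), by fun_prop⟩

@[simp] lemma expWeight_apply (c : ℝ) (y : C(T2, ℝ)) (x : T2) :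
    expWeight c y x = Real.exp (-(c * y x)) := rfl

/-- The function `|V|^p`, for `p ≥ 0`. -/
def absPow {p : ℝ} (hp : 0 ≤ p) (V : C(T2, ℂ)) : C(T2, ℝ) :=
  ⟨fun x => ‖V x‖ ^ p, by
    have : Continuous fun x => ‖V x‖ := by fun_prop
    exact this.rpow_const fun _ => Or.inr hp⟩

@[simp] lemma absPow_apply {p : ℝ} (hp : 0 ≤ p) (V : C(T2, ℂ)) (x : T2) :
    absPow hp V x = ‖V x‖ ^ p := rfl

/-- A solution of `i ∂ₜ v = Δ v - 2 ∇v · ∇y + W v + λ exp (-p y) v |v|^p` in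
`C(ℝ; H²) ∩ C¹(ℝ; L²)`, for a real `C¹` function `y` with gradient `dy` and a real continuous
potential `W`, as an identity in `L²`. -/
structure IsFlow (y : C(T2, ℝ)) (dy : Fin 2 → C(T2, ℝ)) (W : C(T2, ℝ)) {p : ℝ} (hp : 0 ≤ p)
    (lam : ℝ) (v : ℝ → L2) : Prop where
  inSob : ∀ t, InSob 2 (v t)
  tendsto : ∀ t₀, Tendsto (fun t => sob 2 (v t - v t₀)) (𝓝 t₀) (𝓝 0)
  differentiable : Differentiable ℝ v
  equation : ∀ t, Complex.I • deriv v t =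
    laplacian (v t) - (2 : ℂ) • ∑ j, mulL (toC (dy j)) (partialDeriv j (v t))
      + mulL (toC (W + lam • (expWeight p y * absPow hp (contRep (v t))))) (v t)

/-- The divergence-form operator `∑ⱼ ∂ⱼ (exp (-2 y) ∂ⱼ f) = exp (-2 y) (Δ f - 2 ∇y · ∇f)`. -/
def divOp (y : C(T2, ℝ)) (dy : Fin 2 → C(T2, ℝ)) (f : L2) : L2 :=
  mulL (toC (expWeight 2 y))
    (laplacian f - (2 : ℂ) • ∑ j, mulL (toC (dy j)) (partialDeriv j f))

lemma toC_mul (a b : C(T2, ℝ)) : toC a * toC b = toC (a * b) := by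
  ext x; simp

lemma mulL_toC_add (a b : C(T2, ℝ)) (f : L2) :
    mulL (toC (a + b)) f = mulL (toC a) f + mulL (toC b) f := by
  rw [← mulL_add]
  congr 2
  ext x; simp

lemma mulL_toC_smul (c : ℝ) (a : C(T2, ℝ)) (f : L2) :
    mulL (toC (c • a)) f = (c : ℂ) • mulL (toC a) f := by
  apply Lp.ext
  filter_upwards [coe_mulL (toC (c • a)) f, coe_mulL (toC a) f,
    Lp.coeFn_smul (c : ℂ) (mulL (toC a) f)] with x h1 h2 h3
  rw [h3, h1, Pi.smul_apply, h2]
  simp [mul_assoc]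

lemma IsGradient.hasDerivAt_expWeight {y : C(T2, ℝ)} {dy : Fin 2 → C(T2, ℝ)}
    (h : IsGradient y dy) (j : Fin 2) (x : T2) :
    HasDerivAt (fun s => toC (expWeight 2 y) (x + line j s))
      (toC ((-2 : ℝ) • (expWeight 2 y * dy j)) x) 0 := by
  have h1 := (((h.hasDerivAt j x).const_mul 2).neg.exp).ofReal_comp
  refine h1.congr_deriv ?_
  simp only [toC_apply, line_zero, add_zero, ContinuousMap.smul_apply, ContinuousMap.mul_apply,
    expWeight_apply, smul_eq_mul, Pi.neg_apply]
  push_cast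
  ring

/-- The quadratic form of `divOp` is `-∫ exp (-2 y) ∇z · ∇f`. -/
lemma inner_divOp {y : C(T2, ℝ)} {dy : Fin 2 → C(T2, ℝ)} (h : IsGradient y dy) {f z : L2}
    (hf : InSob 2 f) (hz : InSob 1 z) :
    ⟪z, divOp y dy f⟫_ℂ
      = -∑ j, ⟪partialDeriv j z, mulL (toC (expWeight 2 y)) (partialDeriv j f)⟫_ℂ := by
  have h1 : ∀ j, InSob 1 (partialDeriv j f) := fun j =>
    InSob.partialDeriv zero_le_one (by norm_num; exact hf) j
  simp only [fun j => inner_partialDeriv_mulL (h.hasDerivAt_expWeight j) (h1 j) hz]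
  rw [divOp, laplacian_eq hf, map_sub, map_smul, map_sum, map_sum, inner_sub_right,
    inner_smul_right, inner_sum, inner_sum, Finset.mul_sum, ← Finset.sum_sub_distrib,
    ← Finset.sum_neg_distrib]
  refine Finset.sum_congr rfl fun j _ => ?_
  rw [mulL_toC_smul, inner_smul_right, mulL_mul, toC_mul]
  push_cast
  ring

lemma divOp_sub {y : C(T2, ℝ)} {dy : Fin 2 → C(T2, ℝ)} {f g : L2} (hf : InSob 2 f)
    (hg : InSob 2 g) : divOp y dy (f - g) = divOp y dy f - divOp y dy g := by
  have h : ∀ j, partialDeriv j (f - g) = partialDeriv j f - partialDeriv j g := fun j =>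
    partialDeriv_sub (hf.mono one_le_two) (hg.mono one_le_two) j
  simp only [divOp, h, laplacian_sub hf hg, map_sub, Finset.sum_sub_distrib, smul_sub]
  abel

lemma exists_norm_divOp_le (y : C(T2, ℝ)) (dy : Fin 2 → C(T2, ℝ)) :
    ∃ C, ∀ f, InSob 2 f → ‖divOp y dy f‖ ≤ C * Real.sqrt (sob 2 f) := by
  refine ⟨‖toC (expWeight 2 y)‖ * (1 + 2 * ∑ j, ‖toC (dy j)‖), fun f hf => ?_⟩
  have h1 : ‖laplacian f‖ ≤ Real.sqrt (sob 2 f) := Real.le_sqrt_of_sq_le (norm_sq_laplacian_le hf)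
  have h2 : ∀ j, ‖partialDeriv j f‖ ≤ Real.sqrt (sob 2 f) := fun j =>
    Real.le_sqrt_of_sq_le ((norm_sq_partialDeriv_le (hf.mono one_le_two) j).trans
      (sob_mono one_le_two hf))
  refine (norm_mulL_le _ _).trans ?_
  rw [mul_assoc]
  gcongr
  refine (norm_sub_le _ _).trans ?_
  rw [add_mul, one_mul, norm_smul, mul_assoc, Finset.sum_mul, Complex.norm_ofNat]
  gcongr
  refine (norm_sum_le _ _).trans (Finset.sum_le_sum fun j _ => (norm_mulL_le _ _).trans ?_)
  gcongr
  exact h2 j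

/-- If `f` vanishes at `t₀`, the product rule for `⟪f, g⟫` at `t₀` only needs continuity
of `g`. -/
lemma hasDerivAt_inner_of_eq_zero {f g : ℝ → L2} {f' : L2} {t₀ : ℝ} (hf : HasDerivAt f f' t₀)
    (h0 : f t₀ = 0) (hg : ContinuousAt g t₀) :
    HasDerivAt (fun t => ⟪f t, g t⟫_ℂ) ⟪f', g t₀⟫_ℂ t₀ := by
  rw [hasDerivAt_iff_tendsto_slope] at hf ⊢
  have h1 := hf.inner (𝕜 := ℂ) (hg.tendsto.mono_left (nhdsWithin_le_nhds (s := {t₀}ᶜ)))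
  refine h1.congr fun t => ?_
  simp only [slope_def_module, h0, sub_zero, inner_zero_left]
  have h2 : (t - t₀)⁻¹ • f t = (((t - t₀)⁻¹ : ℝ) : ℂ) • f t := (Complex.coe_smul _ _).symm
  rw [h2, inner_smul_left, Complex.conj_ofReal, Complex.real_smul]

/-- The Dirichlet energy `∫ exp (-2 y) |∇f|²`. -/
def dirichlet (y : C(T2, ℝ)) (f : L2) : ℝ :=
  ∑ j, ∫ x, expWeight 2 y x * ‖partialDeriv j f x‖ ^ 2

lemma dirichlet_eq_re_inner (y : C(T2, ℝ)) (f : L2) :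
    (dirichlet y f : ℂ)
      = ∑ j, ⟪partialDeriv j f, mulL (toC (expWeight 2 y)) (partialDeriv j f)⟫_ℂ := by
  simp only [inner_mulL_self, dirichlet, Complex.ofReal_sum]

/-- The increment of the Dirichlet energy, without a derivative on the increment of `f`. -/
lemma dirichlet_sub_dirichlet {y : C(T2, ℝ)} {dy : Fin 2 → C(T2, ℝ)} (h : IsGradient y dy)
    {f g : L2} (hf : InSob 2 f) (hg : InSob 2 g) :
    dirichlet y f - dirichlet y g = -(⟪f - g, divOp y dy f + divOp y dy g⟫_ℂ).re := by
  have hf1 : InSob 1 f := hf.mono one_le_two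
  have hg1 : InSob 1 g := hg.mono one_le_two
  have e1 := dirichlet_eq_re_inner y f
  have e2 := dirichlet_eq_re_inner y g
  rw [inner_add_right, inner_divOp h hf (hf1.sub hg1), inner_divOp h hg (hf1.sub hg1),
    ← neg_add, Complex.neg_re, neg_neg, ← Finset.sum_add_distrib]
  have e3 : ∀ j, ⟪partialDeriv j g, mulL (toC (expWeight 2 y)) (partialDeriv j f)⟫_ℂ
      = conj ⟪partialDeriv j f, mulL (toC (expWeight 2 y)) (partialDeriv j g)⟫_ℂ := fun j => by
    rw [inner_conj_symm, inner_mulL_symm]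
  simp only [partialDeriv_sub hf1 hg1, inner_sub_left, e3]
  rw [← Complex.ofReal_re (dirichlet y f), ← Complex.ofReal_re (dirichlet y g), e1, e2,
    ← Complex.sub_re, ← Finset.sum_sub_distrib, Complex.re_sum, Complex.re_sum]
  refine Finset.sum_congr rfl fun j _ => ?_
  simp only [Complex.sub_re, Complex.add_re, Complex.conj_re]
  ring

/-- Second-order Taylor estimate for `s ↦ s ^ r`, `r ≥ 2`. -/
lemma abs_rpow_sub_rpow_sub_le {r R s s' : ℝ} (hr : 2 ≤ r) (hs : s ∈ Set.Icc 0 R)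
    (hs' : s' ∈ Set.Icc 0 R) :
    |s' ^ r - s ^ r - r * s ^ (r - 1) * (s' - s)|
      ≤ r * (r - 1) * R ^ (r - 2) * (s' - s) ^ 2 := by
  have hR : 0 ≤ R := hs.1.trans hs.2
  have h1 : ∀ x ∈ Set.Icc 0 R, |x ^ (r - 1) - s ^ (r - 1)| ≤ (r - 1) * R ^ (r - 2) * |x - s| := by
    intro x hx
    refine (convex_Icc 0 R).norm_image_sub_le_of_norm_hasDerivWithin_le
      (f := fun x => x ^ (r - 1)) (f' := fun x => (r - 1) * x ^ (r - 1 - 1))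
      (fun z _ => (Real.hasDerivAt_rpow_const (Or.inr (by linarith))).hasDerivWithinAt)
      (fun z hz => ?_) hs hx
    rw [Real.norm_eq_abs, abs_of_nonneg
      (mul_nonneg (by linarith) (Real.rpow_nonneg hz.1 _))]
    have : r - 1 - 1 = r - 2 := by ring
    rw [this]
    exact mul_le_mul_of_nonneg_left (Real.rpow_le_rpow hz.1 hz.2 (by linarith)) (by linarith)
  have hsub : Set.uIcc s s' ⊆ Set.Icc 0 R := Set.ordConnected_Icc.uIcc_subset hs hs'
  have h2 := (convex_uIcc s s').norm_image_sub_le_of_norm_hasDerivWithin_le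
    (f := fun x => x ^ r - r * s ^ (r - 1) * x)
    (f' := fun x => r * x ^ (r - 1) - r * s ^ (r - 1) * 1)
    (C := r * ((r - 1) * R ^ (r - 2) * |s' - s|))
    (fun z _ => (((Real.hasDerivAt_rpow_const (Or.inr (by linarith))).sub
      ((hasDerivAt_id z).const_mul _))).hasDerivWithinAt)
    (fun z hz => ?_) Set.left_mem_uIcc Set.right_mem_uIcc
  · rw [Real.norm_eq_abs, Real.norm_eq_abs] at h2
    refine le_of_eq_of_le ?_ (h2.trans (le_of_eq ?_))
    · congr 1; ring
    · rw [← sq_abs (s' - s)]; ring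
  · rw [mul_one, ← mul_sub, norm_mul, Real.norm_eq_abs, Real.norm_eq_abs,
      abs_of_nonneg (by linarith : 0 ≤ r)]
    refine mul_le_mul_of_nonneg_left ((h1 z (hsub hz)).trans ?_) (by linarith)
    refine mul_le_mul_of_nonneg_left (Set.abs_sub_left_of_mem_uIcc hz) ?_
    exact mul_nonneg (by linarith) (Real.rpow_nonneg hR _)

/-- The potential energy `∫ exp (-2 y) exp (-p y) |f|^(p + 2)`, with the continuous
representative of `f`. -/
def potEnergy (y : C(T2, ℝ)) (p : ℝ) (f : L2) : ℝ :=
  ∫ x, expWeight 2 y x * expWeight p y x * ‖contRep f x‖ ^ (p + 2)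

lemma potEnergy_nonneg (y : C(T2, ℝ)) (p : ℝ) (f : L2) : 0 ≤ potEnergy y p f :=
  integral_nonneg fun x => by
    simp only [expWeight_apply]
    positivity

lemma integrable_of_continuous {E : Type*} [NormedAddCommGroup E] {F : T2 → E}
    (hF : Continuous F) : Integrable F :=
  hF.integrable_of_hasCompactSupport (HasCompactSupport.of_compactSpace _)

lemma re_inner_mulL_self {f : L2} (hf : InSob 2 f) (b : C(T2, ℝ)) :
    (⟪f, mulL (toC b) f⟫_ℂ).re = ∫ x, b x * ‖contRep f x‖ ^ 2 := by
  rw [inner_mulL_self, Complex.ofReal_re]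
  apply integral_congr_ae
  filter_upwards [coe_contRep hf] with x h
  rw [h]

lemma norm_sq_eq_integral_contRep {f : L2} (hf : InSob 2 f) :
    ‖f‖ ^ 2 = ∫ x, ‖contRep f x‖ ^ 2 := by
  have h := re_inner_mulL_self hf 1
  have h1 : mulL (toC 1) f = f := by
    apply Lp.ext
    filter_upwards [coe_mulL (toC 1) f] with x hx
    rw [hx]; simp
  rw [h1] at h
  simp only [ContinuousMap.one_apply, one_mul] at h
  rw [← h, ← inner_self_eq_norm_sq (𝕜 := ℂ) f]
  rfl

/-- Linearisation of the potential energy: to first order it changes like the quadratic form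
with weight `((p + 2) / 2) exp (-(p + 2) y) |g|^p`. -/
lemma abs_potEnergy_sub_le {y : C(T2, ℝ)} {p : ℝ} (hp : 2 ≤ p) (hp0 : 0 ≤ p) {f g : L2} {R : ℝ}
    (hf : InSob 2 f) (hg : InSob 2 g) (hfR : ‖contRep f‖ ≤ R) (hgR : ‖contRep g‖ ≤ R) :
    |potEnergy y p f - potEnergy y p g - (p + 2) / 2 *
      ((⟪f, mulL (toC (expWeight 2 y * (expWeight p y * absPow hp0 (contRep g)))) f⟫_ℂ).re
      - (⟪g, mulL (toC (expWeight 2 y * (expWeight p y * absPow hp0 (contRep g)))) g⟫_ℂ).re)|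
      ≤ ‖expWeight 2 y * expWeight p y‖ * ((p + 2) / 2 * ((p + 2) / 2 - 1) *
        (R ^ 2) ^ ((p + 2) / 2 - 2) * (2 * R) ^ 2) * ‖f - g‖ ^ 2 := by
  have hi : ∀ {F : T2 → ℝ}, Continuous F → Integrable F := fun hF => integrable_of_continuous hF
  have cf : Continuous fun x => ‖contRep f x‖ := by fun_prop
  have cg : Continuous fun x => ‖contRep g x‖ := by fun_prop
  have cf' := cf.rpow_const (p := p + 2) fun _ => Or.inr (by linarith)
  have cg' := cg.rpow_const (p := p + 2) fun _ => Or.inr (by linarith)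
  have cg'' := cg.rpow_const (p := p) fun _ => Or.inr (by linarith)
  have cw := (expWeight 2 y * expWeight p y).continuous
  rw [re_inner_mulL_self hf, re_inner_mulL_self hg, potEnergy, potEnergy,
    ← integral_sub (hi (by fun_prop)) (hi (by fun_prop)),
    ← integral_sub (hi (by fun_prop)) (hi (by fun_prop)), ← integral_const_mul,
    ← integral_sub (hi (by fun_prop)) (hi (by fun_prop)),
    norm_sq_eq_integral_contRep (hf.sub hg), ← integral_const_mul, ← Real.norm_eq_abs]
  refine norm_integral_le_of_norm_le (hi (by fun_prop)) (ae_of_all _ fun x => ?_)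
  have hR : 0 ≤ R := (norm_nonneg _).trans hfR
  have bf : ‖contRep f x‖ ≤ R := ((contRep f).norm_coe_le_norm x).trans hfR
  have bg : ‖contRep g x‖ ≤ R := ((contRep g).norm_coe_le_norm x).trans hgR
  have e1 : ∀ a : ℝ, 0 ≤ a → (a ^ 2) ^ ((p + 2) / 2) = a ^ (p + 2) := fun a ha => by
    rw [← Real.rpow_natCast, ← Real.rpow_mul ha]; congr 1; push_cast; ring
  have e2 : ∀ a : ℝ, 0 ≤ a → (a ^ 2) ^ ((p + 2) / 2 - 1) = a ^ p := fun a ha => by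
    rw [← Real.rpow_natCast, ← Real.rpow_mul ha]; congr 1; push_cast; ring
  have key := abs_rpow_sub_rpow_sub_le (r := (p + 2) / 2) (R := R ^ 2)
    (s := ‖contRep g x‖ ^ 2) (s' := ‖contRep f x‖ ^ 2) (by linarith)
    ⟨by positivity, by gcongr⟩ ⟨by positivity, by gcongr⟩
  rw [e1 _ (norm_nonneg _), e1 _ (norm_nonneg _), e2 _ (norm_nonneg _)] at key
  have e3 : (‖contRep f x‖ ^ 2 - ‖contRep g x‖ ^ 2) ^ 2
      ≤ (2 * R) ^ 2 * ‖contRep (f - g) x‖ ^ 2 := by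
    have h1 : ‖contRep f x‖ ^ 2 - ‖contRep g x‖ ^ 2
        = (‖contRep f x‖ + ‖contRep g x‖) * (‖contRep f x‖ - ‖contRep g x‖) := by ring
    rw [h1, mul_pow, ← sq_abs (‖contRep f x‖ - ‖contRep g x‖)]
    gcongr
    · linarith
    · rw [contRep_sub hf hg, ContinuousMap.sub_apply]
      exact abs_norm_sub_norm_le _ _
  have e4 : expWeight 2 y x * expWeight p y x ≤ ‖expWeight 2 y * expWeight p y‖ :=
    (le_abs_self _).trans ((expWeight 2 y * expWeight p y).norm_coe_le_norm x)
  have e5 : 0 ≤ expWeight 2 y x * expWeight p y x := by simp only [expWeight_apply]; positivity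
  have e6 : 0 ≤ (p + 2) / 2 * ((p + 2) / 2 - 1) * (R ^ 2) ^ ((p + 2) / 2 - 2) :=
    mul_nonneg (mul_nonneg (by linarith) (by linarith)) (Real.rpow_nonneg (by positivity) _)
  calc _ = expWeight 2 y x * expWeight p y x * |‖contRep f x‖ ^ (p + 2) - ‖contRep g x‖ ^ (p + 2)
        - (p + 2) / 2 * ‖contRep g x‖ ^ p * (‖contRep f x‖ ^ 2 - ‖contRep g x‖ ^ 2)| := by
        rw [Real.norm_eq_abs, ← abs_of_nonneg e5, ← abs_mul, abs_of_nonneg e5]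
        congr 1
        simp only [ContinuousMap.mul_apply, absPow_apply]
        ring
    _ ≤ ‖expWeight 2 y * expWeight p y‖ * ((p + 2) / 2 * ((p + 2) / 2 - 1) *
        (R ^ 2) ^ ((p + 2) / 2 - 2) * ((2 * R) ^ 2 * ‖contRep (f - g) x‖ ^ 2)) := by
        gcongr
        exact key.trans (mul_le_mul_of_nonneg_left e3 e6)
    _ = _ := by ring

section Flow

variable {y : C(T2, ℝ)} {dy : Fin 2 → C(T2, ℝ)} {W : C(T2, ℝ)} {p : ℝ} {hp : 0 ≤ p} {lam : ℝ}
  {v : ℝ → L2}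

lemma IsFlow.hasDerivAt (h : IsFlow y dy W hp lam v) (t : ℝ) : HasDerivAt v (deriv v t) t :=
  (h.differentiable t).hasDerivAt

lemma IsFlow.continuousAt_divOp (h : IsFlow y dy W hp lam v) (t₀ : ℝ) :
    ContinuousAt (fun t => divOp y dy (v t)) t₀ := by
  obtain ⟨C, hC⟩ := exists_norm_divOp_le y dy
  rw [ContinuousAt, tendsto_iff_norm_sub_tendsto_zero]
  have h1 : Tendsto (fun t => C * Real.sqrt (sob 2 (v t - v t₀))) (𝓝 t₀) (𝓝 0) := by
    simpa using ((Real.continuous_sqrt.tendsto 0).comp (h.tendsto t₀)).const_mul C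
  refine squeeze_zero (fun _ => norm_nonneg _) (fun t => ?_) h1
  rw [← divOp_sub (h.inSob t) (h.inSob t₀)]
  exact hC _ ((h.inSob t).sub (h.inSob t₀))

/-- The Dirichlet energy is differentiable although `v` is only `C¹` in `L²`: its increments
are `-Re ⟪v - v₀, L v + L v₀⟫` with `L v` continuous. -/
lemma IsFlow.hasDerivAt_dirichlet (h : IsFlow y dy W hp lam v) (hy : IsGradient y dy) (t₀ : ℝ) :
    HasDerivAt (fun t => dirichlet y (v t)) (-(2 * (⟪deriv v t₀, divOp y dy (v t₀)⟫_ℂ).re)) t₀ := by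
  have h1 := hasDerivAt_inner_of_eq_zero ((h.hasDerivAt t₀).sub_const (v t₀)) (sub_self _)
    ((h.continuousAt_divOp t₀).add (continuousAt_const (y := divOp y dy (v t₀))))
  have h2 := (Complex.reCLM.hasFDerivAt.comp_hasDerivAt t₀ h1).neg.const_add (dirichlet y (v t₀))
  refine (h2.congr_deriv ?_).congr_of_eventuallyEq (Eventually.of_forall fun t => ?_)
  · simp only [Complex.reCLM_apply, inner_add_right, Complex.add_re, Pi.add_apply]
    ring
  · have := dirichlet_sub_dirichlet hy (h.inSob t) (h.inSob t₀)
    simp only [Function.comp_apply, Complex.reCLM_apply, Pi.add_apply, Pi.neg_apply]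
    linarith

lemma IsFlow.hasDerivAt_quadratic (h : IsFlow y dy W hp lam v) (b : C(T2, ℝ)) (t : ℝ) :
    HasDerivAt (fun t => (⟪v t, mulL (toC b) (v t)⟫_ℂ).re)
      (2 * (⟪deriv v t, mulL (toC b) (v t)⟫_ℂ).re) t := by
  have h1 : HasDerivAt (fun t => mulL (toC b) (v t)) (mulL (toC b) (deriv v t)) t :=
    ((mulL (toC b)).restrictScalars ℝ).hasFDerivAt.comp_hasDerivAt t (h.hasDerivAt t)
  have h2 := Complex.reCLM.hasFDerivAt.comp_hasDerivAt t ((h.hasDerivAt t).inner ℂ h1)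
  refine h2.congr_deriv ?_
  rw [Complex.reCLM_apply, Complex.add_re, ← inner_mulL_symm, ← inner_conj_symm,
    Complex.conj_re]
  ring

lemma IsFlow.hasDerivAt_potEnergy (h : IsFlow y dy W hp lam v) (hp2 : 2 ≤ p) (t₀ : ℝ) :
    HasDerivAt (fun t => potEnergy y p (v t)) ((p + 2) * (⟪deriv v t₀,
      mulL (toC (expWeight 2 y * (expWeight p y * absPow hp (contRep (v t₀))))) (v t₀)⟫_ℂ).re)
      t₀ := by
  have h1 := (h.hasDerivAt_quadratic
    (expWeight 2 y * (expWeight p y * absPow hp (contRep (v t₀)))) t₀).const_mul ((p + 2) / 2)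
  set Q : ℝ → ℝ := fun t => (⟪v t, mulL (toC (expWeight 2 y *
    (expWeight p y * absPow hp (contRep (v t₀))))) (v t)⟫_ℂ).re with hQ
  -- the continuous representatives converge uniformly, hence are locally bounded
  have h2 : ∀ᶠ t in 𝓝 t₀, ‖contRep (v t)‖ ≤ ‖contRep (v t₀)‖ + 1 := by
    have h3 : Tendsto (fun t => Real.sqrt (japaneseSum * sob 2 (v t - v t₀))) (𝓝 t₀) (𝓝 0) := by
      have h4 := (h.tendsto t₀).const_mul japaneseSum
      rw [mul_zero] at h4
      simpa [Function.comp_def] using (Real.continuous_sqrt.tendsto 0).comp h4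
    filter_upwards [h3.eventually_le_const zero_lt_one] with t ht
    have h4 := norm_contRep_le ((h.inSob t).sub (h.inSob t₀))
    rw [contRep_sub (h.inSob t) (h.inSob t₀)] at h4
    have := norm_sub_norm_le (contRep (v t)) (contRep (v t₀))
    linarith
  have h3 : HasDerivAt (fun t => potEnergy y p (v t) - (p + 2) / 2 * Q t) 0 t₀ := by
    rw [hasDerivAt_iff_isLittleO]
    have h4 : (fun t => ‖v t - v t₀‖ ^ 2) =o[𝓝 t₀] fun t => t - t₀ := by
      have h5 : (fun t => v t - v t₀) =O[𝓝 t₀] fun t => t - t₀ := (h.hasDerivAt t₀).isBigO_sub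
      have h6 : (fun t => v t - v t₀) =o[𝓝 t₀] fun _ => (1 : ℝ) := by
        rw [Asymptotics.isLittleO_one_iff]
        simpa using ((h.hasDerivAt t₀).continuousAt.tendsto.sub_const (v t₀))
      simpa [sq] using h5.norm_left.mul_isLittleO h6.norm_left
    refine Asymptotics.IsBigO.trans_isLittleO ?_ h4
    refine Asymptotics.IsBigO.of_bound (‖expWeight 2 y * expWeight p y‖ *
      ((p + 2) / 2 * ((p + 2) / 2 - 1) * ((‖contRep (v t₀)‖ + 1) ^ 2) ^ ((p + 2) / 2 - 2) *
        (2 * (‖contRep (v t₀)‖ + 1)) ^ 2)) ?_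
    filter_upwards [h2] with t ht
    rw [smul_zero, sub_zero, Real.norm_eq_abs, Real.norm_of_nonneg (sq_nonneg _)]
    refine le_of_eq_of_le ?_ (abs_potEnergy_sub_le hp2 hp (h.inSob t) (h.inSob t₀) ht
      (le_add_of_nonneg_right zero_le_one))
    congr 1
    simp only [hQ]
    ring
  refine ((h3.add h1).congr_deriv (by ring)).congr_of_eventuallyEq
    (Eventually.of_forall fun t => ?_)
  simp only [hQ, Pi.add_apply]
  ring

/-- The equation in divergence form. -/
lemma IsFlow.divergence_form (h : IsFlow y dy W hp lam v) (t : ℝ) :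
    Complex.I • mulL (toC (expWeight 2 y)) (deriv v t) = divOp y dy (v t)
      + mulL (toC (expWeight 2 y * W)) (v t) + (lam : ℂ) •
        mulL (toC (expWeight 2 y * (expWeight p y * absPow hp (contRep (v t))))) (v t) := by
  rw [← map_smul, h.equation t, map_add, ← divOp, add_assoc, mulL_toC_add, map_add, mulL_toC_smul,
    map_smul, mulL_mul, mulL_mul, toC_mul, toC_mul]

/-- Conservation of the mass `∫ exp (-2 y) |v|²`. -/
lemma IsFlow.mass_eq (h : IsFlow y dy W hp lam v) (hy : IsGradient y dy) (t s : ℝ) :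
    (⟪v t, mulL (toC (expWeight 2 y)) (v t)⟫_ℂ).re
      = (⟪v s, mulL (toC (expWeight 2 y)) (v s)⟫_ℂ).re := by
  -- the right-hand side of the equation, tested against `v`, is real
  refine is_const_of_deriv_eq_zero (f := fun t =>
    (⟪v t, mulL (toC (expWeight 2 y)) (v t)⟫_ℂ).re)
    (fun t => (h.hasDerivAt_quadratic _ t).differentiableAt) (fun t => ?_) t s
  rw [(h.hasDerivAt_quadratic _ t).deriv, ← inner_mulL_symm, ← inner_conj_symm, Complex.conj_re]
  have h1 := congrArg (fun z => (⟪v t, z⟫_ℂ).im) (h.divergence_form t)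
  simp only [inner_smul_right, inner_add_right, inner_divOp hy (h.inSob t)
    ((h.inSob t).mono one_le_two), inner_mulL_self, ← Complex.ofReal_sum, ← Complex.ofReal_mul,
    ← Complex.ofReal_neg, ← Complex.ofReal_add, Complex.ofReal_im] at h1
  simpa using h1

/-- Conservation of the energy. -/
lemma IsFlow.energy_eq (h : IsFlow y dy W hp lam v) (hy : IsGradient y dy) (hp2 : 2 ≤ p)
    (t s : ℝ) :
    dirichlet y (v t) - (⟪v t, mulL (toC (expWeight 2 y * W)) (v t)⟫_ℂ).re
        - 2 * lam / (p + 2) * potEnergy y p (v t)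
      = dirichlet y (v s) - (⟪v s, mulL (toC (expWeight 2 y * W)) (v s)⟫_ℂ).re
        - 2 * lam / (p + 2) * potEnergy y p (v s) := by
  have hd := fun t => ((h.hasDerivAt_dirichlet hy t).sub
    (h.hasDerivAt_quadratic (expWeight 2 y * W) t)).sub
    ((h.hasDerivAt_potEnergy hp2 t).const_mul (2 * lam / (p + 2)))
  refine is_const_of_deriv_eq_zero (fun t => (hd t).differentiableAt) (fun t => ?_) t s
  -- the right-hand side of the equation, tested against `∂ₜ v`, is purely imaginary
  refine (hd t).deriv.trans ?_
  have h1 := congrArg (fun z => (⟪deriv v t, z⟫_ℂ).re) (h.divergence_form t)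
  simp only [inner_smul_right, inner_add_right, inner_mulL_self, Complex.add_re,
    Complex.mul_re, Complex.I_re, Complex.I_im, Complex.ofReal_re,
    Complex.ofReal_im, zero_mul, mul_zero, sub_zero] at h1
  have h2 : p + 2 ≠ 0 := by linarith
  field_simp
  linear_combination 2 * h1

end Flow

/-! ### An `L⁴` estimate for Fourier series -/

/-- The Cauchy–Schwarz inequality for series in `[0, ∞]`. -/
lemma sq_tsum_le_tsum_mul_tsum {ι : Type*} {x u v : ι → ℝ≥0∞} (h : ∀ i, x i ^ 2 ≤ u i * v i) :
    (∑' i, x i) ^ 2 ≤ (∑' i, u i) * ∑' i, v i := by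
  let _ : MeasurableSpace ι := ⊤
  have e1 : ∀ a : ℝ≥0∞, (a ^ (1 / 2 : ℝ)) ^ (2 : ℝ) = a := fun a => by
    rw [← ENNReal.rpow_mul]; norm_num
  have h1 : ∀ i, x i ≤ u i ^ (1 / 2 : ℝ) * v i ^ (1 / 2 : ℝ) := fun i => by
    rw [← ENNReal.mul_rpow_of_nonneg _ _ (by norm_num), ← ENNReal.rpow_le_rpow_iff two_pos, e1]
    simpa using h i
  have h2 := ENNReal.lintegral_mul_le_Lp_mul_Lq (Measure.count : Measure ι)
    (f := fun i => u i ^ (1 / 2 : ℝ)) (g := fun i => v i ^ (1 / 2 : ℝ))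
    (Real.HolderConjugate.two_two) measurable_from_top.aemeasurable
    measurable_from_top.aemeasurable
  simp only [Pi.mul_apply, e1, lintegral_count] at h2
  have h3 := (ENNReal.tsum_le_tsum h1).trans h2
  rw [← ENNReal.mul_rpow_of_nonneg _ _ (by norm_num)] at h3
  calc _ ≤ (((∑' i, u i) * ∑' i, v i) ^ (1 / 2 : ℝ)) ^ 2 := by gcongr
    _ = _ := by rw [← ENNReal.rpow_natCast]; exact e1 _

/-- Parseval's identity for continuous functions. -/
lemma hasSum_norm_sq_mFourierCoeff (F : C(T2, ℂ)) :
    HasSum (fun n => ‖mFourierCoeff F n‖ ^ 2) (∫ x, ‖F x‖ ^ 2) := by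
  have h := hasSum_sq_mFourierCoeff (ContinuousMap.toLp (E := ℂ) 2 (volume : Measure T2) ℂ F)
  simp only [mFourierCoeff_toLp] at h
  convert h using 1
  apply integral_congr_ae
  filter_upwards [ContinuousMap.coeFn_toLp (E := ℂ) (p := 2) (𝕜 := ℂ) (volume : Measure T2) F]
    with x hx
  rw [hx]

lemma hasSum_conj_mFourierCoeff_mul (F G : C(T2, ℂ)) :
    HasSum (fun n => conj (mFourierCoeff F n) * mFourierCoeff G n) (∫ x, conj (F x) * G x) := by
  have h := hasSum_prod_mFourierCoeff (ContinuousMap.toLp (E := ℂ) 2 (volume : Measure T2) ℂ F)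
    (ContinuousMap.toLp (E := ℂ) 2 (volume : Measure T2) ℂ G)
  simp only [mFourierCoeff_toLp] at h
  convert h using 1
  apply integral_congr_ae
  filter_upwards [ContinuousMap.coeFn_toLp (E := ℂ) (p := 2) (𝕜 := ℂ) (volume : Measure T2) F,
    ContinuousMap.coeFn_toLp (E := ℂ) (p := 2) (𝕜 := ℂ) (volume : Measure T2) G] with x hx hx'
  rw [hx, hx']

/-- The Fourier coefficient, as a continuous functional on continuous functions. -/
def coeffCLM (n : Fin 2 → ℤ) : C(T2, ℂ) →L[ℂ] ℂ :=
  (innerSL ℂ (mFourierLp (d := Fin 2) 2 n)).comp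
    (ContinuousMap.toLp (E := ℂ) 2 (volume : Measure T2) ℂ)

lemma coeffCLM_apply (n : Fin 2 → ℤ) (F : C(T2, ℂ)) : coeffCLM n F = mFourierCoeff F n := by
  have h := mFourierBasis.repr_apply_apply
    (ContinuousMap.toLp (E := ℂ) 2 (volume : Measure T2) ℂ F) n
  rw [coe_mFourierBasis] at h
  rw [← mFourierCoeff_toLp, coeff_eq_repr]
  exact h.symm

lemma mFourierCoeff_mFourier_mul (F : C(T2, ℂ)) (m n : Fin 2 → ℤ) :
    mFourierCoeff (mFourier m * F : C(T2, ℂ)) n = mFourierCoeff F (n - m) := by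
  simp only [mFourierCoeff, ContinuousMap.mul_apply, smul_eq_mul]
  congr 1
  ext x
  rw [← mul_assoc, ← mFourier_add, neg_sub, sub_eq_neg_add]

lemma mFourierCoeff_of_hasSum {a : (Fin 2 → ℤ) → ℂ} {V : C(T2, ℂ)}
    (hV : HasSum (fun n => a n • mFourier n) V) (n : Fin 2 → ℤ) : mFourierCoeff V n = a n := by
  have h := hV.mapL (coeffCLM n)
  rw [coeffCLM_apply] at h
  refine h.unique ?_
  convert hasSum_ite_eq n (a n) using 2 with m
  rw [map_smul, coeffCLM_apply, smul_eq_mul, ← mul_one (mFourier m), mFourierCoeff_mFourier_mul]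
  simp only [mFourierCoeff, ContinuousMap.one_apply, smul_eq_mul, mul_one, integral_mFourier]
  have : -(n - m) = 0 ↔ m = n := by rw [neg_eq_zero, sub_eq_zero, eq_comm]
  simp only [this]
  split_ifs with h
  · rw [h, mul_one]
  · rw [mul_zero]

lemma mFourierCoeff_sq {a : (Fin 2 → ℤ) → ℂ} {V : C(T2, ℂ)}
    (hV : HasSum (fun n => a n • mFourier n) V) (n : Fin 2 → ℤ) :
    HasSum (fun m => a m * a (n - m)) (mFourierCoeff (V * V : C(T2, ℂ)) n) := by
  have h := (hV.mul_right V).mapL (coeffCLM n)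
  rw [coeffCLM_apply] at h
  refine h.congr_fun fun m => ?_
  rw [smul_mul_assoc, map_smul, coeffCLM_apply, mFourierCoeff_mFourier_mul,
    mFourierCoeff_of_hasSum hV, smul_eq_mul]

/-- The constant of the embedding of `H^{5/8}` into `L⁴`. -/
def l4Const : ℝ := ∑' n : Fin 2 → ℤ, (1 + normSq n) ^ (-(5 / 4) : ℝ)

lemma l4Const_nonneg : 0 ≤ l4Const :=
  tsum_nonneg fun n => Real.rpow_nonneg (one_add_normSq_pos n).le _

/-- The embedding of `H^{5/8}` into `L⁴`: the Fourier coefficients of `V ^ 2` are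
convolutions, so the Cauchy–Schwarz inequality and Parseval's identity for `V ^ 2` give the
bound. -/
lemma integral_norm_pow_four_le {a : (Fin 2 → ℤ) → ℂ} {V : C(T2, ℂ)}
    (hV : HasSum (fun n => a n • mFourier n) V)
    (ha : Summable fun n => (1 + normSq n) ^ (5 / 8 : ℝ) * ‖a n‖ ^ 2) :
    ∫ x, ‖V x‖ ^ 4 ≤ l4Const * (∑' n, (1 + normSq n) ^ (5 / 8 : ℝ) * ‖a n‖ ^ 2) ^ 2 := by
  set w : (Fin 2 → ℤ) → ℝ≥0∞ := fun n => ENNReal.ofReal ((1 + normSq n) ^ (-(5 / 8) : ℝ))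
  set b : (Fin 2 → ℤ) → ℝ≥0∞ := fun n =>
    ENNReal.ofReal ((1 + normSq n) ^ (5 / 8 : ℝ) * ‖a n‖ ^ 2) with hb
  have hwb : ∀ n, ‖a n‖ₑ ^ 2 = w n * b n := fun n => by
    rw [← ENNReal.ofReal_mul (Real.rpow_nonneg (one_add_normSq_pos n).le _), ← mul_assoc,
      ← Real.rpow_add (one_add_normSq_pos n), ← ofReal_norm, ← ENNReal.ofReal_pow (norm_nonneg _)]
    simp
  have hw : ∀ n, ∑' m, w m * w (n - m) ≤ ∑' m, w m ^ 2 := fun n => by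
    have h1 := sq_tsum_le_tsum_mul_tsum (x := fun m => w m * w (n - m)) (u := fun m => w m ^ 2)
      (v := fun m => w (n - m) ^ 2) fun m => (mul_pow _ _ _).le
    have h2 : ∑' m, w (n - m) ^ 2 = ∑' m, w m ^ 2 := (Equiv.subLeft n).tsum_eq (fun m => w m ^ 2)
    rw [h2, ← sq] at h1
    exact (ENNReal.pow_le_pow_left_iff two_ne_zero).1 h1
  have h1 : ∀ n, ‖mFourierCoeff (V * V : C(T2, ℂ)) n‖ₑ ^ 2
      ≤ (∑' m, w m ^ 2) * ∑' m, b m * b (n - m) := fun n => by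
    rw [← (mFourierCoeff_sq hV n).tsum_eq]
    calc _ ≤ (∑' m, ‖a m * a (n - m)‖ₑ) ^ 2 := by gcongr; exact enorm_tsum_le_tsum_enorm
      _ ≤ (∑' m, w m * w (n - m)) * ∑' m, b m * b (n - m) :=
        sq_tsum_le_tsum_mul_tsum fun m => by
          rw [enorm_mul, mul_pow, hwb, hwb, mul_mul_mul_comm]
      _ ≤ _ := mul_le_mul' (hw n) le_rfl
  have h2 : ∑' n, ∑' m, b m * b (n - m) = (∑' n, b n) ^ 2 := by
    rw [ENNReal.tsum_comm, sq]
    have h3 : ∀ m, ∑' n, b (n - m) = ∑' n, b n := fun m => (Equiv.subRight m).tsum_eq b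
    simp only [ENNReal.tsum_mul_left, h3, ENNReal.tsum_mul_right]
  have h3 := hasSum_norm_sq_mFourierCoeff (V * V)
  have h4 : ENNReal.ofReal (∫ x, ‖(V * V) x‖ ^ 2)
      ≤ ENNReal.ofReal l4Const *
        ENNReal.ofReal (∑' n, (1 + normSq n) ^ (5 / 8 : ℝ) * ‖a n‖ ^ 2) ^ 2 := by
    rw [← h3.tsum_eq, ENNReal.ofReal_tsum_of_nonneg (fun n => by positivity) h3.summable,
      ENNReal.ofReal_tsum_of_nonneg (fun n => mul_nonneg
        (Real.rpow_nonneg (one_add_normSq_pos n).le _) (by positivity)) ha, l4Const,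
      ENNReal.ofReal_tsum_of_nonneg (fun n => Real.rpow_nonneg (one_add_normSq_pos n).le _)
        (summable_japanese (by norm_num))]
    simp only [ENNReal.ofReal_pow (norm_nonneg _), ofReal_norm]
    calc _ ≤ ∑' n, (∑' m, w m ^ 2) * ∑' m, b m * b (n - m) := ENNReal.tsum_le_tsum h1
      _ = (∑' m, w m ^ 2) * (∑' n, b n) ^ 2 := by rw [ENNReal.tsum_mul_left, h2]
      _ = _ := by
        congr 2
        ext m
        rw [← ENNReal.ofReal_pow (Real.rpow_nonneg (one_add_normSq_pos m).le _),
          ← Real.rpow_natCast, ← Real.rpow_mul (one_add_normSq_pos m).le]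
        norm_num
  rw [← ENNReal.ofReal_pow (tsum_nonneg fun n => mul_nonneg
        (Real.rpow_nonneg (one_add_normSq_pos n).le _) (by positivity)),
      ← ENNReal.ofReal_mul l4Const_nonneg, ENNReal.ofReal_le_ofReal_iff
      (mul_nonneg l4Const_nonneg (sq_nonneg _))] at h4
  refine le_of_eq_of_le ?_ h4
  congr 1
  ext x
  rw [ContinuousMap.mul_apply, norm_mul]
  ring

/-! ### Translates and fractional regularity -/

/-- The translate `x ↦ F (x + h)`. -/
def translate (h : T2) (F : C(T2, ℂ)) : C(T2, ℂ) := ⟨fun x => F (x + h), by fun_prop⟩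

@[simp] lemma translate_apply (h : T2) (F : C(T2, ℂ)) (x : T2) : translate h F x = F (x + h) := rfl

lemma mFourierCoeff_translate (h : T2) (F : C(T2, ℂ)) (n : Fin 2 → ℤ) :
    mFourierCoeff (translate h F) n = mFourier n h * mFourierCoeff F n := by
  simp only [mFourierCoeff, smul_eq_mul, translate_apply]
  rw [← integral_const_mul,
    ← integral_add_right_eq_self (fun x => mFourier n h * (mFourier (-n) x * F x)) h]
  congr 1
  ext x
  have h1 : mFourier n h * mFourier (-n) h = 1 := by
    rw [← mFourier_add, add_neg_cancel, mFourier_zero, ContinuousMap.one_apply]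
  rw [mFourier_apply_add]
  linear_combination (-(mFourier (-n) x * F (x + h))) * h1

lemma mFourierCoeff_translate_sub (h : T2) (F : C(T2, ℂ)) (n : Fin 2 → ℤ) :
    mFourierCoeff (translate h F - F : C(T2, ℂ)) n
      = (mFourier n h - 1) * mFourierCoeff F n := by
  rw [← coeffCLM_apply, map_sub, coeffCLM_apply, coeffCLM_apply, mFourierCoeff_translate]
  ring

/-- Translates along dyadic shifts control the `H^{1/4}` norm: every frequency `n ≠ 0` is moved by
the shift of scale `2 ^ (-l)` in the direction of its largest coordinate, for `2 ^ l ≤ ‖n‖ <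
2 ^ (l + 1)`. -/
lemma exists_sum_rpow_norm_mul_le (F : C(T2, ℂ)) (S : Finset (Fin 2 → ℤ)) (hS : 0 ∉ S) :
    ∃ L : ℕ, ∑ n ∈ S, ‖n‖ ^ (1 / 2 : ℝ) * ‖mFourierCoeff F n‖ ^ 2
      ≤ 2 * ∑ j, ∑ l ∈ Finset.range L, dyadicBase ^ (8 * l) *
        ∫ x, ‖F (x + dyadicShift l j) - F x‖ ^ 2 := by
  have hq := dyadicBase_pos
  have h1 : ∀ n ∈ S, ∃ (l : ℕ) (j : Fin 2), ‖n‖ ^ (1 / 2 : ℝ) ≤ 2 * dyadicBase ^ (8 * l) ∧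
      1 ≤ ‖mFourier n (dyadicShift l j) - 1‖ := by
    intro n hn
    have hn0 : n ≠ 0 := fun h => hS (h ▸ hn)
    obtain ⟨j, hj⟩ : ∃ j, ‖n‖ = ‖n j‖ := by
      obtain ⟨j, -, hj⟩ := Finset.exists_mem_eq_sup' Finset.univ_nonempty (fun j => ‖n j‖₊)
      refine ⟨j, ?_⟩
      rw [Pi.norm_def, ← Finset.sup'_eq_sup Finset.univ_nonempty, hj]
      rfl
    have h1n := one_le_norm hn0
    set k := (n j).natAbs with hk
    have hkn : ‖n‖ = k := by
      rw [hj, Int.norm_eq_abs, hk, Nat.cast_natAbs]; push_cast; rfl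
    have hk0 : k ≠ 0 := by
      rintro h0
      rw [hkn, h0] at h1n
      norm_num at h1n
    refine ⟨Nat.log 2 k, j, ?_, ?_⟩
    · have h2 : ‖n‖ ≤ 2 * 2 ^ Nat.log 2 k := by
        rw [hkn]
        have := (Nat.lt_pow_succ_log_self one_lt_two k).le
        rw [pow_succ'] at this
        exact_mod_cast this
      have h3 : ‖n‖ ≤ (2 * dyadicBase ^ (8 * Nat.log 2 k)) ^ 2 := by
        rw [mul_pow, ← pow_mul, show 8 * Nat.log 2 k * 2 = 16 * Nat.log 2 k by ring,
          dyadicBase_pow_mul]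
        refine h2.trans ?_
        gcongr
        norm_num
      rw [← Real.sqrt_eq_rpow]
      exact (Real.sqrt_le_left (by positivity)).2 h3
    · apply one_le_norm_mFourier_dyadicShift_sub_one
      · rw [← Int.natCast_natAbs]
        exact_mod_cast Nat.pow_log_le_self 2 hk0
      · rw [← Int.natCast_natAbs]
        exact_mod_cast Nat.lt_pow_succ_log_self one_lt_two k
  choose! l j hl hj using h1
  refine ⟨S.sup l + 1, ?_⟩
  have h2 : ∀ n ∈ S, ‖n‖ ^ (1 / 2 : ℝ) * ‖mFourierCoeff F n‖ ^ 2
      ≤ ∑ i, ∑ k ∈ Finset.range (S.sup l + 1), 2 * dyadicBase ^ (8 * k) *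
        ‖mFourierCoeff (translate (dyadicShift k i) F - F : C(T2, ℂ)) n‖ ^ 2 := by
    intro n hn
    have e0 : ∀ (i : Fin 2) (k : ℕ), 0 ≤ 2 * dyadicBase ^ (8 * k) *
        ‖mFourierCoeff (translate (dyadicShift k i) F - F : C(T2, ℂ)) n‖ ^ 2 := fun i k => by
      positivity
    calc _ ≤ 2 * dyadicBase ^ (8 * l n) *
        ‖mFourierCoeff (translate (dyadicShift (l n) (j n)) F - F : C(T2, ℂ)) n‖ ^ 2 := by
          rw [mFourierCoeff_translate_sub, norm_mul, mul_pow]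
          have h3 : 1 ≤ ‖mFourier n (dyadicShift (l n) (j n)) - 1‖ ^ 2 := one_le_pow₀ (hj n hn)
          calc _ ≤ (2 * dyadicBase ^ (8 * l n)) * (1 * ‖mFourierCoeff F n‖ ^ 2) := by
                rw [one_mul]; gcongr; exact hl n hn
            _ ≤ _ := by gcongr
      _ ≤ ∑ k ∈ Finset.range (S.sup l + 1), 2 * dyadicBase ^ (8 * k) *
        ‖mFourierCoeff (translate (dyadicShift k (j n)) F - F : C(T2, ℂ)) n‖ ^ 2 :=
          Finset.single_le_sum (f := fun k => 2 * dyadicBase ^ (8 * k) *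
            ‖mFourierCoeff (translate (dyadicShift k (j n)) F - F : C(T2, ℂ)) n‖ ^ 2)
            (fun k _ => e0 _ k)
            (Finset.mem_range.2 (Nat.lt_succ_of_le (Finset.le_sup (f := l) hn)))
      _ ≤ _ := Finset.single_le_sum (f := fun i => ∑ k ∈ Finset.range (S.sup l + 1),
            2 * dyadicBase ^ (8 * k) *
            ‖mFourierCoeff (translate (dyadicShift k i) F - F : C(T2, ℂ)) n‖ ^ 2)
            (fun i _ => Finset.sum_nonneg fun k _ => e0 i k) (Finset.mem_univ _)
  refine (Finset.sum_le_sum h2).trans ?_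
  rw [Finset.sum_comm, Finset.mul_sum]
  refine Finset.sum_le_sum fun i _ => ?_
  rw [Finset.sum_comm, Finset.mul_sum]
  refine Finset.sum_le_sum fun k _ => ?_
  rw [← Finset.mul_sum, mul_assoc]
  gcongr
  exact sum_le_hasSum S (fun n _ => by positivity)
    (hasSum_norm_sq_mFourierCoeff (translate (dyadicShift k i) F - F))

/-- The sum `∑ₖ q ^ (-k)`, where `q` is `dyadicBase`. -/
def geomSum : ℝ := ∑' k : ℕ, (dyadicBase⁻¹) ^ k

lemma geomSum_nonneg : 0 ≤ geomSum :=
  tsum_nonneg fun _ => pow_nonneg (inv_nonneg.2 dyadicBase_pos.le) _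

/-- Interpolation between the bounds `2` and `2 ‖n‖ / 2 ^ l` for `‖mFourier n h - 1‖`: its square
is at most `4 ‖n‖ ^ (3/4) 2 ^ (-3l/4)`, which is summable against `2 ^ (l/2)`. -/
lemma sum_dyadicBase_mul_norm_sq_le (n : Fin 2 → ℤ) (j : Fin 2) (L : ℕ) :
    ∑ l ∈ Finset.range L, dyadicBase ^ (8 * l) * ‖mFourier n (dyadicShift l j) - 1‖ ^ 2
      ≤ 4 * geomSum * (1 + normSq n) ^ (3 / 8 : ℝ) := by
  have hq := dyadicBase_pos
  have hW : 0 ≤ (1 + normSq n) ^ (3 / 8 : ℝ) := Real.rpow_nonneg (one_add_normSq_pos n).le _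
  have h1 : ∀ l, dyadicBase ^ (8 * l) * ‖mFourier n (dyadicShift l j) - 1‖ ^ 2
      ≤ 4 * (1 + normSq n) ^ (3 / 8 : ℝ) * (dyadicBase⁻¹) ^ l := by
    intro l
    set c := ‖mFourier n (dyadicShift l j) - 1‖ / 2 with hc
    have hc0 : 0 ≤ c := by positivity
    have hc1 : c ≤ 1 := by
      rw [hc, div_le_one two_pos]; exact norm_mFourier_sub_one_le_two n _
    have hc2 : c ≤ ‖n‖ / 2 ^ l := by
      rw [hc, div_le_iff₀ two_pos]
      refine (norm_mFourier_dyadicShift_sub_one_le n l j).trans (le_of_eq ?_)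
      ring
    have e1 : ((2 : ℝ) ^ l) ^ (3 / 4 : ℝ) = dyadicBase ^ (12 * l) := by
      rw [← dyadicBase_pow_mul, ← Real.rpow_natCast, ← Real.rpow_natCast, ← Real.rpow_mul hq.le]
      congr 1; push_cast; ring
    have e2 : ‖n‖ ^ (3 / 4 : ℝ) ≤ (1 + normSq n) ^ (3 / 8 : ℝ) := by
      have : ‖n‖ ^ (3 / 4 : ℝ) = (‖n‖ ^ 2) ^ (3 / 8 : ℝ) := by
        rw [← Real.rpow_natCast, ← Real.rpow_mul (norm_nonneg _)]; norm_num
      rw [this]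
      gcongr
      linarith [norm_sq_le_normSq n]
    have e3 : c ^ 2 ≤ (1 + normSq n) ^ (3 / 8 : ℝ) / dyadicBase ^ (12 * l) := by
      calc c ^ 2 = c ^ (2 : ℝ) := (Real.rpow_two c).symm
        _ ≤ c ^ (3 / 4 : ℝ) :=
          Real.rpow_le_rpow_of_exponent_ge_of_imp hc0 hc1 (by norm_num) (by norm_num)
        _ ≤ (‖n‖ / 2 ^ l) ^ (3 / 4 : ℝ) := by gcongr
        _ = ‖n‖ ^ (3 / 4 : ℝ) / dyadicBase ^ (12 * l) := by
          rw [Real.div_rpow (norm_nonneg _) (by positivity), e1]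
        _ ≤ _ := by gcongr
    have e4 : ‖mFourier n (dyadicShift l j) - 1‖ ^ 2 = 4 * c ^ 2 := by rw [hc]; ring
    rw [e4]
    calc _ ≤ dyadicBase ^ (8 * l) *
          (4 * ((1 + normSq n) ^ (3 / 8 : ℝ) / dyadicBase ^ (12 * l))) := by gcongr
      _ = 4 * (1 + normSq n) ^ (3 / 8 : ℝ) * (dyadicBase⁻¹) ^ (4 * l) := by
        rw [show 12 * l = 8 * l + 4 * l by ring, pow_add, inv_pow]
        field_simp
      _ ≤ _ := by
        refine mul_le_mul_of_nonneg_left ?_ (by positivity)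
        exact pow_le_pow_of_le_one (by positivity) (inv_le_one_of_one_le₀ one_lt_dyadicBase.le)
          (by linarith)
  calc _ ≤ ∑ l ∈ Finset.range L, 4 * (1 + normSq n) ^ (3 / 8 : ℝ) * (dyadicBase⁻¹) ^ l :=
        Finset.sum_le_sum fun l _ => h1 l
    _ = 4 * (1 + normSq n) ^ (3 / 8 : ℝ) * ∑ l ∈ Finset.range L, (dyadicBase⁻¹) ^ l := by
        rw [Finset.mul_sum]
    _ ≤ 4 * (1 + normSq n) ^ (3 / 8 : ℝ) * geomSum := by
        gcongr
        exact summable_dyadicBase_inv.sum_le_tsum _ fun _ _ => by positivity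
    _ = _ := by ring

/-- The square of the `H^{5/8}` norm of the increment of `f` under the dyadic shift. -/
def sobIncrement (l : ℕ) (j : Fin 2) (f : L2) : ℝ :=
  ∑' n, (1 + normSq n) ^ (5 / 8 : ℝ) *
    ‖(mFourier n (dyadicShift l j) - 1) * mFourierCoeff f n‖ ^ 2

lemma InSob.summable_increment {f : L2} (hf : InSob 1 f) (l : ℕ) (j : Fin 2) :
    Summable fun n => (1 + normSq n) ^ (5 / 8 : ℝ) *
      ‖(mFourier n (dyadicShift l j) - 1) * mFourierCoeff f n‖ ^ 2 := by
  have h0 : Summable fun n => (1 + normSq n) ^ (5 / 8 : ℝ) * ‖mFourierCoeff f n‖ ^ 2 :=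
    hf.mono (by norm_num)
  refine Summable.of_nonneg_of_le (fun n => mul_nonneg
    (Real.rpow_nonneg (one_add_normSq_pos n).le _) (by positivity)) (fun n => ?_) (h0.mul_left 4)
  have h1 : 0 ≤ (1 + normSq n) ^ (5 / 8 : ℝ) := Real.rpow_nonneg (one_add_normSq_pos n).le _
  have h2 : ‖mFourier n (dyadicShift l j) - 1‖ ^ 2 ≤ 4 := by
    have := norm_mFourier_sub_one_le_two n (dyadicShift l j)
    nlinarith [norm_nonneg (mFourier n (dyadicShift l j) - 1)]
  rw [norm_mul, mul_pow, ← mul_assoc, mul_comm _ (‖mFourier n (dyadicShift l j) - 1‖ ^ 2),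
    mul_assoc]
  gcongr

/-- Increments in `H^{5/8}`, weighted by `2 ^ (l/2)`, are summable for functions in `H¹`, because
`5/8 + 3/8 = 1`. -/
lemma sum_sobIncrement_le {f : L2} (hf : InSob 1 f) (j : Fin 2) (L : ℕ) :
    ∑ l ∈ Finset.range L, dyadicBase ^ (8 * l) * sobIncrement l j f
      ≤ 4 * geomSum * sob 1 f := by
  simp only [sobIncrement, sob, ← tsum_mul_left]
  rw [← Summable.tsum_finsetSum fun l _ => (hf.summable_increment l j).mul_left _]
  refine Summable.tsum_le_tsum (fun n => ?_)
    (summable_sum fun l _ => (hf.summable_increment l j).mul_left _) (Summable.mul_left _ hf)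
  have h1 : 0 ≤ (1 + normSq n) ^ (5 / 8 : ℝ) := Real.rpow_nonneg (one_add_normSq_pos n).le _
  calc _ = (1 + normSq n) ^ (5 / 8 : ℝ) * ‖mFourierCoeff f n‖ ^ 2 * ∑ l ∈ Finset.range L,
        dyadicBase ^ (8 * l) * ‖mFourier n (dyadicShift l j) - 1‖ ^ 2 := by
        rw [Finset.mul_sum]
        refine Finset.sum_congr rfl fun l _ => ?_
        rw [norm_mul]; ring
    _ ≤ (1 + normSq n) ^ (5 / 8 : ℝ) * ‖mFourierCoeff f n‖ ^ 2 *
        (4 * geomSum * (1 + normSq n) ^ (3 / 8 : ℝ)) := by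
        gcongr
        exact sum_dyadicBase_mul_norm_sq_le n j L
    _ = 4 * geomSum * ((1 + normSq n) ^ (5 / 8 : ℝ) * (1 + normSq n) ^ (3 / 8 : ℝ) *
        ‖mFourierCoeff f n‖ ^ 2) := by ring
    _ = _ := by
        rw [← Real.rpow_add (one_add_normSq_pos n)]; norm_num

lemma integral_mul_le_sqrt_mul_sqrt {a b : T2 → ℝ} (ha : Continuous a) (hb : Continuous b)
    (ha0 : ∀ x, 0 ≤ a x) (hb0 : ∀ x, 0 ≤ b x) :
    ∫ x, a x * b x ≤ Real.sqrt (∫ x, a x ^ 2) * Real.sqrt (∫ x, b x ^ 2) := by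
  have h2 : ∀ {c : T2 → ℝ}, Continuous c → MemLp c (ENNReal.ofReal 2) (volume : Measure T2) :=
    fun hc => hc.memLp_of_hasCompactSupport (HasCompactSupport.of_compactSpace _)
  have h := integral_mul_le_Lp_mul_Lq_of_nonneg Real.HolderConjugate.two_two
    (ae_of_all _ ha0) (ae_of_all _ hb0) (h2 ha) (h2 hb)
  simpa only [Real.rpow_two, ← Real.sqrt_eq_rpow] using h

/-- The density `exp (-2 y) |V|²`. -/
def density (y : C(T2, ℝ)) (V : C(T2, ℂ)) : C(T2, ℂ) :=
  ⟨fun x => ((expWeight 2 y x * ‖V x‖ ^ 2 : ℝ) : ℂ), by fun_prop⟩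

lemma density_apply (y : C(T2, ℝ)) (V : C(T2, ℂ)) (x : T2) :
    density y V x = ((expWeight 2 y x * ‖V x‖ ^ 2 : ℝ) : ℂ) := rfl

lemma expWeight_le {y : C(T2, ℝ)} {K c : ℝ} (hc : 0 ≤ c) (hy : ∀ x, |y x| ≤ K) (x : T2) :
    expWeight c y x ≤ Real.exp (c * K) := by
  rw [expWeight_apply]
  gcongr
  have := (abs_le.1 (hy x)).1
  nlinarith

lemma le_expWeight {y : C(T2, ℝ)} {K c : ℝ} (hc : 0 ≤ c) (hy : ∀ x, |y x| ≤ K) (x : T2) :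
    Real.exp (-(c * K)) ≤ expWeight c y x := by
  rw [expWeight_apply]
  gcongr
  exact (le_abs_self _).trans (hy x)

lemma abs_expWeight_sub_le {y : C(T2, ℝ)} {K : ℝ} (hy : ∀ x, |y x| ≤ K) (x z : T2) :
    |expWeight 2 y x - expWeight 2 y z| ≤ Real.exp (2 * K) * (2 * |y x - y z|) := by
  have h := Convex.norm_image_sub_le_of_norm_hasDerivWithin_le (f := Real.exp) (f' := Real.exp)
    (C := Real.exp (2 * K)) (s := Set.Iic (2 * K)) (x := -(2 * y z)) (y := -(2 * y x))
    (fun t _ => (Real.hasDerivAt_exp t).hasDerivWithinAt)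
    (fun t ht => by
      rw [Real.norm_of_nonneg (Real.exp_nonneg t)]; exact Real.exp_le_exp.2 ht)
    (convex_Iic _)
    (by have := (abs_le.1 (hy z)).1; simp only [Set.mem_Iic]; linarith)
    (by have := (abs_le.1 (hy x)).1; simp only [Set.mem_Iic]; linarith)
  rw [Real.norm_eq_abs, Real.norm_eq_abs] at h
  refine h.trans (le_of_eq ?_)
  have : -(2 * y x) - -(2 * y z) = -(2 * (y x - y z)) := by ring
  rw [this, abs_neg, abs_mul, abs_two]

/-- The increment of `w |V|²` is `w_h (|V_h|² - |V|²) + (w_h - w) |V|²`. -/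
lemma norm_density_sub_sq_le {y : C(T2, ℝ)} {V : C(T2, ℂ)} {K D : ℝ} (hy : ∀ x, |y x| ≤ K)
    {h : T2} (hD : ∀ x, |y (x + h) - y x| ≤ D) (x : T2) :
    ‖density y V (x + h) - density y V x‖ ^ 2 ≤ Real.exp (2 * K) ^ 2 * (4 *
      (‖V (x + h)‖ ^ 2 * ‖V (x + h) - V x‖ ^ 2 + ‖V x‖ ^ 2 * ‖V (x + h) - V x‖ ^ 2)
      + 8 * (D ^ 2 * ‖V x‖ ^ 4)) := by
  have hD0 : 0 ≤ D := (abs_nonneg _).trans (hD x)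
  rw [density_apply, density_apply, ← Complex.ofReal_sub, Complex.norm_real, Real.norm_eq_abs,
    sq_abs]
  set W := expWeight 2 y (x + h)
  set w := expWeight 2 y x
  set a := ‖V (x + h)‖
  set b := ‖V x‖
  set d := ‖V (x + h) - V x‖
  have ha : 0 ≤ a := norm_nonneg _
  have hb : 0 ≤ b := norm_nonneg _
  have hd : |a - b| ≤ d := abs_norm_sub_norm_le _ _
  have hW : |W| ≤ Real.exp (2 * K) := by
    have hW0 : 0 ≤ W := Real.exp_nonneg _
    rw [abs_of_nonneg hW0]; exact expWeight_le zero_le_two hy _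
  have hWw : |W - w| ≤ Real.exp (2 * K) * (2 * D) := by
    refine (abs_expWeight_sub_le hy _ _).trans ?_
    gcongr
    exact hD x
  have e1 : (W * (a ^ 2 - b ^ 2)) ^ 2 ≤ Real.exp (2 * K) ^ 2 * (2 * (a ^ 2 + b ^ 2) * d ^ 2) := by
    rw [mul_pow, ← sq_abs W]
    have h1 : (a ^ 2 - b ^ 2) ^ 2 = (a + b) ^ 2 * |a - b| ^ 2 := by rw [sq_abs]; ring
    rw [h1]
    gcongr
    nlinarith [sq_nonneg (a - b)]
  have e2 : ((W - w) * b ^ 2) ^ 2 ≤ (Real.exp (2 * K) * (2 * D)) ^ 2 * b ^ 4 := by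
    rw [mul_pow, ← sq_abs (W - w), ← pow_mul]
    gcongr
  have e3 : W * a ^ 2 - w * b ^ 2 = W * (a ^ 2 - b ^ 2) + (W - w) * b ^ 2 := by ring
  rw [e3]
  calc _ ≤ 2 * ((W * (a ^ 2 - b ^ 2)) ^ 2 + ((W - w) * b ^ 2) ^ 2) := add_sq_le
    _ ≤ 2 * (Real.exp (2 * K) ^ 2 * (2 * (a ^ 2 + b ^ 2) * d ^ 2)
        + (Real.exp (2 * K) * (2 * D)) ^ 2 * b ^ 4) := by gcongr
    _ = _ := by ring

lemma integral_norm_density_sub_sq_le {y : C(T2, ℝ)} (V : C(T2, ℂ)) {K D : ℝ}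
    (hy : ∀ x, |y x| ≤ K) {h : T2} (hD : ∀ x, |y (x + h) - y x| ≤ D) :
    ∫ x, ‖density y V (x + h) - density y V x‖ ^ 2 ≤ 8 * Real.exp (2 * K) ^ 2 *
      (Real.sqrt (∫ x, ‖V x‖ ^ 4) * Real.sqrt (∫ x, ‖(translate h V - V) x‖ ^ 4)
        + D ^ 2 * ∫ x, ‖V x‖ ^ 4) := by
  have hi : ∀ {F : T2 → ℝ}, Continuous F → Integrable F := fun hF => integrable_of_continuous hF
  have h1 := integral_mono (hi (by fun_prop)) (hi (by fun_prop))
    (norm_density_sub_sq_le (V := V) hy hD)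
  refine h1.trans ?_
  rw [integral_const_mul, integral_add (hi (by fun_prop)) (hi (by fun_prop)), integral_const_mul,
    integral_const_mul, integral_const_mul, integral_add (hi (by fun_prop)) (hi (by fun_prop))]
  have h2 := integral_mul_le_sqrt_mul_sqrt (a := fun x => ‖V x‖ ^ 2)
    (b := fun x => ‖V (x + h) - V x‖ ^ 2) (by fun_prop) (by fun_prop) (fun x => by positivity)
    (fun x => by positivity)
  have h3 := integral_mul_le_sqrt_mul_sqrt (a := fun x => ‖V (x + h)‖ ^ 2)
    (b := fun x => ‖V (x + h) - V x‖ ^ 2) (by fun_prop) (by fun_prop) (fun x => by positivity)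
    (fun x => by positivity)
  rw [integral_add_right_eq_self (fun x => (‖V x‖ ^ 2) ^ 2) h] at h3
  simp only [← pow_mul, Nat.reduceMul] at h2 h3
  simp only [ContinuousMap.sub_apply, translate_apply]
  have h4 : 0 ≤ Real.exp (2 * K) ^ 2 := by positivity
  calc _ ≤ Real.exp (2 * K) ^ 2 * (4 * (Real.sqrt (∫ x, ‖V x‖ ^ 4) *
        Real.sqrt (∫ x, ‖V (x + h) - V x‖ ^ 4) + Real.sqrt (∫ x, ‖V x‖ ^ 4) *
        Real.sqrt (∫ x, ‖V (x + h) - V x‖ ^ 4)) + 8 * (D ^ 2 * ∫ x, ‖V x‖ ^ 4)) := by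
        gcongr
    _ = _ := by ring

/-! ### The renormalised potential as a form on `H¹` -/

lemma InSob.summable_five_eighths {f : L2} (hf : InSob 1 f) :
    Summable fun n => (1 + normSq n) ^ (5 / 8 : ℝ) * ‖mFourierCoeff f n‖ ^ 2 :=
  hf.mono (by norm_num)

lemma sqrt_integral_contRep_pow_four_le {f : L2} (hf : InSob 2 f) :
    Real.sqrt (∫ x, ‖contRep f x‖ ^ 4) ≤ Real.sqrt l4Const * sob (5 / 8) f := by
  have h := integral_norm_pow_four_le (hasSum_contRep hf)
    (hf.mono one_le_two).summable_five_eighths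
  refine (Real.sqrt_le_sqrt h).trans ?_
  rw [Real.sqrt_mul l4Const_nonneg]
  exact mul_le_mul_of_nonneg_left (Real.sqrt_sq (sob_nonneg _ f)).le (Real.sqrt_nonneg _)

lemma sqrt_integral_increment_pow_four_le {f : L2} (hf : InSob 2 f) (l : ℕ) (j : Fin 2) :
    Real.sqrt (∫ x, ‖(translate (dyadicShift l j) (contRep f) - contRep f) x‖ ^ 4)
      ≤ Real.sqrt l4Const * sobIncrement l j f := by
  have h0 : HasSum (fun n => ((mFourier n (dyadicShift l j) - 1) * mFourierCoeff f n) •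
      mFourier n) (translate (dyadicShift l j) (contRep f) - contRep f) := by
    have h1 := ((hasSum_contRep hf).map (ContinuousMap.compRightAlgHom ℂ ℂ
      (⟨fun x => x + dyadicShift l j, by fun_prop⟩ : C(T2, T2)))
      (ContinuousMap.compRightAlgHom_continuous ℂ ℂ _)).sub (hasSum_contRep hf)
    refine HasSum.congr_fun h1 fun n => ?_
    ext x
    simp only [ContinuousMap.smul_apply, ContinuousMap.sub_apply, Function.comp_apply,
      ContinuousMap.compRightAlgHom_apply, ContinuousMap.comp_apply, ContinuousMap.coe_mk,
      smul_eq_mul, mFourier_apply_add]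
    ring
  have h := integral_norm_pow_four_le h0 ((hf.mono one_le_two).summable_increment l j)
  refine (Real.sqrt_le_sqrt h).trans ?_
  have h1 : 0 ≤ sobIncrement l j f := tsum_nonneg fun n => mul_nonneg
    (Real.rpow_nonneg (one_add_normSq_pos n).le _) (by positivity)
  rw [Real.sqrt_mul l4Const_nonneg]
  exact mul_le_mul_of_nonneg_left (Real.sqrt_sq h1).le (Real.sqrt_nonneg _)

/-- The square of the `H^{1/4}` norm of the density is at most a constant times the product
of the squares of the `H¹` and `H^{5/8}` norms. -/
lemma exists_sum_density_le (K : ℝ) {D : ℕ → Fin 2 → ℝ}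
    (hD : ∀ j, Summable fun l => dyadicBase ^ (8 * l) * D l j ^ 2) :
    ∃ C, 0 ≤ C ∧ ∀ y : C(T2, ℝ), (∀ x, |y x| ≤ K) →
      (∀ l j x, |y (x + dyadicShift l j) - y x| ≤ D l j) → ∀ f, InSob 2 f →
      ∀ S : Finset (Fin 2 → ℤ), 0 ∉ S →
      ∑ n ∈ S, ‖n‖ ^ (1 / 2 : ℝ) * ‖mFourierCoeff (density y (contRep f)) n‖ ^ 2
        ≤ C * (sob 1 f * sob (5 / 8) f) := by
  have hq := dyadicBase_pos
  have hG := geomSum_nonneg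
  have hc := l4Const_nonneg
  have hT : ∀ j, 0 ≤ ∑' l, dyadicBase ^ (8 * l) * D l j ^ 2 := fun j =>
    tsum_nonneg fun l => by positivity
  refine ⟨2 * ∑ j, 8 * Real.exp (2 * K) ^ 2 * (l4Const * (4 * geomSum)
    + l4Const * ∑' l, dyadicBase ^ (8 * l) * D l j ^ 2), ?_, ?_⟩
  · have := Finset.sum_nonneg fun j (_ : j ∈ Finset.univ) => hT j
    refine mul_nonneg two_pos.le (Finset.sum_nonneg fun j _ => ?_)
    have := hT j
    positivity
  intro y hy hyD f hf S hS
  have hf1 : InSob 1 f := hf.mono one_le_two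
  obtain ⟨L, hL⟩ := exists_sum_rpow_norm_mul_le (density y (contRep f)) S hS
  refine hL.trans ?_
  rw [mul_assoc 2, Finset.sum_mul]
  gcongr 2 * ?_
  refine Finset.sum_le_sum fun j _ => ?_
  have s1 := sob_nonneg 1 f
  have s2 := sob_nonneg (5 / 8) f
  have s3 : sob (5 / 8) f ≤ sob 1 f := sob_mono (by norm_num) hf1
  have h4 := sqrt_integral_contRep_pow_four_le hf
  have h4' : ∫ x, ‖contRep f x‖ ^ 4 ≤ l4Const * sob (5 / 8) f ^ 2 :=
    integral_norm_pow_four_le (hasSum_contRep hf) hf1.summable_five_eighths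
  have h1 : ∀ l, ∫ x, ‖density y (contRep f) (x + dyadicShift l j) - density y (contRep f) x‖ ^ 2
      ≤ 8 * Real.exp (2 * K) ^ 2 * (l4Const * sob (5 / 8) f * sobIncrement l j f
        + l4Const * (sob 1 f * sob (5 / 8) f) * D l j ^ 2) := by
    intro l
    refine (integral_norm_density_sub_sq_le (contRep f) hy (hyD l j)).trans ?_
    have e1 : Real.sqrt (∫ x, ‖contRep f x‖ ^ 4) *
        Real.sqrt (∫ x, ‖(translate (dyadicShift l j) (contRep f) - contRep f) x‖ ^ 4)
        ≤ l4Const * sob (5 / 8) f * sobIncrement l j f := by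
      refine (mul_le_mul h4 (sqrt_integral_increment_pow_four_le hf l j) (Real.sqrt_nonneg _)
        (by positivity)).trans (le_of_eq ?_)
      rw [mul_mul_mul_comm, Real.mul_self_sqrt hc]; ring
    have e2 : D l j ^ 2 * ∫ x, ‖contRep f x‖ ^ 4
        ≤ l4Const * (sob 1 f * sob (5 / 8) f) * D l j ^ 2 := by
      rw [mul_comm]
      gcongr
      refine h4'.trans ?_
      rw [sq]
      gcongr
    gcongr
  calc _ ≤ ∑ l ∈ Finset.range L, dyadicBase ^ (8 * l) *
        (8 * Real.exp (2 * K) ^ 2 * (l4Const * sob (5 / 8) f * sobIncrement l j f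
        + l4Const * (sob 1 f * sob (5 / 8) f) * D l j ^ 2)) :=
        Finset.sum_le_sum fun l _ => by gcongr; exact h1 l
    _ = 8 * Real.exp (2 * K) ^ 2 * (l4Const * sob (5 / 8) f *
          (∑ l ∈ Finset.range L, dyadicBase ^ (8 * l) * sobIncrement l j f)
        + l4Const * (sob 1 f * sob (5 / 8) f) *
          ∑ l ∈ Finset.range L, dyadicBase ^ (8 * l) * D l j ^ 2) := by
        rw [Finset.mul_sum, Finset.mul_sum, ← Finset.sum_add_distrib, Finset.mul_sum]
        refine Finset.sum_congr rfl fun l _ => ?_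
        ring
    _ ≤ 8 * Real.exp (2 * K) ^ 2 * (l4Const * sob (5 / 8) f * (4 * geomSum * sob 1 f)
        + l4Const * (sob 1 f * sob (5 / 8) f) * ∑' l, dyadicBase ^ (8 * l) * D l j ^ 2) := by
        gcongr
        · exact sum_sobIncrement_le hf1 j L
        · exact (hD j).sum_le_tsum _ fun l _ => by positivity
    _ = _ := by ring

lemma rpow_five_eighths_le {η x : ℝ} (hη : 0 < η) (hx : 0 < x) :
    x ^ (5 / 8 : ℝ) ≤ η * x + (η ^ (-(8 / 3) : ℝ)) ^ (5 / 8 : ℝ) := by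
  set X := η ^ (-(8 / 3) : ℝ) with hX
  have hX0 : 0 < X := Real.rpow_pos_of_pos hη _
  rcases le_total x X with h | h
  · have : x ^ (5 / 8 : ℝ) ≤ X ^ (5 / 8 : ℝ) := by gcongr
    nlinarith
  · have h1 : X ^ (-(3 / 8) : ℝ) = η := by
      rw [hX, ← Real.rpow_mul hη.le]; norm_num
    have h2 : x ^ (-(3 / 8) : ℝ) ≤ η := by
      rw [← h1]; exact Real.rpow_le_rpow_of_nonpos hX0 h (by norm_num)
    have h3 : x ^ (5 / 8 : ℝ) = x ^ (-(3 / 8) : ℝ) * x := by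
      rw [← Real.rpow_add_one hx.ne']; norm_num
    rw [h3]
    have : 0 ≤ X ^ (5 / 8 : ℝ) := Real.rpow_nonneg hX0.le _
    nlinarith

/-- Interpolation of `H^{5/8}` between `L²` and `H¹`. -/
lemma sob_five_eighths_le {η : ℝ} (hη : 0 < η) {f : L2} (hf : InSob 1 f) :
    sob (5 / 8) f ≤ η * sob 1 f + (η ^ (-(8 / 3) : ℝ)) ^ (5 / 8 : ℝ) * ‖f‖ ^ 2 := by
  rw [← (hasSum_norm_sq_coeff f).tsum_eq, sob, sob, ← tsum_mul_left, ← tsum_mul_left,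
    ← Summable.tsum_add (Summable.mul_left _ hf) ((hasSum_norm_sq_coeff f).summable.mul_left _)]
  refine Summable.tsum_le_tsum (fun n => ?_) hf.summable_five_eighths
    ((Summable.mul_left _ hf).add ((hasSum_norm_sq_coeff f).summable.mul_left _))
  rw [Real.rpow_one, ← mul_assoc, ← add_mul]
  gcongr
  exact rpow_five_eighths_le hη (one_add_normSq_pos n)

/-- `|∇y|²`. -/
def gradSq (dy : Fin 2 → C(T2, ℝ)) : C(T2, ℝ) := ∑ j, dy j ^ 2

lemma gradSq_apply (dy : Fin 2 → C(T2, ℝ)) (x : T2) : gradSq dy x = ∑ j, dy j x ^ 2 := by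
  simp [gradSq]

/-- The potential minus its mean is form bounded with relative bound zero with respect to
the Laplacian, uniformly in the field. -/
lemma exists_form_bound (K : ℝ) {D : ℕ → Fin 2 → ℝ} (B : ℝ)
    (hD : ∀ j, Summable fun l => dyadicBase ^ (8 * l) * D l j ^ 2) {δ : ℝ} (hδ : 0 < δ) :
    ∃ C, 0 ≤ C ∧ ∀ y dy, FieldBounds K D B y dy → ∃ m : ℝ, ∀ f, InSob 2 f →
      |(∫ x, (expWeight 2 y * gradSq dy) x * ‖contRep f x‖ ^ 2)
        - m * ∫ x, expWeight 2 y x * ‖contRep f x‖ ^ 2| ≤ δ * sob 1 f + C * ‖f‖ ^ 2 := by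
  obtain ⟨C₁, hC₁, h₁⟩ := exists_sum_density_le K hD
  set A := |B| * C₁ + 1 with hA
  have hA0 : 0 < A := by positivity
  refine ⟨A / (2 * δ) * ((δ ^ 2 / A) ^ (-(8 / 3) : ℝ)) ^ (5 / 8 : ℝ), by positivity,
    fun y dy hy => ⟨∫ x, gradSq dy x, fun f hf => ?_⟩⟩
  have hf1 : InSob 1 f := hf.mono one_le_two
  have s1 := sob_nonneg 1 f
  have s2 := sob_nonneg (5 / 8) f
  set P : C(T2, ℂ) := toC (gradSq dy) with hP
  set F : C(T2, ℂ) := density y (contRep f) with hF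
  have hP' : (P : T2 → ℂ) = fun x => ((∑ j, dy j x ^ 2 : ℝ) : ℂ) := by
    ext x; rw [hP, toC_apply, gradSq_apply]
  set u : (Fin 2 → ℤ) → ℂ := fun n => if n = 0 then 0 else
    conj (mFourierCoeff P n) * mFourierCoeff F n with hu
  have hsum : HasSum u ((((∫ x, (expWeight 2 y * gradSq dy) x * ‖contRep f x‖ ^ 2)
        - (∫ x, gradSq dy x) * ∫ x, expWeight 2 y x * ‖contRep f x‖ ^ 2 : ℝ)) : ℂ) := by
    have h2 := (hasSum_conj_mFourierCoeff_mul P F).sub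
      (hasSum_ite_eq (0 : Fin 2 → ℤ) (conj (mFourierCoeff P 0) * mFourierCoeff F 0))
    have e1 : (fun n => conj (mFourierCoeff P n) * mFourierCoeff F n - if n = 0 then
        conj (mFourierCoeff P 0) * mFourierCoeff F 0 else 0) = u := by
      ext n
      by_cases hn : n = 0
      · simp [hu, hn]
      · simp [hu, hn]
    have e2 : mFourierCoeff P 0 = ((∫ x, gradSq dy x : ℝ) : ℂ) := by
      simp only [mFourierCoeff, neg_zero, mFourier_zero, ContinuousMap.one_apply, one_smul, hP,
        toC_apply]
      exact integral_ofReal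
    have e3 : mFourierCoeff F 0 = ((∫ x, expWeight 2 y x * ‖contRep f x‖ ^ 2 : ℝ) : ℂ) := by
      simp only [mFourierCoeff, neg_zero, mFourier_zero, ContinuousMap.one_apply, one_smul, hF,
        density_apply]
      exact integral_ofReal
    have e4 : ∫ x, conj (P x) * F x
        = ((∫ x, (expWeight 2 y * gradSq dy) x * ‖contRep f x‖ ^ 2 : ℝ) : ℂ) := by
      rw [← integral_complex_ofReal]
      congr 1
      ext x
      rw [hP, hF, toC_apply, Complex.conj_ofReal, density_apply, ← Complex.ofReal_mul,
        ContinuousMap.mul_apply]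
      congr 1
      ring
    rw [e1, e4, e2, e3, Complex.conj_ofReal] at h2
    push_cast at h2 ⊢
    exact h2
  have hbound : ∀ S : Finset (Fin 2 → ℤ), ‖∑ n ∈ S, u n‖
      ≤ Real.sqrt (A * (sob 1 f * sob (5 / 8) f)) := by
    intro S
    rw [← Finset.sum_erase S (show u 0 = 0 by simp [hu])]
    set T := S.erase 0 with hT
    have hT0 : (0 : Fin 2 → ℤ) ∉ T := Finset.notMem_erase 0 S
    have hw := hy.wick T hT0
    rw [← hP'] at hw
    have hB : 0 ≤ |B| := abs_nonneg B
    refine (norm_sum_le _ _).trans (Real.le_sqrt_of_sq_le ?_)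
    calc _ ≤ (∑ n ∈ T, ‖n‖ ^ (-(1 / 2) : ℝ) * ‖mFourierCoeff P n‖ ^ 2) *
          ∑ n ∈ T, ‖n‖ ^ (1 / 2 : ℝ) * ‖mFourierCoeff F n‖ ^ 2 := by
          refine Finset.sum_sq_le_sum_mul_sum_of_sq_le_mul _ (fun n _ => by positivity)
            (fun n _ => by positivity) fun n hn => ?_
          have hn0 : n ≠ 0 := fun h => hT0 (h ▸ hn)
          have h3 : ‖n‖ ^ (-(1 / 2) : ℝ) * ‖n‖ ^ (1 / 2 : ℝ) = 1 := by
            rw [← Real.rpow_add (norm_pos_iff.2 hn0)]; norm_num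
          simp only [hu, if_neg hn0, norm_mul, RCLike.norm_conj, mul_pow]
          refine le_of_eq ?_
          linear_combination (-(‖mFourierCoeff P n‖ ^ 2 * ‖mFourierCoeff F n‖ ^ 2)) * h3
      _ ≤ |B| * (C₁ * (sob 1 f * sob (5 / 8) f)) := by
          refine mul_le_mul (hw.trans (le_abs_self B))
            (h₁ y hy.abs_le hy.increment f hf T hT0) ?_ hB
          exact Finset.sum_nonneg fun n _ => by positivity
      _ ≤ _ := by
          rw [← mul_assoc, hA]
          gcongr
          linarith
  have h5 := le_of_tendsto (f := fun S => ‖∑ n ∈ S, u n‖) hsum.norm (Eventually.of_forall hbound)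
  rw [Complex.norm_real, Real.norm_eq_abs] at h5
  refine h5.trans ?_
  have h6 := sob_five_eighths_le (η := δ ^ 2 / A) (by positivity) hf1
  -- Young's inequality
  have h7 : Real.sqrt (A * (sob 1 f * sob (5 / 8) f))
      ≤ δ / 2 * sob 1 f + A / (2 * δ) * sob (5 / 8) f := by
    apply Real.sqrt_le_iff.2 ⟨by positivity, ?_⟩
    have e : A * (sob 1 f * sob (5 / 8) f)
        = 4 * (δ / 2 * sob 1 f) * (A / (2 * δ) * sob (5 / 8) f) := by
      field_simp
      ring
    rw [e]
    nlinarith [sq_nonneg (δ / 2 * sob 1 f - A / (2 * δ) * sob (5 / 8) f)]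
  calc _ ≤ δ / 2 * sob 1 f + A / (2 * δ) * (δ ^ 2 / A * sob 1 f +
        ((δ ^ 2 / A) ^ (-(8 / 3) : ℝ)) ^ (5 / 8 : ℝ) * ‖f‖ ^ 2) := by
        refine h7.trans ?_
        gcongr
    _ = _ := by
        field_simp
        ring

/-! ### The uniform bound in `H¹` -/

lemma integrable_weight_mul_norm_sq (b : C(T2, ℝ)) (f : L2) :
    Integrable fun x => b x * ‖f x‖ ^ 2 :=
  ((Lp.memLp f).integrable_norm_pow two_ne_zero).bdd_mul (c := ‖b‖)
    b.continuous.aestronglyMeasurable (ae_of_all _ fun x => b.norm_coe_le_norm x)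

lemma norm_sq_eq_integral (f : L2) : ‖f‖ ^ 2 = ∫ x, ‖f x‖ ^ 2 :=
  (hasSum_norm_sq_coeff f).unique (hasSum_sq_mFourierCoeff f)

lemma exp_mul_norm_sq_le {y : C(T2, ℝ)} {K : ℝ} (hy : ∀ x, |y x| ≤ K) (f : L2) :
    (Real.exp (2 * K))⁻¹ * ‖f‖ ^ 2 ≤ ∫ x, expWeight 2 y x * ‖f x‖ ^ 2 := by
  rw [norm_sq_eq_integral, ← integral_const_mul, ← Real.exp_neg]
  refine integral_mono (((Lp.memLp f).integrable_norm_pow two_ne_zero).const_mul _)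
    (integrable_weight_mul_norm_sq _ f) fun x => ?_
  exact mul_le_mul_of_nonneg_right (le_expWeight zero_le_two hy x) (by positivity)

lemma integral_expWeight_le {y : C(T2, ℝ)} {K : ℝ} (hy : ∀ x, |y x| ≤ K) (f : L2) :
    ∫ x, expWeight 2 y x * ‖f x‖ ^ 2 ≤ Real.exp (2 * K) * ‖f‖ ^ 2 := by
  rw [norm_sq_eq_integral, ← integral_const_mul]
  refine integral_mono (integrable_weight_mul_norm_sq _ f)
    (((Lp.memLp f).integrable_norm_pow two_ne_zero).const_mul _) fun x => ?_
  exact mul_le_mul_of_nonneg_right (expWeight_le zero_le_two hy x) (by positivity)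

lemma potEnergy_le {y : C(T2, ℝ)} {K p A : ℝ} (hp : 0 ≤ p) (hy : ∀ x, |y x| ≤ K) {f : L2}
    (hf : InSob 2 f) (hA : sob 2 f ≤ A) :
    potEnergy y p f ≤ Real.exp (2 * K) * Real.exp (p * K) *
      Real.sqrt (japaneseSum * A) ^ (p + 2) := by
  have h1 : ∀ x, expWeight 2 y x * expWeight p y x * ‖contRep f x‖ ^ (p + 2)
      ≤ Real.exp (2 * K) * Real.exp (p * K) * Real.sqrt (japaneseSum * A) ^ (p + 2) := by
    intro x
    have h2 : ‖contRep f x‖ ≤ Real.sqrt (japaneseSum * A) := by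
      refine ((contRep f).norm_coe_le_norm x).trans ((norm_contRep_le hf).trans ?_)
      exact Real.sqrt_le_sqrt (mul_le_mul_of_nonneg_left hA japaneseSum_nonneg)
    have h3 := expWeight_le zero_le_two hy x
    have h4 := expWeight_le hp hy x
    have h5 : 0 ≤ expWeight 2 y x := Real.exp_nonneg _
    have h6 : 0 ≤ expWeight p y x := Real.exp_nonneg _
    gcongr
  have h2 : Continuous fun x => ‖contRep f x‖ := by fun_prop
  have h3 := h2.rpow_const (p := p + 2) fun _ => Or.inr (by linarith)
  refine (integral_mono (integrable_of_continuous (by fun_prop)) (integrable_const _) h1).trans ?_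
  simp

/-- Conservation of mass and energy bounds the `H¹` norm for all times, by a quantity that
depends on the field only through the bounds `K`, `D` and `B`. Subtracting a constant `c` from the
potential changes the energy by a multiple of the mass, so the bound does not depend on `c`. -/
theorem exists_uniform_bound (K : ℝ) {D : ℕ → Fin 2 → ℝ} (B : ℝ)
    (hD : ∀ j, Summable fun l => dyadicBase ^ (8 * l) * D l j ^ 2) {p lam : ℝ} (hp : 2 ≤ p)
    (hp0 : 0 ≤ p) (hlam : lam ≤ 0) (A : ℝ) :
    ∃ R, ∀ y dy, IsGradient y dy → FieldBounds K D B y dy → ∀ (c : ℝ) (v : ℝ → L2),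
      IsFlow y dy (gradSq dy - ContinuousMap.const T2 c) hp0 lam v → sob 2 (v 0) ≤ A →
      ∀ t, sob 1 (v t) ≤ R := by
  set E := Real.exp (2 * K) with hE
  have hE0 : 0 < E := Real.exp_pos _
  obtain ⟨C, hC, hform⟩ := exists_form_bound K B hD (δ := E⁻¹ / 2) (by positivity)
  set κ := -(2 * lam / (p + 2)) with hκ
  have hκ0 : 0 ≤ κ := by
    rw [hκ, ← neg_div]
    exact div_nonneg (by linarith) (by linarith)
  set N := E * Real.exp (p * K) * Real.sqrt (japaneseSum * A) ^ (p + 2) with hN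
  refine ⟨2 * E * ((E⁻¹ + C) * (E ^ 2 * A) + E * A + E⁻¹ / 2 * A + C * A + κ * N), ?_⟩
  intro y dy hy hb c v hv hA t
  obtain ⟨m, hm⟩ := hform y dy hb
  have hi : ∀ {F : T2 → ℝ}, Continuous F → Integrable F := fun hF => integrable_of_continuous hF
  set M : ℝ → ℝ := fun t => (⟪v t, mulL (toC (expWeight 2 y)) (v t)⟫_ℂ).re with hM
  -- the potential form, corrected by a multiple of the conserved mass
  set X : ℝ → ℝ := fun t => (∫ x, (expWeight 2 y * gradSq dy) x * ‖contRep (v t) x‖ ^ 2)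
    - m * ∫ x, expWeight 2 y x * ‖contRep (v t) x‖ ^ 2 with hX
  have hMt : ∀ t, M t = ∫ x, expWeight 2 y x * ‖v t x‖ ^ 2 := fun t => by
    rw [hM]; simp only [inner_mulL_self, Complex.ofReal_re]
  have hq : ∀ t, (⟪v t, mulL (toC (expWeight 2 y * (gradSq dy - ContinuousMap.const T2 c)))
      (v t)⟫_ℂ).re = X t + (m - c) * M t := by
    intro t
    simp only [hX, hM, re_inner_mulL_self (hv.inSob t)]
    have e1 : ∀ x, (expWeight 2 y * (gradSq dy - ContinuousMap.const T2 c)) x *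
        ‖contRep (v t) x‖ ^ 2 = (expWeight 2 y * gradSq dy) x * ‖contRep (v t) x‖ ^ 2
        - c * (expWeight 2 y x * ‖contRep (v t) x‖ ^ 2) := fun x => by
      simp only [ContinuousMap.mul_apply, ContinuousMap.sub_apply, ContinuousMap.const_apply]
      ring
    simp only [e1]
    rw [integral_sub (hi (by fun_prop)) (hi (by fun_prop)), integral_const_mul]
    ring
  have henergy := hv.energy_eq hy hp t 0
  have hmass : M t = M 0 := hv.mass_eq hy t 0
  rw [hq, hq, hmass] at henergy
  have n1 : ‖v t‖ ^ 2 ≤ E * M t := by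
    have := exp_mul_norm_sq_le hb.abs_le (v t)
    rw [← hMt, inv_mul_le_iff₀ hE0] at this
    exact this
  have s0 : sob 1 (v 0) ≤ A := (sob_mono one_le_two (hv.inSob 0)).trans hA
  have n0 : ‖v 0‖ ^ 2 ≤ A := by
    rw [← sob_zero]; exact (sob_mono zero_le_two (hv.inSob 0)).trans hA
  have n2 : M 0 ≤ E * A := by
    rw [hMt]
    exact (integral_expWeight_le hb.abs_le (v 0)).trans (by gcongr)
  have n3 : ‖v t‖ ^ 2 ≤ E ^ 2 * A := by
    rw [hmass] at n1
    calc _ ≤ E * M 0 := n1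
      _ ≤ E * (E * A) := by gcongr
      _ = _ := by ring
  have d0 : dirichlet y (v 0) ≤ E * A := by
    have h1 : dirichlet y (v 0) ≤ ∑ j, E * ‖partialDeriv j (v 0)‖ ^ 2 :=
      Finset.sum_le_sum fun j _ => integral_expWeight_le hb.abs_le _
    rw [← Finset.mul_sum] at h1
    refine h1.trans ?_
    gcongr
    have := sob_one_eq ((hv.inSob 0).mono one_le_two)
    have := sq_nonneg ‖v 0‖
    linarith
  have dt : E⁻¹ * (sob 1 (v t) - ‖v t‖ ^ 2) ≤ dirichlet y (v t) := by
    rw [sob_one_eq ((hv.inSob t).mono one_le_two), add_sub_cancel_left, Finset.mul_sum]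
    exact Finset.sum_le_sum fun j _ => exp_mul_norm_sq_le hb.abs_le _
  have x0 := (abs_le.1 (hm (v 0) (hv.inSob 0))).1
  have xt := (abs_le.1 (hm (v t) (hv.inSob t))).2
  have p0 := potEnergy_le hp0 hb.abs_le (hv.inSob 0) hA
  have pt := mul_nonneg hκ0 (potEnergy_nonneg y p (v t))
  have p1 : κ * potEnergy y p (v 0) ≤ κ * N := by gcongr
  have i0 : E⁻¹ / 2 * sob 1 (v 0) ≤ E⁻¹ / 2 * A := by gcongr
  have i1 : C * ‖v 0‖ ^ 2 ≤ C * A := by gcongr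
  have i2 : (E⁻¹ + C) * ‖v t‖ ^ 2 ≤ (E⁻¹ + C) * (E ^ 2 * A) := by gcongr
  have key : E⁻¹ / 2 * sob 1 (v t)
      ≤ (E⁻¹ + C) * (E ^ 2 * A) + E * A + E⁻¹ / 2 * A + C * A + κ * N := by
    have e : 2 * lam / (p + 2) = -κ := by rw [hκ, neg_neg]
    rw [e] at henergy
    simp only [hX] at henergy
    linarith
  calc sob 1 (v t) = 2 * E * (E⁻¹ / 2 * sob 1 (v t)) := by field_simp
    _ ≤ _ := by gcongr

lemma mFourierCoeff_congr_ae {f g : T2 → ℂ} (h : f =ᵐ[volume] g) (n : Fin 2 → ℤ) :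
    mFourierCoeff f n = mFourierCoeff g n := by
  apply integral_congr_ae
  filter_upwards [h] with x hx
  rw [hx]

lemma sobolevNorm_congr_ae {f g : T2 → ℂ} (h : f =ᵐ[volume] g) (s : ℝ) :
    sobolevNorm s f = sobolevNorm s g := by
  simp only [sobolevNorm, mFourierCoeff_congr_ae h]

lemma sob_eq_toReal_sq {s : ℝ} {f : L2} (h : InSob s f) :
    sob s f = (sobolevNorm s f).toReal ^ 2 := by
  rw [sobolevNorm_eq h, ENNReal.toReal_ofReal (Real.sqrt_nonneg _), Real.sq_sqrt (sob_nonneg s f)]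

/-- A solution of the gauged equation is a flow with potential `|∇Y_ε|² - C_ε`; that `Y_ε` and
`C_ε` are real enters here. -/
lemma IsGaugedSolution.isFlow {χ : EuclideanSpace ℝ (Fin 2) → ℝ} {ε : ℝ} {γ : (Fin 2 → ℤ) → ℂ}
    {p lam : ℝ} {v₀ : T2 → ℂ} {v : ℝ → L2} (h : IsGaugedSolution χ ε γ p lam v₀ v) (hp : 0 ≤ p)
    {y : C(T2, ℝ)} {dy : Fin 2 → C(T2, ℝ)} (hy : ∀ x, Yeps χ ε γ x = y x)
    (hdy : ∀ j x, partialYeps χ ε γ j x = dy j x) :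
    IsFlow y dy (gradSq dy - ContinuousMap.const T2 (Ceps χ ε).re) hp lam v := by
  have hs : ∀ t, InSob 2 (v t) := fun t => summable_sob (h.mem_H2 t).2
  refine ⟨hs, fun t₀ => ?_, h.differentiable, fun t => ?_⟩
  · have h1 := (ENNReal.tendsto_toReal ENNReal.zero_ne_top).comp (h.continuous_H2 t₀)
    have h2 := h1.pow 2
    simp only [ENNReal.toReal_zero, ne_eq, OfNat.ofNat_ne_zero, not_false_eq_true, zero_pow] at h2
    refine h2.congr fun t => ?_
    rw [sob_eq_toReal_sq ((hs t).sub (hs t₀))]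
    rfl
  · have hC : ((Ceps χ ε).re : ℂ) = Ceps χ ε := Complex.conj_eq_iff_re.1 (conj_Ceps ε)
    rw [Fin.sum_univ_two]
    set Q := gradSq dy - ContinuousMap.const T2 (Ceps χ ε).re
      + lam • (expWeight p y * absPow hp (contRep (v t))) with hQ
    set G := mulL (toC (dy 0)) (partialDeriv 0 (v t)) + mulL (toC (dy 1)) (partialDeriv 1 (v t))
      with hG
    apply Lp.ext
    filter_upwards [h.equation t, Lp.coeFn_smul Complex.I (deriv v t),
      Lp.coeFn_add (laplacian (v t) - (2 : ℂ) • G) (mulL (toC Q) (v t)),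
      Lp.coeFn_sub (laplacian (v t)) ((2 : ℂ) • G), Lp.coeFn_smul (2 : ℂ) G,
      Lp.coeFn_add (mulL (toC (dy 0)) (partialDeriv 0 (v t)))
        (mulL (toC (dy 1)) (partialDeriv 1 (v t))),
      coe_mulL (toC (dy 0)) (partialDeriv 0 (v t)), coe_mulL (toC (dy 1)) (partialDeriv 1 (v t)),
      coe_mulL (toC Q) (v t), coe_contRep (hs t)] with x e0 e1 e2 e3 e4 e5 e6 e7 e8 e9
    rw [e1, e2, Pi.smul_apply, Pi.add_apply, e3, Pi.sub_apply, e4, Pi.smul_apply, hG, e5,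
      Pi.add_apply, e6, e7, e8, smul_eq_mul, smul_eq_mul, e0, wickSq, Fin.sum_univ_two, hdy, hdy]
    simp only [hy, hdy, hQ, toC_apply, ContinuousMap.add_apply, ContinuousMap.sub_apply,
      ContinuousMap.smul_apply, ContinuousMap.mul_apply, ContinuousMap.const_apply, gradSq_apply,
      expWeight_apply, absPow_apply, smul_eq_mul, Complex.norm_real, Real.norm_eq_abs, sq_abs, ← e9]
    push_cast
    linear_combination v t x * hC

end

end GaugedNLS

theorem mainTheorem6 {Ω : Type*} [MeasurableSpace Ω] (P : Measure Ω) [IsProbabilityMeasure P]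
    (g : (Fin 2 → ℤ) → Ω → ℂ) (hg : IsWhiteNoise P g)
    (χ : EuclideanSpace ℝ (Fin 2) → ℝ) (hχ : IsMollifier χ)
    (p lam : ℝ) (hp : p ∈ Set.Icc (2 : ℝ) 3) (hlam : lam ≤ 0)
    (u₀ : Ω → T2 → ℂ)
    (hu₀ : ∀ᵐ ω ∂P, MemSobolev 2 (gaugedDatum (fun n => g n ω) (u₀ ω)))
    (E₀ : Set Ω) (hE₀ : MeasurableSet E₀) (hPE₀ : P E₀ = 1) :
    ∃ E : Set Ω, E ⊆ E₀ ∧ MeasurableSet E ∧ P E = 1 ∧ ∀ ω ∈ E, ∃ C : ℝ≥0, 0 < C ∧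
      (⨆ ε ∈ Set.Ioo (0 : ℝ) 1, ⨆ v : ℝ → L2,
        ⨆ _ : IsGaugedSolution χ ε (fun n => g n ω) p lam
          (gaugedDatum (fun n => g n ω) (u₀ ω)) v,
        ⨆ t : ℝ, sobolevNorm 1 (v t)) < C ∧
      MemLp (gaugedDatum (fun n => g n ω) (u₀ ω)) 2 volume ∧
      sobolevNorm 2 (gaugedDatum (fun n => g n ω) (u₀ ω)) < C := by
  have hE₀' : ∀ᵐ ω ∂P, ω ∈ E₀ := (mem_ae_iff_prob_eq_one hE₀).2 hPE₀
  obtain ⟨E, hEae, hEm, hE⟩ :=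
    (hE₀'.and (hu₀.and (hg.ae_goodRealisation hχ))).exists_measurable_mem
  refine ⟨E, fun ω hω => (hE ω hω).1, hEm, (mem_ae_iff_prob_eq_one hEm).1 hEae, fun ω hω => ?_⟩
  obtain ⟨-, hu, hgood⟩ := hE ω hω
  set v₀ := gaugedDatum (fun n => g n ω) (u₀ ω)
  have hp0 : 0 ≤ p := by linarith [hp.1]
  obtain ⟨K, D, B, hD, hfields⟩ := hgood.exists_fields
  obtain ⟨R, hR⟩ := exists_uniform_bound K B hD hp.1 hp0 hlam ((sobolevNorm 2 v₀).toReal ^ 2)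
  have hsup : (⨆ ε ∈ Set.Ioo (0 : ℝ) 1, ⨆ v : ℝ → L2,
      ⨆ _ : IsGaugedSolution χ ε (fun n => g n ω) p lam v₀ v, ⨆ t : ℝ, sobolevNorm 1 (v t))
      ≤ ENNReal.ofReal (Real.sqrt R) := by
    refine iSup₂_le fun ε hε => iSup₂_le fun v hv => iSup_le fun t => ?_
    obtain ⟨y, dy, hy, hdy, hgrad, hbounds⟩ := hfields ε hε
    have hflow := hv.isFlow hp0 hy hdy
    rw [sobolevNorm_eq ((hflow.inSob t).mono one_le_two)]
    refine ENNReal.ofReal_le_ofReal (Real.sqrt_le_sqrt (hR y dy hgrad hbounds _ v hflow ?_ t))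
    rw [sob_eq_toReal_sq (hflow.inSob 0), sobolevNorm_congr_ae hv.initial]
  refine ⟨(Real.sqrt R).toNNReal + (sobolevNorm 2 v₀).toNNReal + 1, by positivity, ?_, hu.1, ?_⟩
  · refine hsup.trans_lt ?_
    rw [ENNReal.ofReal, ENNReal.coe_lt_coe, add_assoc]
    exact lt_add_of_pos_right _ (by positivity)
  · rw [← ENNReal.coe_toNNReal hu.2.ne, ENNReal.coe_lt_coe, ENNReal.toNNReal_coe]
    calc _ < (sobolevNorm 2 v₀).toNNReal + 1 := lt_add_one _
      _ ≤ _ := by gcongr; exact le_add_self
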